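/- **Setting.** For strings $u,v$ let $L(u,v)$ be the length of their longest common subsequence and $M(u,v)$ the number of matching pairs, i.e. of pairs of positions $(a,b)$ with $u[a]=v[b]$. Let $x,y$ be strings of length $n\ge 1$ and let $T$ be an integer with $n\le T\le n^2$. Put $m=\lceil n/\sqrt T\rceil$ and split $x$ into consecutive blocks $x_1,\dots,x_K$ and $y$ into consecutive blocks $y_1,\dots,y_K$ of length $m$, where $K=\lceil n/m\rceil$ (the last block may be shorter). A *block sequence* is a set $\mathcal S=\{(i_1,j_1),\dots,(i_k,j_k)\}\subseteq\{1,\dots,K\}^2$ with $i_1<\dots<i_k$ and $j_1<\dots<j_k$. Let $$L=L(x,y),\qquad \lambda=\sum_{i,j=1}^{K} L(x_i,y_j),\qquad \mu=\max_{\mathcal S\text{ block sequence}}\ \sum_{(i,j)\in\mathcal S} M(x_i,y_j).$$ **Theorem.** For every constant $c>0$ and every constant $A\in\mathbb N$ there are a randomized random access machine program and constants $C>0$, $k\in\mathbb N$ (depending only on $c$ and $A$) such that the following holds for all $n\ge 1$, all integers $T\in[n,n^2]$ and all strings $x,y$ of length $n$ over the alphabet $\{0,1,\dots,An\}$. On input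 $(n,T,x,y)$ the program has expected running time at most $C(1+\log n)^k\,T$, i.e. $\widetilde O(T)$, and outputs a number $\widetilde L$ such that $\widetilde L\le L$ (with probability $1$) and, with probability at least $1-n^{-c}$, $$\widetilde L\ \ge\ \frac{1}{C(1+\log n)^k}\,\min\Big\{\frac{\lambda}{\sqrt T},\ \frac{\lambda\sqrt T}{\mu}\Big\},$$ i.e. $\widetilde L=\widetilde\Omega\big(\min\{\lambda/\sqrt T,\ \lambda\sqrt T/\mu\}\big)$. (If $\mu=0$ then $\lambda=0$ and the minimum is read as $0$.) Running time is measured on a RAM with uniform random integers under the logarithmic cost criterion, where every operation costs one plus the bit lengths of the numbers involved; on polynomially bounded numbers this agrees with the unit-cost word RAM up to a logarithmic factor. -/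

import Mathlib

open scoped ENNReal

/-! ### Strings, common subsequences, matching pairs -/

/-- `L(x,y)`: the length of a longest common subsequence of two strings. -/
noncomputable def lcsLen (x y : List ℕ) : ℕ :=
  sSup {k : ℕ | ∃ z : List ℕ, z.Sublist x ∧ z.Sublist y ∧ z.length = k}

/-- `M(x,y)`: the number of matching pairs, i.e. pairs of positions carrying the same symbol. -/
def matchingPairs (x y : List ℕ) : ℕ :=
  (Finset.univ.filter fun p : Fin x.length × Fin y.length => x.get p.1 = y.get p.2).card

/-! ### Blocks -/

/-- The block length `m = n / √T`, rounded up to an integer. -/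
noncomputable def blockLen (n T : ℕ) : ℕ := ⌈(n : ℝ) / √(T : ℝ)⌉₊

/-- The number `n / m` of blocks of length `m`, rounded up (the last block may be shorter). -/
def numBlocks (n m : ℕ) : ℕ := (n + m - 1) / m

/-- The `i`-th block (`i = 0, 1, …`) of the string `x`, for block length `m`. -/
def block (x : List ℕ) (m i : ℕ) : List ℕ := (x.drop (i * m)).take m

/-- A block sequence: a set of blocks `(i₁,j₁), …, (i_k,j_k)` with `i₁ < … < i_k` and
`j₁ < … < j_k`. -/
def IsBlockSeq (S : Finset (ℕ × ℕ)) : Prop :=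
  ∀ p ∈ S, ∀ q ∈ S, p ≠ q → (p.1 < q.1 ∧ p.2 < q.2) ∨ (q.1 < p.1 ∧ q.2 < p.2)

/-- `λ = ∑_{i,j} L(x_i, y_j)`, the total LCS length over all blocks. -/
noncomputable def blockLambda (n T : ℕ) (x y : List ℕ) : ℕ :=
  ∑ p ∈ Finset.range (numBlocks n (blockLen n T)) ×ˢ Finset.range (numBlocks n (blockLen n T)),
    lcsLen (block x (blockLen n T) p.1) (block y (blockLen n T) p.2)

open Classical in
/-- `μ`, the maximum of `∑_{(i,j) ∈ S} M(x_i, y_j)` over all block sequences `S`. -/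
noncomputable def blockMu (n T : ℕ) (x y : List ℕ) : ℕ :=
  ((Finset.range (numBlocks n (blockLen n T)) ×ˢ
      Finset.range (numBlocks n (blockLen n T))).powerset.filter IsBlockSeq).sup
    fun S => ∑ p ∈ S,
      matchingPairs (block x (blockLen n T) p.1) (block y (blockLen n T) p.2)

/-! ### Randomized random access machine with logarithmic cost

A program is a finite structured text over finitely many registers and arrays of natural
numbers; arrays are randomly accessible. Every operation is charged one unit plus the bit lengths
of the numbers it handles (the logarithmic cost criterion), so that large numbers are not free.
On numbers that are polynomial in the input length this is the unit cost word RAM up to a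
logarithmic factor. -/

namespace RAM

/-- A memory state: registers and arrays. -/
structure State where
  var : ℕ → ℕ
  arr : ℕ → ℕ → ℕ

def State.setVar (s : State) (v a : ℕ) : State :=
  ⟨Function.update s.var v a, s.arr⟩

def State.setArr (s : State) (b i a : ℕ) : State :=
  ⟨s.var, Function.update s.arr b (Function.update (s.arr b) i a)⟩

inductive Op
  | add | sub | mul | div | mod | lt | eq

/-- Arithmetic on natural numbers (truncated subtraction, rounded division), and comparisons with
truth values `1` and `0`. -/
def Op.apply : Op → ℕ → ℕ → ℕ
  | .add, a, b => a + b
  | .sub, a, b => a - b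
  | .mul, a, b => a * b
  | .div, a, b => a / b
  | .mod, a, b => a % b
  | .lt, a, b => if a < b then 1 else 0
  | .eq, a, b => if a = b then 1 else 0

inductive Expr
  | const (a : ℕ)
  | var (v : ℕ)
  | get (b : ℕ) (i : Expr)
  | bin (o : Op) (e f : Expr)

def Expr.val (s : State) : Expr → ℕ
  | .const a => a
  | .var v => s.var v
  | .get b i => s.arr b (i.val s)
  | .bin o e f => o.apply (e.val s) (f.val s)

/-- The time to evaluate an expression: for each node, one plus the bit length of its value. -/
def Expr.cost (s : State) : Expr → ℕ
  | .const a => 1 + a.size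
  | .var v => 1 + (s.var v).size
  | .get b i => 1 + i.cost s + (s.arr b (i.val s)).size
  | .bin o e f => 1 + e.cost s + f.cost s + (o.apply (e.val s) (f.val s)).size

/-- `rand v e` draws a uniformly random number from `{0, …, a - 1}`, where `a` is the value of `e`,
and stores it in register `v`; `loop e c` is `while e ≠ 0 do c`. -/
inductive Prog
  | skip
  | assign (v : ℕ) (e : Expr)
  | store (b : ℕ) (i e : Expr)
  | rand (v : ℕ) (e : Expr)
  | seq (c d : Prog)
  | ite (e : Expr) (c d : Prog)
  | loop (e : Expr) (c : Prog)

/-- The uniform distribution on `{0, …, a - 1}` (on `{0}` if `a = 0`). -/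
noncomputable def uniformBelow (a : ℕ) : PMF ℕ :=
  PMF.uniformOfFinset (Finset.range (max a 1)) ⟨0, by simp⟩

/-- The result of a computation that was cut off (`none`), or that halted in a state after some
time. -/
abbrev Outcome := Option (State × ℕ)

/-- Charge `t` additional units of time. -/
noncomputable def tick (t : ℕ) (p : PMF Outcome) : PMF Outcome :=
  p.map (Option.map fun r => (r.1, t + r.2))

/-- Sequential composition; the times add up. -/
noncomputable def andThen (p : PMF Outcome) (f : State → PMF Outcome) : PMF Outcome :=
  p.bind fun r => match r with
    | none => PMF.pure none
    | some (s, t) => tick t (f s)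

/-- `while e ≠ 0 do body`, cut off when the test is about to be made for the `N+1`-st time. -/
noncomputable def iterate (e : Expr) (body : State → PMF Outcome) : ℕ → State → PMF Outcome
  | 0, _ => PMF.pure none
  | N + 1, s => tick (1 + e.cost s) <|
      if e.val s = 0 then PMF.pure (some (s, 0)) else andThen (body s) (iterate e body N)

/-- The distribution of the outcome of a program started in a given state, where every execution
of a loop is cut off after `fuel` tests. -/
noncomputable def exec (fuel : ℕ) : Prog → State → PMF Outcome
  | .skip, s => PMF.pure (some (s, 1))
  | .assign v e, s => PMF.pure (some (s.setVar v (e.val s), 1 + e.cost s))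
  | .store b i e, s =>
      PMF.pure (some (s.setArr b (i.val s) (e.val s), 1 + i.cost s + e.cost s))
  | .rand v e, s =>
      (uniformBelow (e.val s)).map fun a => some (s.setVar v a, 1 + e.cost s)
  | .seq c d, s => andThen (exec fuel c s) (exec fuel d)
  | .ite e c d, s => tick (1 + e.cost s) <|
      if e.val s = 0 then exec fuel d s else exec fuel c s
  | .loop e c, s => iterate e (exec fuel c) fuel s

/-- The probability that program `P`, started in state `s`, halts with a (final state, running
time) in the set `E`. The probabilities for bounded `fuel` increase to this limit. -/
noncomputable def haltProb (P : Prog) (s : State) (E : Set (State × ℕ)) : ℝ≥0∞ :=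
  ⨆ fuel : ℕ, (exec fuel P s).toOuterMeasure (some '' E)

/-- The expected running time `E[τ] = ∑_{t ≥ 0} Pr[τ > t]`, where `τ = ∞` if `P` does not halt. -/
noncomputable def expectedTime (P : Prog) (s : State) : ℝ≥0∞ :=
  ∑' t : ℕ, (1 - haltProb P s {r | r.2 ≤ t})

/-- The initial state: `n` and `T` in registers `0` and `1`, the strings in arrays `0` and `1`;
the rest of the memory is zero. -/
def input (n T : ℕ) (x y : List ℕ) : State where
  var v := if v = 0 then n else if v = 1 then T else 0
  arr b i := if b = 0 then x.getD i 0 else if b = 1 then y.getD i 0 else 0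

/-- The output is the content of register `0`. -/
def State.output (s : State) : ℕ := s.var 0

end RAM

/-! Fix `d` and consider the blocks `(i, i + d - K)`, a diagonal (`d = K` is the main one). Longest
common subsequences of its blocks concatenate to a chain of matching pairs, strictly increasing in
both coordinates, of some length `W(d)` (`exists_chain_diag`), and the `W(d)` add up to at least `λ`
(`blockLambda_le_sum_diagWeight`). A diagonal is a block sequence, so it carries at most `μ`
matching pairs (`sum_rowOcc_le_blockMu`). The number of diagonals, padded to a power of two `D`, is
`O(√T)`. By dyadic pigeonholing (`exists_dyadic_level`) some `w = 2 ^ κ` and `N ≥ 1` satisfy `λ ≤ 2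
L w N`, where `N` diagonals have `W(d) ≥ w`; here `L` is the bit length of `n`.

An attempt draws a random diagonal and one random row out of every `g` consecutive rows. By patience
sorting it finds a longest chain among the matching pairs of the diagonal in these rows, handling at
most `T / a` pairs. Suppose `W(d) ≥ w` and `g T ≥ a (n + 4 μ)`. The expected number of sampled pairs
is at most `μ / g`, so by Markov's inequality the budget rarely runs out. The expected number of
chain elements kept is at least `w / g`, and a Chernoff bound gives at least `w / (4 g)` of them if
`w ≥ 8 g`. Hence such an attempt succeeds with probability at least `1/2` (`drawAvg_fail_diag_le`).
If also `a ≥ D / N`, then `a * rep` attempts all fail with probability at most `exp (-rep / 2)`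
(`le_drawAvg_exists_succeeds`). They visit `a (n / g + 2) = O(T)` rows and at most `a (T / a) ≤ T`
pairs per repetition.

The right `a` and `g` are unknown, so all pairs of powers of two are tried, except those with too
many rows. For the smallest suitable `a` and `g`, `min_le_of_level` bounds the minimum in the
theorem by `O(L w / g)`. If `w < 8 g` this is `O(L)`, and it suffices to detect deterministically
whether any matching pair exists. The output never exceeds the true LCS length, because every
recorded chain length is witnessed by a common subsequence (`Patience`).

All random numbers are drawn into an array beforehand and everything else is deterministic. So a
Hoare logic with time (`Tri`) handles the program, probabilities become averages over tapes
(`drawAvg`), and `le_haltProb_draw` connects the two. The time bound holds for every tape. All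
numbers are polynomial in `n`, which makes each operation cost `O(log n)` (`Expr.cost_le`). -/

namespace RAM

/-! ### Big-step semantics of programs without random choices -/

/-- `Big P s s' t`: the program `P`, which draws no random numbers on this run, leads from `s` to
`s'` in time `t`. -/
inductive Big : Prog → State → State → ℕ → Prop
  | skip (s) : Big .skip s s 1
  | assign (s v e) : Big (.assign v e) s (s.setVar v (e.val s)) (1 + e.cost s)
  | store (s b i e) :
      Big (.store b i e) s (s.setArr b (i.val s) (e.val s)) (1 + i.cost s + e.cost s)
  | seq {c d s s₁ s₂ t₁ t₂} : Big c s s₁ t₁ → Big d s₁ s₂ t₂ → Big (.seq c d) s s₂ (t₁ + t₂)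
  | ite_true {e c d s s₁ t} : e.val s ≠ 0 → Big c s s₁ t →
      Big (.ite e c d) s s₁ (1 + e.cost s + t)
  | ite_false {e c d s s₁ t} : e.val s = 0 → Big d s s₁ t →
      Big (.ite e c d) s s₁ (1 + e.cost s + t)
  | loop_false {e c s} : e.val s = 0 → Big (.loop e c) s s (1 + e.cost s)
  | loop_true {e c s s₁ s₂ t₁ t₂} : e.val s ≠ 0 → Big c s s₁ t₁ → Big (.loop e c) s₁ s₂ t₂ →
      Big (.loop e c) s s₂ (1 + e.cost s + (t₁ + t₂))

theorem tick_pure (t : ℕ) (s : State) (u : ℕ) :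
    tick t (PMF.pure (some (s, u))) = PMF.pure (some (s, t + u)) := by
  simp [tick, PMF.pure_map]

theorem andThen_pure (s : State) (t : ℕ) (f : State → PMF Outcome) :
    andThen (PMF.pure (some (s, t))) f = tick t (f s) := by
  simp [andThen, PMF.pure_bind]

/-- The second conjunct strengthens the induction. Unfolding a loop lowers its count of remaining
tests `N` while the fuel of the body stays the same, so the two have to vary independently. -/
theorem Big.exec_eq {P : Prog} {s s' : State} {t : ℕ} (h : Big P s s' t) :
    ∃ F, ∀ fuel ≥ F, exec fuel P s = PMF.pure (some (s', t)) ∧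
      ∀ e c, P = .loop e c → ∀ N ≥ F, iterate e (exec fuel c) N s = PMF.pure (some (s', t)) := by
  induction h with
  | skip s => exact ⟨0, fun _ _ => ⟨rfl, fun _ _ h => by cases h⟩⟩
  | assign s v e => exact ⟨0, fun _ _ => ⟨rfl, fun _ _ h => by cases h⟩⟩
  | store s b i e => exact ⟨0, fun _ _ => ⟨rfl, fun _ _ h => by cases h⟩⟩
  | seq _ _ ih₁ ih₂ =>
    obtain ⟨F₁, h₁⟩ := ih₁
    obtain ⟨F₂, h₂⟩ := ih₂
    refine ⟨max F₁ F₂, fun fuel hf => ⟨?_, fun _ _ h => by cases h⟩⟩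
    rw [exec, (h₁ fuel (le_trans (le_max_left _ _) hf)).1, andThen_pure,
      (h₂ fuel (le_trans (le_max_right _ _) hf)).1, tick_pure]
  | ite_true he _ ih =>
    obtain ⟨F, h⟩ := ih
    refine ⟨F, fun fuel hf => ⟨?_, fun _ _ h => by cases h⟩⟩
    rw [exec, if_neg he, (h fuel hf).1, tick_pure]
  | ite_false he _ ih =>
    obtain ⟨F, h⟩ := ih
    refine ⟨F, fun fuel hf => ⟨?_, fun _ _ h => by cases h⟩⟩
    rw [exec, if_pos he, (h fuel hf).1, tick_pure]
  | @loop_false e c s he =>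
    have key : ∀ fuel, ∀ N ≥ 1,
        iterate e (exec fuel c) N s = PMF.pure (some (s, 1 + e.cost s)) := by
      intro fuel N hN
      obtain ⟨N, rfl⟩ := Nat.exists_eq_succ_of_ne_zero (by omega : N ≠ 0)
      rw [iterate, if_pos he, tick_pure, Nat.add_zero]
    refine ⟨1, fun fuel hf => ⟨by rw [exec]; exact key fuel fuel hf, ?_⟩⟩
    intro e' c' h N hN
    cases h
    exact key fuel N hN
  | @loop_true e c s s₁ s₂ t₁ t₂ he _ _ ih₁ ih₂ =>
    obtain ⟨F₁, h₁⟩ := ih₁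
    obtain ⟨F₂, h₂⟩ := ih₂
    have key : ∀ fuel ≥ max F₁ F₂ + 1, ∀ N ≥ max F₁ F₂ + 1,
        iterate e (exec fuel c) N s = PMF.pure (some (s₂, 1 + e.cost s + (t₁ + t₂))) := by
      intro fuel hf N hN
      obtain ⟨N, rfl⟩ := Nat.exists_eq_succ_of_ne_zero (by omega : N ≠ 0)
      rw [iterate, if_neg he, (h₁ fuel (by omega)).1, andThen_pure,
        (h₂ fuel (by omega)).2 e c rfl N (by omega), tick_pure, tick_pure]
    refine ⟨max F₁ F₂ + 1, fun fuel hf => ⟨by rw [exec]; exact key fuel hf fuel hf, ?_⟩⟩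
    intro e' c' h N hN
    cases h
    exact key fuel hf N hN

/-- Whether a program may write to the register `v`. -/
def Prog.writesVar (v : ℕ) : Prog → Bool
  | .skip => false
  | .assign w _ => w == v
  | .store _ _ _ => false
  | .rand w _ => w == v
  | .seq c d => c.writesVar v || d.writesVar v
  | .ite _ c d => c.writesVar v || d.writesVar v
  | .loop _ c => c.writesVar v

/-- Whether a program may write to the array `b`. -/
def Prog.writesArr (b : ℕ) : Prog → Bool
  | .skip => false
  | .assign _ _ => false
  | .store a _ _ => a == b
  | .rand _ _ => false
  | .seq c d => c.writesArr b || d.writesArr b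
  | .ite _ c d => c.writesArr b || d.writesArr b
  | .loop _ c => c.writesArr b

theorem Big.var_eq {P : Prog} {s s' : State} {t : ℕ} (h : Big P s s' t) {v : ℕ}
    (hv : P.writesVar v = false) : s'.var v = s.var v := by
  induction h with
  | skip s => rfl
  | assign s w e =>
    have : v ≠ w := by rintro rfl; simp [Prog.writesVar] at hv
    simp [State.setVar, Function.update_of_ne this]
  | store s b i e => rfl
  | seq _ _ ih₁ ih₂ =>
    simp only [Prog.writesVar, Bool.or_eq_false_iff] at hv
    rw [ih₂ hv.2, ih₁ hv.1]
  | ite_true _ _ ih =>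
    simp only [Prog.writesVar, Bool.or_eq_false_iff] at hv
    exact ih hv.1
  | ite_false _ _ ih =>
    simp only [Prog.writesVar, Bool.or_eq_false_iff] at hv
    exact ih hv.2
  | loop_false _ => rfl
  | loop_true _ _ _ ih₁ ih₂ => rw [ih₂ hv, ih₁ hv]

theorem Big.arr_eq {P : Prog} {s s' : State} {t : ℕ} (h : Big P s s' t) {b : ℕ}
    (hb : P.writesArr b = false) : s'.arr b = s.arr b := by
  induction h with
  | skip s => rfl
  | assign s w e => rfl
  | store s a i e =>
    have : b ≠ a := by rintro rfl; simp [Prog.writesArr] at hb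
    simp [State.setArr, Function.update_of_ne this]
  | seq _ _ ih₁ ih₂ =>
    simp only [Prog.writesArr, Bool.or_eq_false_iff] at hb
    rw [ih₂ hb.2, ih₁ hb.1]
  | ite_true _ _ ih =>
    simp only [Prog.writesArr, Bool.or_eq_false_iff] at hb
    exact ih hb.1
  | ite_false _ _ ih =>
    simp only [Prog.writesArr, Bool.or_eq_false_iff] at hb
    exact ih hb.2
  | loop_false _ => rfl
  | loop_true _ _ _ ih₁ ih₂ => rw [ih₂ hb, ih₁ hb]

/-! ### Bounded states and the cost of expressions -/

/-- All registers and array cells hold numbers at most `V`. -/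
structure State.Bdd (V : ℕ) (s : State) : Prop where
  var : ∀ v, s.var v ≤ V
  arr : ∀ b i, s.arr b i ≤ V

theorem State.Bdd.setVar {V : ℕ} {s : State} (h : s.Bdd V) {v a : ℕ} (ha : a ≤ V) :
    (s.setVar v a).Bdd V := by
  refine ⟨fun w => ?_, h.arr⟩
  simp only [State.setVar, Function.update_apply]
  split_ifs
  exacts [ha, h.var w]

theorem State.Bdd.setArr {V : ℕ} {s : State} (h : s.Bdd V) {b i a : ℕ} (ha : a ≤ V) :
    (s.setArr b i a).Bdd V := by
  refine ⟨h.var, fun b' i' => ?_⟩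
  simp only [State.setArr, Function.update_apply]
  split_ifs with h₁
  · simp only [Function.update_apply]
    split_ifs
    exacts [ha, h.arr b i']
  · exact h.arr b' i'

/-- The unit of time for computations with numbers at most `V`. -/
def unit (V : ℕ) : ℕ := 1 + V.size

/-- The bit length of the value of an expression, in units. -/
def Expr.bits : Expr → ℕ
  | .const a => a.size
  | .var _ => 1
  | .get _ _ => 1
  | .bin _ e f => e.bits + f.bits + 1

/-- The evaluation time of an expression, in units. -/
def Expr.weight : Expr → ℕ
  | .const a => 1 + a.size
  | .var _ => 2
  | .get _ i => 2 + i.weight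
  | .bin _ e f => 1 + e.weight + f.weight + (e.bits + f.bits + 1)

theorem size_add_le (a b : ℕ) : (a + b).size ≤ a.size + b.size + 1 := by
  rw [Nat.size_le]
  have ha := Nat.lt_size_self a
  have hb := Nat.lt_size_self b
  have h₁ : 2 ^ a.size ≤ 2 ^ (a.size + b.size) := Nat.pow_le_pow_right (by norm_num) (by omega)
  have h₂ : 2 ^ b.size ≤ 2 ^ (a.size + b.size) := Nat.pow_le_pow_right (by norm_num) (by omega)
  rw [pow_succ]
  omega

theorem size_mul_le (a b : ℕ) : (a * b).size ≤ a.size + b.size := by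
  rw [Nat.size_le, pow_add]
  exact Nat.mul_lt_mul'' (Nat.lt_size_self a) (Nat.lt_size_self b)

theorem Op.size_apply_le (o : Op) (a b : ℕ) : (o.apply a b).size ≤ a.size + b.size + 1 := by
  have one : ∀ p : Prop, [Decidable p] → (if p then 1 else 0 : ℕ).size ≤ a.size + b.size + 1 := by
    intro p _
    split_ifs <;> simp
  cases o with
  | add => exact size_add_le a b
  | sub => exact (Nat.size_le_size (Nat.sub_le a b)).trans (by omega)
  | mul => exact (size_mul_le a b).trans (by omega)
  | div => exact (Nat.size_le_size (Nat.div_le_self a b)).trans (by omega)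
  | mod => exact (Nat.size_le_size (Nat.mod_le a b)).trans (by omega)
  | lt => exact one _
  | eq => exact one _

theorem Expr.size_val_le {V : ℕ} {s : State} (h : s.Bdd V) (e : Expr) :
    (e.val s).size ≤ e.bits * unit V := by
  induction e with
  | const a => exact Nat.le_mul_of_pos_right _ (by unfold unit; omega)
  | var v => simpa [Expr.val, Expr.bits, unit] using
      (Nat.size_le_size (h.var v)).trans (by omega)
  | get b i _ => simpa [Expr.val, Expr.bits, unit] using
      (Nat.size_le_size (h.arr b (i.val s))).trans (by omega)
  | bin o e f he hf =>
    refine (o.size_apply_le _ _).trans ?_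
    have : 1 ≤ unit V := by unfold unit; omega
    simp only [Expr.bits, add_mul, one_mul]
    omega

/-- The weight depends only on the syntax. The logarithmic cost of a loop-free piece of program is
thus a constant number of units, and the bit lengths enter only through `unit V`. -/
theorem Expr.cost_le {V : ℕ} {s : State} (h : s.Bdd V) (e : Expr) :
    e.cost s ≤ e.weight * unit V := by
  have one : 1 ≤ unit V := by unfold unit; omega
  induction e with
  | const a => exact Nat.le_mul_of_pos_right _ (by omega)
  | var v =>
    have := Nat.size_le_size (h.var v)
    simp only [Expr.cost, Expr.weight, unit]
    omega
  | get b i hi =>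
    have := Nat.size_le_size (h.arr b (i.val s))
    simp only [Expr.cost, Expr.weight, add_mul]
    unfold unit at *
    omega
  | bin o e f he hf =>
    have := Expr.size_val_le h (.bin o e f)
    simp only [Expr.cost, Expr.weight, Expr.val, Expr.bits, add_mul, one_mul] at *
    omega

/-! ### Hoare triples with time -/

/-- Started in a state with entries at most `V`, the program `P` halts after at most `τ` units of
time, in a state with entries at most `V` that satisfies `Q`. -/
def Tri (V : ℕ) (P : Prog) (s : State) (τ : ℕ) (Q : State → Prop) : Prop :=
  s.Bdd V → ∃ s' t, Big P s s' t ∧ t ≤ τ * unit V ∧ s'.Bdd V ∧ Q s'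

variable {V : ℕ} {s : State} {Q Q' : State → Prop} {τ τ' : ℕ}

/-- Consequence rule with a built-in frame rule: registers and arrays that the text of `P` never
writes are known to be unchanged. The side conditions are decided by computation. -/
theorem Tri.imp {P : Prog} (h : Tri V P s τ Q)
    (hQ : ∀ s', (∀ v, P.writesVar v = false → s'.var v = s.var v) →
      (∀ b, P.writesArr b = false → s'.arr b = s.arr b) → s'.Bdd V → Q s' → Q' s')
    (hτ : τ ≤ τ') : Tri V P s τ' Q' := by
  intro hs
  obtain ⟨s', t, hb, ht, hs', hq⟩ := h hs
  exact ⟨s', t, hb, ht.trans (Nat.mul_le_mul_right _ hτ), hs',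
    hQ s' (fun _ => hb.var_eq) (fun _ => hb.arr_eq) hs' hq⟩

theorem Tri.skip (h : Q s) : Tri V .skip s 1 Q :=
  fun hs => ⟨s, 1, .skip s, by simp [unit], hs, h⟩

theorem Tri.assign {v : ℕ} {e : Expr} (hV : e.val s ≤ V) (h : Q (s.setVar v (e.val s))) :
    Tri V (.assign v e) s (1 + e.weight) Q := by
  intro hs
  refine ⟨_, _, .assign s v e, ?_, hs.setVar hV, h⟩
  have := e.cost_le hs
  rw [add_mul, one_mul]
  unfold unit at *
  omega

theorem Tri.store {b : ℕ} {i e : Expr} (hV : e.val s ≤ V)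
    (h : Q (s.setArr b (i.val s) (e.val s))) :
    Tri V (.store b i e) s (1 + i.weight + e.weight) Q := by
  intro hs
  refine ⟨_, _, .store s b i e, ?_, hs.setArr hV, h⟩
  have h₁ := e.cost_le hs
  have h₂ := i.cost_le hs
  rw [add_mul, add_mul, one_mul]
  unfold unit at *
  omega

theorem Tri.seq {c d : Prog} {τ₁ τ₂ : ℕ} (h : Tri V c s τ₁ fun s₁ => Tri V d s₁ τ₂ Q) :
    Tri V (.seq c d) s (τ₁ + τ₂) Q := by
  intro hs
  obtain ⟨s₁, t₁, hb₁, ht₁, hs₁, h₁⟩ := h hs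
  obtain ⟨s₂, t₂, hb₂, ht₂, hs₂, h₂⟩ := h₁ hs₁
  exact ⟨s₂, _, hb₁.seq hb₂, by rw [add_mul]; omega, hs₂, h₂⟩

theorem Tri.ite {e : Expr} {c d : Prog} (h₁ : e.val s ≠ 0 → Tri V c s τ Q)
    (h₀ : e.val s = 0 → Tri V d s τ Q) : Tri V (.ite e c d) s (1 + e.weight + τ) Q := by
  intro hs
  have hc := e.cost_le hs
  by_cases he : e.val s = 0
  · obtain ⟨s', t, hb, ht, hs', h⟩ := h₀ he hs
    refine ⟨s', _, .ite_false he hb, ?_, hs', h⟩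
    rw [add_mul, add_mul, one_mul]
    unfold unit at *
    omega
  · obtain ⟨s', t, hb, ht, hs', h⟩ := h₁ he hs
    refine ⟨s', _, .ite_true he hb, ?_, hs', h⟩
    rw [add_mul, add_mul, one_mul]
    unfold unit at *
    omega

/-- `for v < e do c`. -/
def Prog.for (v : ℕ) (e : Expr) (c : Prog) : Prog :=
  .seq (.assign v (.const 0))
    (.loop (.bin .lt (.var v) e) (.seq c (.assign v (.bin .add (.var v) (.const 1)))))

/-- The overhead of one iteration of a `for` loop. -/
def Expr.forWeight (e : Expr) : ℕ := 20 + e.weight + e.bits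

/-- Induction on the number `j` of remaining rounds. The invariant carries the time spent so far,
which allows amortised bounds. -/
theorem Tri.loop_for {v : ℕ} {e : Expr} {c : Prog} {N : ℕ} (Inv : ℕ → ℕ → State → Prop)
    (hN : N ≤ V)
    (he : ∀ k τ s, k ≤ N → s.var v = k → Inv k τ s → e.val s = N)
    (hc : ∀ k τ s, k < N → s.var v = k → Inv k τ s → ∃ τ₁,
      Tri V c s τ₁ fun s' => s'.var v = k ∧ Inv (k + 1) (τ + τ₁) (s'.setVar v (k + 1)))
    (j k τ : ℕ) (hk : k + j = N) (hv : s.var v = k) (hs : s.Bdd V) (h₀ : Inv k τ s) :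
    ∃ s' t τ₁, Big (.loop (.bin .lt (.var v) e)
        (.seq c (.assign v (.bin .add (.var v) (.const 1))))) s s' t ∧
      t ≤ (τ₁ + j * e.forWeight + e.forWeight) * unit V ∧ s'.Bdd V ∧
      s'.var v = N ∧ Inv N (τ + τ₁) s' := by
  induction j generalizing k τ s with
  | zero =>
    obtain rfl : k = N := by omega
    have hval := he k τ s le_rfl hv h₀
    refine ⟨s, _, 0, .loop_false ?_, ?_, hs, hv, h₀⟩
    · simp [Expr.val, Op.apply, hval, hv]
    · have := (Expr.bin .lt (.var v) e).cost_le hs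
      refine (Nat.add_le_add_left this 1).trans ?_
      have one : 1 ≤ unit V := by unfold unit; omega
      calc 1 + (Expr.bin .lt (.var v) e).weight * unit V
          ≤ unit V + (Expr.bin .lt (.var v) e).weight * unit V := by omega
        _ = (1 + (Expr.bin .lt (.var v) e).weight) * unit V := by ring
        _ ≤ _ := Nat.mul_le_mul_right _ (by
          simp only [Expr.weight, Expr.bits, Expr.forWeight]; omega)
  | succ j ih =>
    have hval := he k τ s (by omega) hv h₀
    obtain ⟨τ₁, h₁⟩ := hc k τ s (by omega) hv h₀
    obtain ⟨s₁, t₁, hb₁, ht₁, hs₁, hv₁, hI₁⟩ := h₁ hs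
    have hb₂ := hb₁.seq (Big.assign s₁ v (.bin .add (.var v) (.const 1)))
    have hval₂ : (Expr.bin .add (.var v) (.const 1)).val s₁ = k + 1 := by
      simp [Expr.val, Op.apply, hv₁]
    have hcost₂ := (Expr.bin .add (.var v) (.const 1)).cost_le hs₁
    rw [hval₂] at hb₂
    obtain ⟨s', t, τ₂, hb, ht, hs', hv', hI⟩ := ih (k + 1) (τ + τ₁) (by omega)
      (by simp [State.setVar]) (hs₁.setVar (by omega)) hI₁
    refine ⟨s', _, τ₁ + τ₂, .loop_true ?_ hb₂ hb, ?_, hs', hv', by rwa [← add_assoc]⟩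
    · simp [Expr.val, Op.apply, hval, hv]
      omega
    · have hcost := (Expr.bin .lt (.var v) e).cost_le hs
      have one : 1 ≤ unit V := by unfold unit; omega
      have e₁ : (τ₁ + τ₂ + (j + 1) * e.forWeight + e.forWeight) * unit V =
          τ₁ * unit V + (τ₂ + j * e.forWeight + e.forWeight) * unit V +
            e.forWeight * unit V := by ring
      -- The test weighs `5 + e.weight + e.bits`, the increment `8`, and the two statements one unit
      -- each. The constant `20` leaves room.
      have e₂ : e.forWeight * unit V = 2 * unit V + (Expr.bin .lt (.var v) e).weight * unit V +
          (Expr.bin .add (.var v) (.const 1)).weight * unit V +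
          (e.forWeight - 2 - (Expr.bin .lt (.var v) e).weight -
            (Expr.bin .add (.var v) (.const 1)).weight) * unit V := by
        rw [← add_mul, ← add_mul, ← add_mul]
        congr 1
        simp [Expr.weight, Expr.bits, Expr.forWeight]
        omega
      omega

/-- `s'` agrees with `s` on all registers and arrays that `P` does not write. -/
structure Prog.Agrees (P : Prog) (s s' : State) : Prop where
  var : ∀ v, P.writesVar v = false → s'.var v = s.var v
  arr : ∀ b, P.writesArr b = false → s'.arr b = s.arr b

@[simp] theorem State.setVar_var (s : State) (v a w : ℕ) :
    (s.setVar v a).var w = if w = v then a else s.var w := by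
  simp [State.setVar, Function.update_apply]

@[simp] theorem State.setVar_arr (s : State) (v a : ℕ) : (s.setVar v a).arr = s.arr := rfl

@[simp] theorem State.setArr_var (s : State) (b i a : ℕ) : (s.setArr b i a).var = s.var := rfl

@[simp] theorem State.setArr_arr (s : State) (b i a b' : ℕ) :
    (s.setArr b i a).arr b' = if b' = b then Function.update (s.arr b') i a else s.arr b' := by
  by_cases h : b' = b
  · subst h; simp [State.setArr]
  · simp [State.setArr, h]

/-- The rule for `for` loops. The invariant may depend on the time spent so far in the body. -/
theorem Tri.for {v : ℕ} {e : Expr} {c : Prog} {N : ℕ} (Inv : ℕ → ℕ → State → Prop)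
    (hv : c.writesVar v = false) (hN : N ≤ V)
    (he : ∀ k τ s', k ≤ N → s'.var v = k → (Prog.for v e c).Agrees s s' → Inv k τ s' →
      e.val s' = N)
    (h₀ : Inv 0 0 (s.setVar v 0))
    (hc : ∀ k τ s', k < N → s'.var v = k → (Prog.for v e c).Agrees s s' → s'.Bdd V →
      Inv k τ s' → ∃ τ₁, Tri V c s' τ₁ fun s'' => Inv (k + 1) (τ + τ₁) (s''.setVar v (k + 1)))
    (hQ : ∀ τ s', s'.var v = N → (Prog.for v e c).Agrees s s' → Inv N τ s' → Q s' ∧ τ ≤ τ') :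
    Tri V (.for v e c) s (τ' + (N + 2) * e.forWeight) Q := by
  intro hs
  have hwc : ∀ w, (Prog.for v e c).writesVar w = false → w ≠ v ∧ c.writesVar w = false := by
    intro w hw
    simp only [Prog.for, Prog.writesVar, Bool.or_eq_false_iff, beq_eq_false_iff_ne] at hw
    exact ⟨hw.1.symm, hw.2.1⟩
  have hac : ∀ b, (Prog.for v e c).writesArr b = false → c.writesArr b = false := by
    intro b hb
    simpa [Prog.for, Prog.writesArr] using hb
  obtain ⟨s', t, τ₁, hb, ht, hs', hv', hI⟩ := Tri.loop_for (v := v) (e := e) (c := c)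
    (fun k τ s' => (Inv k τ s' ∧ s'.Bdd V) ∧ (Prog.for v e c).Agrees s s') hN
    (fun k τ s' hk hv hI => he k τ s' hk hv hI.2 hI.1.1)
    (by
      intro k τ s' hk hvk hI
      obtain ⟨τ₁, h⟩ := hc k τ s' hk hvk hI.2 hI.1.2 hI.1.1
      refine ⟨τ₁, h.imp ?_ le_rfl⟩
      intro s'' hV hA hs'' hI''
      refine ⟨by rw [hV v hv, hvk], ⟨hI'', hs''.setVar (by omega)⟩, ?_, ?_⟩
      · intro w hw
        rw [State.setVar_var, if_neg (hwc w hw).1, hV w (hwc w hw).2, hI.2.var w hw]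
      · intro b hb
        rw [State.setVar_arr, hA b (hac b hb), hI.2.arr b hb])
    (s := s.setVar v 0) N 0 0
    (by omega) (by simp [State.setVar]) (hs.setVar (Nat.zero_le _))
    ⟨⟨h₀, hs.setVar (Nat.zero_le _)⟩, fun w hw => by simp [(hwc w hw).1], fun b _ => rfl⟩
  have hI' := hQ _ _ hv' hI.2 hI.1.1
  refine ⟨s', _, (Big.assign s v (.const 0)).seq hb, ?_, hs', hI'.1⟩
  have hcost := (Expr.const 0).cost_le hs
  have one : 1 ≤ unit V := by unfold unit; omega
  have e₁ : (τ' + (N + 2) * e.forWeight) * unit V =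
      (τ' + N * e.forWeight + e.forWeight) * unit V + e.forWeight * unit V := by ring
  have e₂ : (τ₁ + N * e.forWeight + e.forWeight) * unit V ≤
      (τ' + N * e.forWeight + e.forWeight) * unit V := Nat.mul_le_mul_right _ (by omega)
  have e₃ : 2 * unit V ≤ e.forWeight * unit V := Nat.mul_le_mul_right _ (by
    simp [Expr.forWeight]; omega)
  simp [Expr.weight] at hcost
  omega

/-- The rule for `for` loops whose body takes a fixed time. -/
theorem Tri.for_const {v : ℕ} {e : Expr} {c : Prog} {N τ₁ : ℕ} (Inv : ℕ → State → Prop)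
    (hv : c.writesVar v = false) (hN : N ≤ V)
    (he : ∀ k s', k ≤ N → s'.var v = k → (Prog.for v e c).Agrees s s' → Inv k s' → e.val s' = N)
    (h₀ : Inv 0 (s.setVar v 0))
    (hc : ∀ k s', k < N → s'.var v = k → (Prog.for v e c).Agrees s s' → s'.Bdd V → Inv k s' →
      Tri V c s' τ₁ fun s'' => Inv (k + 1) (s''.setVar v (k + 1)))
    (hQ : ∀ s', s'.var v = N → (Prog.for v e c).Agrees s s' → Inv N s' → Q s') :
    Tri V (.for v e c) s (N * τ₁ + (N + 2) * e.forWeight) Q :=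
  Tri.for (fun k τ s => Inv k s ∧ τ = k * τ₁) hv hN
    (fun k _ s hk hv hA h => he k s hk hv hA h.1) ⟨h₀, by simp⟩
    (fun k τ s hk hv hA hB h => ⟨τ₁, (hc k s hk hv hA hB h.1).imp
      (fun _ _ _ _ h' => ⟨h', by rw [h.2]; ring⟩) le_rfl⟩)
    (fun _ s hv hA h => ⟨hQ s hv hA h.1, h.2.le⟩)

theorem Tri.mono {P : Prog} (h : Tri V P s τ Q) (hQ : ∀ s', P.Agrees s s' → s'.Bdd V → Q s' → Q' s')
    (hτ : τ ≤ τ') : Tri V P s τ' Q' :=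
  h.imp (fun s' hV hA => hQ s' ⟨hV, hA⟩) hτ

theorem Tri.of_bdd {P : Prog} (h : s.Bdd V → Tri V P s τ Q) : Tri V P s τ Q := fun hs => h hs hs

/-! ### Programs without loops -/

/-- The running time, in units, of a program without loops. -/
def Prog.weight : Prog → ℕ
  | .skip => 1
  | .assign _ e => 1 + e.weight
  | .store _ i e => 1 + i.weight + e.weight
  | .rand _ e => 1 + e.weight
  | .seq c d => c.weight + d.weight
  | .ite e c d => 1 + e.weight + (c.weight + d.weight)
  | .loop _ _ => 0

/-- The weakest precondition of a program without loops and random choices. -/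
def Prog.wp (V : ℕ) : Prog → (State → Prop) → State → Prop
  | .skip, Q, s => Q s
  | .assign v e, Q, s => e.val s ≤ V ∧ Q (s.setVar v (e.val s))
  | .store b i e, Q, s => e.val s ≤ V ∧ Q (s.setArr b (i.val s) (e.val s))
  | .rand _ _, _, _ => False
  | .seq c d, Q, s => c.wp V (d.wp V Q) s
  | .ite e c d, Q, s => if e.val s = 0 then d.wp V Q s else c.wp V Q s
  | .loop _ _, _, _ => False

/-- Reduces loop-free code to a computation by `simp`. The weight counts both branches of a
conditional, hence bounds the time on either of them. -/
theorem Tri.of_wp {P : Prog} (h : P.wp V Q s) : Tri V P s P.weight Q := by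
  induction P generalizing s Q with
  | skip => exact Tri.skip h
  | assign v e => exact Tri.assign h.1 h.2
  | store b i e => exact Tri.store h.1 h.2
  | rand v e => exact h.elim
  | seq c d hc hd => exact Tri.seq ((hc h).imp (fun s' _ _ _ h' => hd h') le_rfl)
  | ite e c d hc hd =>
    rw [Prog.wp] at h
    refine Tri.ite (fun he => ?_) (fun he => ?_)
    · rw [if_neg he] at h
      exact (hc h).imp (fun _ _ _ _ h => h) (by omega)
    · rw [if_pos he] at h
      exact (hd h).imp (fun _ _ _ _ h => h) (by omega)
  | loop e c => exact h.elim

/-! ### Notation for expressions -/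

instance : Add Expr := ⟨.bin .add⟩
instance : Sub Expr := ⟨.bin .sub⟩
instance : Mul Expr := ⟨.bin .mul⟩
instance : Div Expr := ⟨.bin .div⟩
instance : Mod Expr := ⟨.bin .mod⟩
instance (a : ℕ) : OfNat Expr a := ⟨.const a⟩

@[simp] theorem Expr.val_add (e f : Expr) : (e + f).val s = e.val s + f.val s := rfl
@[simp] theorem Expr.val_sub (e f : Expr) : (e - f).val s = e.val s - f.val s := rfl
@[simp] theorem Expr.val_mul (e f : Expr) : (e * f).val s = e.val s * f.val s := rfl
@[simp] theorem Expr.val_div (e f : Expr) : (e / f).val s = e.val s / f.val s := rfl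
@[simp] theorem Expr.val_mod (e f : Expr) : (e % f).val s = e.val s % f.val s := rfl
@[simp] theorem Expr.val_ofNat (a : ℕ) :
    (no_index (OfNat.ofNat a : Expr)).val s = (OfNat.ofNat a : ℕ) := rfl
@[simp] theorem Expr.val_const (a : ℕ) : (Expr.const a).val s = a := rfl
@[simp] theorem Expr.val_var (v : ℕ) : (Expr.var v).val s = s.var v := rfl
@[simp] theorem Expr.val_get (b : ℕ) (i : Expr) : (Expr.get b i).val s = s.arr b (i.val s) := rfl
@[simp] theorem Expr.val_lt (e f : Expr) :
    (Expr.bin .lt e f).val s = if e.val s < f.val s then 1 else 0 := rfl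
@[simp] theorem Expr.val_eq (e f : Expr) :
    (Expr.bin .eq e f).val s = if e.val s = f.val s then 1 else 0 := rfl

end RAM

/-! ### Averages over lists of draws -/

/-- The average of `f` over all lists of `k` numbers below `Q`. -/
noncomputable def drawAvg (Q : ℕ) : ℕ → (List ℕ → ℝ) → ℝ
  | 0, f => f []
  | k + 1, f => (∑ a ∈ Finset.range Q, drawAvg Q k fun l => f (a :: l)) / Q

section drawAvg

variable {Q : ℕ}

theorem drawAvg_mono {k : ℕ} {f g : List ℕ → ℝ}
    (h : ∀ l : List ℕ, l.length = k → (∀ a ∈ l, a < Q) → f l ≤ g l) :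
    drawAvg Q k f ≤ drawAvg Q k g := by
  induction k generalizing f g with
  | zero => exact h [] rfl (by simp)
  | succ k ih =>
    rw [drawAvg, drawAvg]
    gcongr with a ha
    refine ih fun l hl hlQ => h _ (by simp [hl]) ?_
    simp only [List.mem_cons, forall_eq_or_imp]
    exact ⟨Finset.mem_range.1 ha, hlQ⟩

theorem drawAvg_congr {k : ℕ} {f g : List ℕ → ℝ}
    (h : ∀ l : List ℕ, l.length = k → (∀ a ∈ l, a < Q) → f l = g l) :
    drawAvg Q k f = drawAvg Q k g :=
  le_antisymm (drawAvg_mono fun l h₁ h₂ => (h l h₁ h₂).le)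
    (drawAvg_mono fun l h₁ h₂ => (h l h₁ h₂).ge)

theorem drawAvg_const (hQ : 0 < Q) (k : ℕ) (c : ℝ) : drawAvg Q k (fun _ => c) = c := by
  induction k with
  | zero => rfl
  | succ k ih =>
    rw [drawAvg, ih]
    have : (Q : ℝ) ≠ 0 := by positivity
    simp
    field_simp

theorem drawAvg_add (k : ℕ) (f g : List ℕ → ℝ) :
    drawAvg Q k (fun l => f l + g l) = drawAvg Q k f + drawAvg Q k g := by
  induction k generalizing f g with
  | zero => rfl
  | succ k ih => simp only [drawAvg, ih, Finset.sum_add_distrib, add_div]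

theorem drawAvg_mul_left (k : ℕ) (c : ℝ) (f : List ℕ → ℝ) :
    drawAvg Q k (fun l => c * f l) = c * drawAvg Q k f := by
  induction k generalizing f with
  | zero => rfl
  | succ k ih => simp only [drawAvg, ih, ← Finset.mul_sum, mul_div_assoc]

theorem drawAvg_nonneg {k : ℕ} {f : List ℕ → ℝ} (h : ∀ l, 0 ≤ f l) : 0 ≤ drawAvg Q k f := by
  induction k generalizing f with
  | zero => exact h []
  | succ k ih => exact div_nonneg (Finset.sum_nonneg fun a _ => ih fun l => h _) (by positivity)

theorem drawAvg_append (k j : ℕ) (f : List ℕ → ℝ) :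
    drawAvg Q (k + j) f = drawAvg Q k fun l => drawAvg Q j fun l' => f (l ++ l') := by
  induction k generalizing f with
  | zero => simp [drawAvg]
  | succ k ih =>
    rw [Nat.succ_add, drawAvg, drawAvg]
    simp only [ih, List.cons_append]

end drawAvg

namespace RAM

/-! ### Programs that first fill an array with random numbers -/

theorem tick_toOuterMeasure (t : ℕ) (p : PMF Outcome) (E : Set (State × ℕ)) :
    (tick t p).toOuterMeasure (some '' E) =
      p.toOuterMeasure (some '' {r | (r.1, t + r.2) ∈ E}) := by
  rw [tick, PMF.toOuterMeasure_map_apply]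
  congr 1
  ext r
  cases r with
  | none => simp
  | some r => simp

theorem andThen_tick (t : ℕ) (p : PMF Outcome) (f : State → PMF Outcome) :
    andThen (tick t p) f = tick t (andThen p f) := by
  simp only [andThen, tick, PMF.bind_map, PMF.map_bind]
  congr 1
  funext r
  cases r with
  | none => simp [PMF.pure_map]
  | some r =>
    simp only [Function.comp, Option.map_some, PMF.map_comp]
    congr 1
    funext r'
    cases r' <;> simp [add_assoc]

theorem andThen_assoc (p : PMF Outcome) (f g : State → PMF Outcome) :
    andThen (andThen p f) g = andThen p fun s => andThen (f s) g := by
  conv_lhs => rw [andThen, andThen]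
  conv_rhs => rw [andThen]
  rw [PMF.bind_bind]
  congr 1
  funext r
  cases r with
  | none => simp [PMF.pure_bind]
  | some r =>
    have := andThen_tick r.2 (f r.1) g
    rw [andThen] at this
    exact this

theorem andThen_map (p : PMF ℕ) (st : ℕ → State) (t : ℕ → ℕ) (f : State → PMF Outcome) :
    andThen (p.map fun a => some (st a, t a)) f = p.bind fun a => tick (t a) (f (st a)) := by
  rw [andThen, PMF.bind_map]
  rfl

theorem uniformBelow_apply {Q : ℕ} (hQ : 0 < Q) (a : ℕ) :
    uniformBelow Q a = if a < Q then (Q : ℝ≥0∞)⁻¹ else 0 := by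
  have h1 : max Q 1 = Q := by omega
  refine (PMF.uniformOfFinset_apply (s := Finset.range (max Q 1)) ⟨0, by simp⟩ a).trans ?_
  simp [h1]

theorem uniformBelow_bind_toOuterMeasure {Q : ℕ} (hQ : 0 < Q) (f : ℕ → PMF Outcome)
    (E : Set Outcome) :
    ((uniformBelow Q).bind f).toOuterMeasure E =
      ∑ a ∈ Finset.range Q, (Q : ℝ≥0∞)⁻¹ * (f a).toOuterMeasure E := by
  rw [PMF.toOuterMeasure_bind_apply, tsum_eq_sum (s := Finset.range Q)]
  · refine Finset.sum_congr rfl fun a ha => ?_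
    rw [uniformBelow_apply hQ, if_pos (Finset.mem_range.1 ha)]
  · intro a ha
    rw [uniformBelow_apply hQ, if_neg (by simpa using ha), zero_mul]

/-- Fill the first `N` cells of array `b` with random numbers below `Q`, where `N`, `Q` are the
contents of the registers `vN`, `vQ`. -/
def Prog.draw (i w vN vQ b : ℕ) : Prog :=
  .for i (.var vN) (.seq (.rand w (.var vQ)) (.store b (.var i) (.var w)))

/-- The state `s` arises from `s₁` by writing the list `l` to array `b`; registers `i` and `w`
may have changed. -/
structure Drawn (s₁ : State) (i w b : ℕ) (l : List ℕ) (s : State) : Prop where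
  var : ∀ v, v ≠ i → v ≠ w → s.var v = s₁.var v
  arr : ∀ b', b' ≠ b → s.arr b' = s₁.arr b'
  tape : ∀ j < l.length, s.arr b j = l.getD j 0

/-- The body of the loop that fills an array with random numbers. -/
def Prog.drawBody (i w vQ b : ℕ) : Prog :=
  .seq (.seq (.rand w (.var vQ)) (.store b (.var i) (.var w)))
    (.assign i (.bin .add (.var i) (.const 1)))

/-- Once the number `a` is drawn, the round is deterministic. Only its time `t a` depends on `a`,
through the bit length. -/
theorem exec_drawBody_andThen {V : ℕ} {s : State} (hs : s.Bdd V) {i w vQ b : ℕ} (hiw : i ≠ w)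
    (fuel : ℕ) (hi : s.var i + 1 ≤ V) :
    ∃ t : ℕ → ℕ, (∀ a ≤ V, t a ≤ 20 * unit V) ∧
      ∀ f, andThen (exec fuel (Prog.drawBody i w vQ b) s) f = (uniformBelow (s.var vQ)).bind
        fun a => tick (t a) (f (((s.setVar w a).setArr b (s.var i) a).setVar i (s.var i + 1))) := by
  have key : ∀ a, ∃ t, (a ≤ V → t ≤ 10 * unit V) ∧
      andThen (exec fuel (.store b (.var i) (.var w)) (s.setVar w a))
        (exec fuel (.assign i (.bin .add (.var i) (.const 1)))) =
      PMF.pure (some (((s.setVar w a).setArr b (s.var i) a).setVar i (s.var i + 1), t)) := by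
    intro a
    rw [exec, andThen_pure, exec, tick_pure]
    refine ⟨_, fun ha => ?_, by simp [hiw, Expr.val, Op.apply]; rfl⟩
    have h₁ := hs.setVar (v := w) ha
    have h₂ := h₁.setArr (b := b) (i := (Expr.var i).val (s.setVar w a))
      (a := (Expr.var w).val (s.setVar w a)) (by simpa using ha)
    have e₁ := (Expr.var i).cost_le h₁
    have e₂ := (Expr.var w).cost_le h₁
    have e₃ := Nat.size_le_size (h₂.var i)
    have e₄ : ((((s.setVar w a).setArr b ((Expr.var i).val (s.setVar w a))
      ((Expr.var w).val (s.setVar w a))).var i) + 1).size ≤ V.size :=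
      Nat.size_le_size (by simpa [hiw] using hi)
    simp only [Expr.weight, Expr.cost, Expr.val, Op.apply, unit, Nat.size_one, State.setVar_var,
      State.setArr_var, if_neg hiw, if_true] at *
    omega
  choose t ht hta using key
  refine ⟨fun a => 1 + (Expr.var vQ).cost s + t a, fun a ha => ?_, fun f => ?_⟩
  · have := ht a ha
    have := (Expr.var vQ).cost_le hs
    simp only [Expr.weight] at this
    unfold unit at *
    dsimp only
    omega
  · rw [Prog.drawBody, exec, exec, andThen_assoc, andThen_assoc, exec, andThen_map]
    congr 1
    funext a
    rw [← andThen_assoc, hta, andThen_pure]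
    simp only [tick, PMF.map_comp]
    congr 1
    funext r
    cases r <;> simp [add_assoc]

/-- Induction on the number `k` of draws still to be made, `l` being the list drawn so far. Each
round averages the claim over the next number, which matches the recursion of `drawAvg`. -/
theorem le_toOuterMeasure_draw_loop {V : ℕ} {s₁ : State} {i w vN vQ b N : ℕ} {M : Prog}
    {good : List ℕ → Prop} [DecidablePred good] {R : State → Prop} {τ : ℕ}
    (hiw : i ≠ w) (hiN : vN ≠ i) (hwN : vN ≠ w) (hiQ : vQ ≠ i) (hwQ : vQ ≠ w)
    (hN : s₁.var vN = N) (hNV : N ≤ V) (hQ : 0 < s₁.var vQ) (hQV : s₁.var vQ ≤ V)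
    (hM : ∀ l s, l.length = N → (∀ a ∈ l, a < s₁.var vQ) → s.Bdd V → Drawn s₁ i w b l s →
      ∃ s' t, Big M s s' t ∧ t ≤ τ ∧ (good l → R s'))
    (k : ℕ) (l : List ℕ) (s : State) (hl : l.length + k = N) (hlQ : ∀ a ∈ l, a < s₁.var vQ)
    (hs : s.Bdd V) (hd : Drawn s₁ i w b l s) (hi : s.var i = l.length) :
    ∃ F, ∀ fuel ≥ F, ∀ j ≥ F,
      ENNReal.ofReal (drawAvg (s₁.var vQ) k fun l' => if good (l ++ l') then 1 else 0) ≤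
        (andThen (iterate (.bin .lt (.var i) (.var vN)) (exec fuel (Prog.drawBody i w vQ b)) j s)
          (exec fuel M)).toOuterMeasure
            (some '' {r | r.2 ≤ τ + (k + 1) * (40 * unit V) ∧ R r.1}) := by
  have one : 1 ≤ unit V := by unfold unit; omega
  induction k generalizing l s with
  | zero =>
    obtain ⟨s', t, hb, ht, hR⟩ := hM l s (by omega) hlQ hs hd
    obtain ⟨F, hF⟩ := hb.exec_eq
    refine ⟨F + 1, fun fuel hf j hj => ?_⟩
    obtain ⟨j, rfl⟩ := Nat.exists_eq_succ_of_ne_zero (by omega : j ≠ 0)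
    have hval : (Expr.bin .lt (.var i) (.var vN)).val s = 0 := by
      simp [hd.var vN hiN hwN, hN, hi]
      omega
    have hcost := (Expr.bin .lt (.var i) (.var vN)).cost_le hs
    rw [iterate, if_pos hval, tick_pure, andThen_pure, (hF fuel (by omega)).1, tick_pure]
    simp only [drawAvg, List.append_nil]
    by_cases hg : good l
    · rw [if_pos hg, ENNReal.ofReal_one, PMF.toOuterMeasure_pure_apply, if_pos]
      refine ⟨_, ⟨?_, hR hg⟩, rfl⟩
      simp only [Expr.weight, Expr.bits] at hcost
      dsimp only
      omega
    · simp [hg]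
  | succ k ih =>
    have hval : (Expr.bin .lt (.var i) (.var vN)).val s ≠ 0 := by
      simp [hd.var vN hiN hwN, hN, hi]
      omega
    have hcost := (Expr.bin .lt (.var i) (.var vN)).cost_le hs
    simp only [Expr.weight, Expr.bits] at hcost
    have step : ∀ a < s₁.var vQ, ∃ F, ∀ fuel ≥ F, ∀ j ≥ F,
        ENNReal.ofReal (drawAvg (s₁.var vQ) k fun l' =>
          if good ((l ++ [a]) ++ l') then 1 else 0) ≤
        (andThen (iterate (.bin .lt (.var i) (.var vN)) (exec fuel (Prog.drawBody i w vQ b)) j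
          (((s.setVar w a).setArr b (s.var i) a).setVar i (s.var i + 1)))
          (exec fuel M)).toOuterMeasure
            (some '' {r | r.2 ≤ τ + (k + 1) * (40 * unit V) ∧ R r.1}) := by
      intro a ha
      refine ih (l ++ [a]) _ (by simp; omega) ?_ ?_ ⟨?_, ?_, ?_⟩ (by simp [hi])
      · intro a' ha'
        simp only [List.mem_append, List.mem_singleton] at ha'
        rcases ha' with h | rfl
        exacts [hlQ _ h, ha]
      · exact ((hs.setVar (by omega)).setArr (by omega)).setVar (by omega)
      · intro v h₁ h₂
        simp [h₁, h₂, hd.var v h₁ h₂]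
      · intro b' hb'
        simp [hb', hd.arr b' hb']
      · intro j hj
        simp only [List.length_append, List.length_singleton] at hj
        simp only [State.setVar_arr, State.setArr_arr, if_true, Function.update_apply, hi]
        split_ifs with h
        · subst h
          simp
        · rw [hd.tape j (by omega), List.getD_append _ _ _ _ (by omega)]
    choose! F hF using step
    -- Only finitely many values can be drawn, so one amount of fuel serves all of them. One more
    -- test is spent on the current round.
    refine ⟨(Finset.range (s₁.var vQ)).sup F + 1, fun fuel hf j hj => ?_⟩
    obtain ⟨j, rfl⟩ := Nat.exists_eq_succ_of_ne_zero (by omega : j ≠ 0)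
    obtain ⟨t, ht, hbody⟩ := exec_drawBody_andThen (vQ := vQ) (b := b) hs hiw fuel (by omega)
    rw [iterate, if_neg hval, andThen_tick, andThen_assoc, hbody, tick_toOuterMeasure,
      hd.var vQ hiQ hwQ, uniformBelow_bind_toOuterMeasure hQ, drawAvg]
    rw [div_eq_inv_mul, ENNReal.ofReal_mul (by positivity),
      ENNReal.ofReal_inv_of_pos (by exact_mod_cast hQ), ENNReal.ofReal_natCast,
      ENNReal.ofReal_sum_of_nonneg fun a _ => drawAvg_nonneg fun l => by split_ifs <;> norm_num,
      ← Finset.mul_sum]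
    refine mul_le_mul_right (Finset.sum_le_sum fun a ha => ?_) _
    have haF := Finset.le_sup (f := F) ha
    rw [Finset.mem_range] at ha
    refine le_trans ?_ ((hF a ha fuel (by omega) j (by omega)).trans ?_)
    · simp
    · rw [tick_toOuterMeasure]
      refine MeasureTheory.measure_mono (Set.image_mono ?_)
      rintro r ⟨hr, hR⟩
      refine ⟨?_, hR⟩
      have := ht a (by omega)
      have e : (k + 1 + 1) * (40 * unit V) = (k + 1) * (40 * unit V) + 40 * unit V := by ring
      dsimp only
      omega

/-- The bridge from deterministic specifications to probabilities. `M` must halt in time on every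
tape, but has to reach `R` only on good ones; the proportion of good tapes then bounds the
probability from below. -/
theorem le_haltProb_draw {V : ℕ} {s₀ s₁ : State} {i w vN vQ b N t₀ : ℕ} {P M : Prog}
    {good : List ℕ → Prop} [DecidablePred good] {R : State → Prop} {τ : ℕ}
    (hiw : i ≠ w) (hiN : vN ≠ i) (hwN : vN ≠ w) (hiQ : vQ ≠ i) (hwQ : vQ ≠ w)
    (hN : s₁.var vN = N) (hNV : N ≤ V) (hQ : 0 < s₁.var vQ)
    (hs₁ : s₁.Bdd V) (hP : Big P s₀ s₁ t₀)
    (hM : ∀ l s, l.length = N → (∀ a ∈ l, a < s₁.var vQ) → s.Bdd V → Drawn s₁ i w b l s →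
      ∃ s' t, Big M s s' t ∧ t ≤ τ ∧ (good l → R s')) :
    ENNReal.ofReal (drawAvg (s₁.var vQ) N fun l => if good l then 1 else 0) ≤
      haltProb (.seq P (.seq (Prog.draw i w vN vQ b) M)) s₀
        {r | r.2 ≤ t₀ + τ + (N + 2) * (40 * unit V) ∧ R r.1} := by
  have one : 1 ≤ unit V := by unfold unit; omega
  obtain ⟨F, hF⟩ := le_toOuterMeasure_draw_loop hiw hiN hwN hiQ hwQ hN hNV hQ (hs₁.var vQ) hM N []
    (s₁.setVar i 0) (by simp) (by simp) (hs₁.setVar (Nat.zero_le _))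
    ⟨fun v h₁ _ => by simp [h₁], fun _ _ => rfl, by simp⟩ (by simp)
  obtain ⟨F', hF'⟩ := hP.exec_eq
  refine le_iSup_of_le (max F F') ?_
  have h := hF (max F F') (le_max_left _ _) (max F F') (le_max_left _ _)
  refine h.trans ?_
  rw [exec, (hF' _ (le_max_right _ _)).1, andThen_pure, tick_toOuterMeasure, exec, Prog.draw,
    Prog.for, exec, exec, andThen_pure, andThen_tick, tick_toOuterMeasure]
  refine MeasureTheory.measure_mono (Set.image_mono ?_)
  rintro r ⟨hr, hR⟩
  refine ⟨?_, hR⟩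
  have e : (N + 2) * (40 * unit V) = (N + 1) * (40 * unit V) + 40 * unit V := by ring
  have e₂ := (Expr.const 0).cost_le hs₁
  simp [Expr.weight] at e₂
  dsimp only
  omega

/-- If a program always halts within time `B`, then `B` bounds the expected time. -/
theorem expectedTime_le {P : Prog} {s : State} {B : ℕ} (h : haltProb P s {r | r.2 ≤ B} = 1) :
    expectedTime P s ≤ B := by
  rw [expectedTime, tsum_eq_sum (s := Finset.range B)]
  · refine (Finset.sum_le_sum fun t _ => (tsub_le_self : _ ≤ (1 : ℝ≥0∞))).trans ?_
    simp
  · intro t ht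
    rw [tsub_eq_zero_iff_le, ← h]
    refine iSup_mono fun fuel => MeasureTheory.measure_mono (Set.image_mono ?_)
    intro r hr
    simp only [Finset.mem_range, not_lt] at ht
    exact le_trans hr ht

theorem haltProb_mono {P : Prog} {s : State} {E E' : Set (State × ℕ)} (h : E ⊆ E') :
    haltProb P s E ≤ haltProb P s E' :=
  iSup_mono fun _ => MeasureTheory.measure_mono (Set.image_mono h)

theorem haltProb_le_one {P : Prog} {s : State} {E : Set (State × ℕ)} : haltProb P s E ≤ 1 :=
  iSup_le fun fuel => ((exec fuel P s).toOuterMeasure.mono (Set.subset_univ _)).trans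
    ((PMF.toOuterMeasure_apply_eq_one_iff _ _).2 (Set.subset_univ _)).le

end RAM

/-! ### Common subsequences -/

/-- The prefixes of lengths `a`, `b` of `x`, `y` have a common subsequence of length `k`. -/
def HasCommon (x y : List ℕ) (a b k : ℕ) : Prop :=
  ∃ z : List ℕ, z.Sublist (x.take a) ∧ z.Sublist (y.take b) ∧ z.length = k

theorem bddAbove_lcsLen (x y : List ℕ) :
    BddAbove {k : ℕ | ∃ z : List ℕ, z.Sublist x ∧ z.Sublist y ∧ z.length = k} :=
  ⟨x.length, by rintro k ⟨z, hz, _, rfl⟩; exact hz.length_le⟩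

theorem le_lcsLen {x y z : List ℕ} (hx : z.Sublist x) (hy : z.Sublist y) :
    z.length ≤ lcsLen x y :=
  le_csSup (bddAbove_lcsLen x y) ⟨z, hx, hy, rfl⟩

theorem exists_lcs (x y : List ℕ) :
    ∃ z : List ℕ, z.Sublist x ∧ z.Sublist y ∧ z.length = lcsLen x y :=
  Nat.sSup_mem (s := {k : ℕ | ∃ z : List ℕ, z.Sublist x ∧ z.Sublist y ∧ z.length = k})
    ⟨0, [], by simp, by simp, rfl⟩ (bddAbove_lcsLen x y)

theorem lcsLen_le_length (x y : List ℕ) : lcsLen x y ≤ x.length := by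
  obtain ⟨z, hz, _, h⟩ := exists_lcs x y
  exact h ▸ hz.length_le

theorem HasCommon.le_lcsLen {x y : List ℕ} {a b k : ℕ} (h : HasCommon x y a b k) :
    k ≤ lcsLen x y := by
  obtain ⟨z, hx, hy, rfl⟩ := h
  exact _root_.le_lcsLen (hx.trans (List.take_sublist _ _)) (hy.trans (List.take_sublist _ _))

theorem HasCommon.mono {x y : List ℕ} {a a' b b' k : ℕ} (h : HasCommon x y a b k) (ha : a ≤ a')
    (hb : b ≤ b') : HasCommon x y a' b' k := by
  obtain ⟨z, hx, hy, hz⟩ := h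
  exact ⟨z, hx.trans (List.take_sublist_take_left ha), hy.trans (List.take_sublist_take_left hb),
    hz⟩

theorem HasCommon.snoc {x y : List ℕ} {a b k : ℕ} (h : HasCommon x y a b k) (ha : a < x.length)
    (hb : b < y.length) (hab : x.getD a 0 = y.getD b 0) : HasCommon x y (a + 1) (b + 1) (k + 1) := by
  obtain ⟨z, hx, hy, rfl⟩ := h
  rw [List.getD_eq_getElem _ _ ha, List.getD_eq_getElem _ _ hb] at hab
  refine ⟨z ++ [x[a]], ?_, ?_, by simp⟩
  · rw [← List.take_concat_get' x a ha]
    exact hx.append (List.Sublist.refl _)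
  · rw [← List.take_concat_get' y b hb, hab]
    exact hy.append (List.Sublist.refl _)

theorem hasCommon_zero (x y : List ℕ) (a b : ℕ) : HasCommon x y a b 0 :=
  ⟨[], by simp, by simp, rfl⟩

/-! ### Patience sorting -/

/-- A chain: a list of pairs strictly increasing in both coordinates. -/
def IsPairChain (ch : List (ℕ × ℕ)) : Prop := ch.Pairwise fun a b => a.1 < b.1 ∧ a.2 < b.2

theorem IsPairChain.getElem_lt {ch : List (ℕ × ℕ)} (h : IsPairChain ch) {i j : ℕ} (hj : j < ch.length)
    (hij : i < j) : ch[i].1 < ch[j].1 ∧ ch[i].2 < ch[j].2 :=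
  List.pairwise_iff_getElem.1 h i j (by omega) hj hij

/-- The state of the computation of a longest chain of matching pairs, after the rows before `p`
and the entries of row `p` from column `q` on. The first `len` entries of `thr` are the least end
columns of chains of lengths `1, …, len`; they are compared with the chains in a set `OK`. -/
structure Patience (x y : List ℕ) (OK : List (ℕ × ℕ) → Prop) (p q len : ℕ) (thr : ℕ → ℕ) :
    Prop where
  lt : ∀ k < len, thr k < y.length
  mono : ∀ i j, i < j → j < len → thr i < thr j
  sound : ∀ k < len, HasCommon x y (p + 1) (thr k + 1) (k + 1)
  sound_lt : ∀ k < len, thr k < q → HasCommon x y p (thr k + 1) (k + 1)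
  complete : ∀ ch, OK ch → ∀ i, (hi : i < ch.length) → (ch[i].1 < p ∨ ch[i].1 = p ∧ q ≤ ch[i].2) →
    i < len ∧ thr i ≤ ch[i].2

/-- This half of the invariant needs nothing about `OK`. It is why the output is sound whatever is
sampled and wherever the budget ends. -/
theorem Patience.len_le {x y : List ℕ} {OK : List (ℕ × ℕ) → Prop} {p q len : ℕ} {thr : ℕ → ℕ}
    (h : Patience x y OK p q len thr) : len ≤ lcsLen x y := by
  cases len with
  | zero => exact Nat.zero_le _
  | succ k => exact (h.sound k (by omega)).le_lcsLen

theorem Patience.start (x y : List ℕ) (OK : List (ℕ × ℕ) → Prop) (thr : ℕ → ℕ) {q : ℕ}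
    (hq : ∀ ch, OK ch → ∀ i, (hi : i < ch.length) → ch[i].2 < q) : Patience x y OK 0 q 0 thr where
  lt := by simp
  mono := by simp
  sound := by simp
  sound_lt := by simp
  complete ch hc i hi h := by
    have := hq ch hc i hi
    omega

/-- A row is handled from right to left. Thresholds below `q` therefore stem from earlier rows
(`sound_lt`), and the pair `(p, q)` may extend their chains; it becomes the new end of the chains of
length `lo + 1`. By `hnext`, no chain in `OK` uses a column strictly between `q` and `q'` in this
row, so none is skipped. -/
theorem Patience.insert {x y : List ℕ} {OK : List (ℕ × ℕ) → Prop} {p q q' len lo : ℕ}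
    {thr : ℕ → ℕ} (h : Patience x y OK p q' len thr) (hOK : ∀ ch, OK ch → IsPairChain ch) (hq : q < q')
    (hp : p < x.length) (hqy : q < y.length) (hxy : x.getD p 0 = y.getD q 0)
    (hlo : lo ≤ len) (hlt : ∀ i < lo, thr i < q) (hge : ∀ i, lo ≤ i → i < len → q ≤ thr i)
    (hnext : ∀ ch, OK ch → ∀ i, (hi : i < ch.length) → ch[i].1 = p → q < ch[i].2 → q' ≤ ch[i].2) :
    Patience x y OK p q (if lo = len then len + 1 else len) (Function.update thr lo q) := by
  have hlen : ∀ k, k < (if lo = len then len + 1 else len) → k < len ∨ k = lo := by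
    intro k hk
    split_ifs at hk <;> omega
  have hlen' : ∀ k, (k < len ∨ k = lo) → k < (if lo = len then len + 1 else len) := by
    intro k hk
    split_ifs <;> omega
  have hup : ∀ k, k ≠ lo → Function.update thr lo q k = thr k := fun k hk =>
    Function.update_of_ne hk _ _
  have hself : Function.update thr lo q lo = q := Function.update_self _ _ _
  have hnew : HasCommon x y (p + 1) (q + 1) (lo + 1) := by
    refine HasCommon.snoc ?_ hp hqy hxy
    rcases Nat.eq_zero_or_pos lo with rfl | hpos
    · exact hasCommon_zero _ _ _ _
    · have h1 := hlt (lo - 1) (by omega)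
      have := h.sound_lt (lo - 1) (by omega) (by omega)
      rw [Nat.sub_add_cancel hpos] at this
      exact this.mono le_rfl (by omega)
  refine ⟨?_, ?_, ?_, ?_, ?_⟩
  · intro k hk
    by_cases hk' : k = lo
    · rw [hk', hself]; exact hqy
    · rw [hup k hk']; exact h.lt k ((hlen k hk).resolve_right hk')
  · intro i j hij hj
    by_cases hi' : i = lo
    · have hj' : j ≠ lo := by omega
      have hj'' := (hlen j hj).resolve_right hj'
      rw [hup j hj', hi', hself]
      have := hge lo le_rfl (by omega)
      have := h.mono lo j (by omega) hj''
      omega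
    · rw [hup i hi']
      by_cases hj' : j = lo
      · rw [hj', hself]; exact hlt i (by omega)
      · rw [hup j hj']
        exact h.mono i j hij ((hlen j hj).resolve_right hj')
  · intro k hk
    by_cases hk' : k = lo
    · rw [hk', hself]; exact hnew
    · rw [hup k hk']; exact h.sound k ((hlen k hk).resolve_right hk')
  · intro k hk hkq
    by_cases hk' : k = lo
    · rw [hk', hself] at hkq; omega
    · rw [hup k hk'] at hkq ⊢
      exact h.sound_lt k ((hlen k hk).resolve_right hk') (by omega)
  · intro ch hc i hi hcase
    have hold : (ch[i].1 < p ∨ ch[i].1 = p ∧ q' ≤ ch[i].2) →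
        i < (if lo = len then len + 1 else len) ∧ Function.update thr lo q i ≤ ch[i].2 := by
      intro hcase'
      obtain ⟨h₁, h₂⟩ := h.complete ch hc i hi hcase'
      refine ⟨hlen' i (Or.inl h₁), ?_⟩
      by_cases hi' : i = lo
      · have e : Function.update thr lo q i = q := by rw [hi', hself]
        have := hge i (by omega) h₁
        omega
      · rw [hup i hi']; exact h₂
    rcases hcase with hcase | ⟨hcp, hcq⟩
    · exact hold (Or.inl hcase)
    · rcases Nat.lt_or_ge q ch[i].2 with hlt' | hge'
      · exact hold (Or.inr ⟨hcp, hnext ch hc i hi hcp hlt'⟩)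
      · have hcq' : ch[i].2 = q := by omega
        -- Otherwise the element of index `lo` precedes `(p, q)` in both coordinates. Completeness
        -- for earlier rows then puts `thr lo` below `q`, against the choice of `lo`.
        have hilo : i ≤ lo := by
          by_contra hcon
          have hl : lo < ch.length := by omega
          have hprev := (hOK ch hc).getElem_lt hi (Nat.lt_of_not_le hcon)
          obtain ⟨h₁, h₂⟩ := h.complete ch hc lo hl (Or.inl (by omega))
          have := hge lo le_rfl h₁
          omega
        refine ⟨hlen' i (by omega), ?_⟩
        rcases Nat.lt_or_ge i lo with hi' | hi'
        · rw [hup i (by omega)]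
          have := hlt i hi'
          omega
        · obtain rfl : i = lo := by omega
          rw [hself]
          omega

/-- After a row is finished, all thresholds refer to rows before `p'` and may be extended. By
`hrow`, the rows jumped over contain no elements of chains in `OK`. -/
theorem Patience.advance {x y : List ℕ} {OK : List (ℕ × ℕ) → Prop} {p q p' q' len : ℕ}
    {thr : ℕ → ℕ} (h : Patience x y OK p q len thr) (hp : p < p')
    (hq' : ∀ ch, OK ch → ∀ i, (hi : i < ch.length) → ch[i].2 < q')
    (hrow : ∀ ch, OK ch → ∀ i, (hi : i < ch.length) → ch[i].1 < p' →
      ch[i].1 < p ∨ ch[i].1 = p ∧ q ≤ ch[i].2) : Patience x y OK p' q' len thr where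
  lt := h.lt
  mono := h.mono
  sound k hk := (h.sound k hk).mono (by omega) le_rfl
  sound_lt k hk _ := (h.sound k hk).mono (by omega) le_rfl
  complete ch hc i hi hcase := by
    refine h.complete ch hc i hi (hrow ch hc i hi ?_)
    have := hq' ch hc i hi
    omega

/-! ### Occurrences of a symbol in a block -/

/-- The positions below `q` in block `j` where the symbol `a` occurs, in increasing order. -/
def occ (y : ℕ → ℕ) (m a j q : ℕ) : List ℕ :=
  (List.range q).filter fun i => y i = a ∧ i / m = j

theorem mem_occ {y : ℕ → ℕ} {m a j q i : ℕ} :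
    i ∈ occ y m a j q ↔ i < q ∧ y i = a ∧ i / m = j := by
  simp [occ]

theorem occ_succ (y : ℕ → ℕ) (m a j q : ℕ) :
    occ y m a j (q + 1) = occ y m a j q ++ if y q = a ∧ q / m = j then [q] else [] := by
  simp only [occ, List.range_succ, List.filter_append]
  congr 1
  by_cases h : y q = a ∧ q / m = j <;> simp [h]

theorem occ_pairwise (y : ℕ → ℕ) (m a j q : ℕ) : (occ y m a j q).Pairwise (· < ·) :=
  List.pairwise_lt_range.filter _

theorem occ_length_le (y : ℕ → ℕ) (m a j q : ℕ) : (occ y m a j q).length ≤ q :=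
  (List.length_filter_le _ _).trans (by simp)

/-! ### The program: registers -/

notation "rN" => 0
notation "rT" => 1
notation "rBest" => 2
notation "rM" => 3
notation "rK" => 4
notation "rLog" => 5
notation "rPow" => 6
notation "rD" => 7
notation "rQ" => 8
notation "rLev" => 9
notation "rRep" => 10
notation "rDraws" => 11
notation "rI" => 12
notation "rKey" => 13
notation "rW" => 14
notation "rA" => 15
notation "rG" => 16
notation "rAlpha" => 17
notation "rGamma" => 18
notation "rRows" => 19
notation "rTry" => 20
notation "rBase" => 21
notation "rDiag" => 22
notation "rBudget" => 23
notation "rLen" => 24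
notation "rRow" => 25
notation "rP" => 26
notation "rJ" => 27
notation "rCnt" => 28
notation "rU" => 29
notation "rCol" => 30
notation "rLo" => 31
notation "rHi" => 32
notation "rZ" => 33
notation "rMid" => 34
notation "aX" => 0
notation "aY" => 1
notation "aTape" => 2
notation "aCnt" => 3
notation "aPos" => 4
notation "aThr" => 5
notation "aHas" => 6

namespace RAM
open RAM.Expr

/-! ### Binary search -/

/-- One step of the binary search for the first entry of `aThr` that is at least `rCol`. -/
def searchStep : Prog :=
  .ite (.bin .lt (var rLo) (var rHi))
    (.seq (.assign rMid ((var rLo + var rHi) / 2))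
      (.ite (.bin .lt (get aThr (var rMid)) (var rCol))
        (.assign rLo (var rMid + 1)) (.assign rHi (var rMid)))) .skip

def searchInit : Prog := .seq (.assign rLo 0) (.assign rHi (var rLen))

def search : Prog := .seq searchInit (.for rZ (var rLog) searchStep)

def searchTime : ℕ :=
  searchInit.weight + searchStep.weight + 2 * (var rLog).forWeight

/-- A fixed number `rLog` of halvings is run. The interval width times `2 ^ k` never exceeds `rLen <
2 ^ rLog`, so the interval is empty at the end. -/
theorem search_spec {V : ℕ} {s : State} (hs : s.Bdd V) (hlen : s.var rLen < 2 ^ s.var rLog)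
    (hmono : ∀ i j, i < j → j < s.var rLen → s.arr aThr i < s.arr aThr j) :
    Tri V search s (searchTime * (s.var rLog + 1)) fun s' => s'.var rLo ≤ s.var rLen ∧
      (∀ i < s'.var rLo, s.arr aThr i < s.var rCol) ∧
      ∀ i, s'.var rLo ≤ i → i < s.var rLen → s.var rCol ≤ s.arr aThr i := by
  refine Tri.mono (τ := searchInit.weight + (s.var rLog * searchStep.weight +
    (s.var rLog + 2) * (var rLog).forWeight))
    (Tri.seq (Tri.of_wp ?_)) (fun _ _ _ h => h) ?_
  · simp only [searchInit, Prog.wp, val_ofNat, val_var, State.setVar_var]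
    refine ⟨Nat.zero_le _, hs.var _, ?_⟩
    refine Tri.for_const (fun k s' => s'.var rLo ≤ s'.var rHi ∧ s'.var rHi ≤ s.var rLen ∧
      (∀ i < s'.var rLo, s.arr aThr i < s.var rCol) ∧
      (∀ i, s'.var rHi ≤ i → i < s.var rLen → s.var rCol ≤ s.arr aThr i) ∧
      (s'.var rHi - s'.var rLo) * 2 ^ k ≤ s.var rLen) rfl (hs.var _) ?_ ?_ ?_ ?_
    · intro k s' _ _ hA _
      simp [hA.var rLog rfl]
    · simp
      intro i h1 h2
      omega
    · intro k s' hk hv hA hB ⟨h1, h2, h3, h4, h5⟩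
      have eL := hA.var rLen rfl
      have eC := hA.var rCol rfl
      have eT := hA.arr aThr rfl
      simp at eL eC eT
      have hV := hs.var rLen
      refine Tri.of_wp ?_
      simp only [searchStep, Prog.wp, val_lt, val_var, val_div, val_add, val_ofNat, val_get,
        State.setVar_var, State.setVar_arr, eC, eT]
      rw [pow_succ]
      by_cases hlt : s'.var rLo < s'.var rHi
      · have hm1 : s'.var rLo ≤ (s'.var rLo + s'.var rHi) / 2 := by omega
        have hm2 : (s'.var rLo + s'.var rHi) / 2 < s'.var rHi := by omega
        have hgap : ∀ b, b * 2 ≤ s'.var rHi - s'.var rLo → b * (2 ^ k * 2) ≤ s.var rLen := by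
          intro b hb
          calc b * (2 ^ k * 2) = b * 2 * 2 ^ k := by ring
            _ ≤ _ := Nat.mul_le_mul_right _ hb
            _ ≤ _ := h5
        have mono' : ∀ i j, i ≤ j → j < s.var rLen → s.arr aThr i ≤ s.arr aThr j := by
          intro i j hij hj
          rcases Nat.eq_or_lt_of_le hij with rfl | h
          · exact le_rfl
          · exact (hmono i j h hj).le
        by_cases hc : s.arr aThr ((s'.var rLo + s'.var rHi) / 2) < s.var rCol
        · simp [hlt, hc]
          refine ⟨by omega, by omega, by omega, h2, ?_, h4, hgap _ (by omega)⟩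
          intro i hi
          exact (mono' i _ (by omega) (by omega)).trans_lt hc
        · simp [hlt, hc]
          refine ⟨by omega, hm1, by omega, h3, ?_, hgap _ (by omega)⟩
          intro i hi hi'
          exact (not_lt.1 hc).trans (mono' _ i hi hi')
      · have : s'.var rHi - s'.var rLo = 0 := by omega
        simp [hlt]
        exact ⟨h1, h2, h3, h4, by simp [this]⟩
    · intro s' hv hA ⟨h1, h2, h3, h4, h5⟩
      have h6 : s'.var rHi - s'.var rLo = 0 := by
        by_contra h
        have := Nat.le_mul_of_pos_left (2 ^ s.var rLog) (Nat.pos_of_ne_zero h)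
        omega
      exact ⟨by omega, h3, fun i hi => h4 i (by omega)⟩
  · simp only [searchTime]
    nlinarith [Nat.zero_le searchInit.weight, Nat.zero_le searchStep.weight,
      Nat.zero_le (var rLog).forWeight, Nat.zero_le (s.var rLog),
      Nat.zero_le (searchInit.weight * s.var rLog), Nat.zero_le ((var rLog).forWeight * s.var rLog)]

end RAM

/-! ### Matching pairs on a diagonal and sampled chains -/

/-- The columns of row `p` that match in the block of diagonal `d` (where `d = K` is the main
diagonal). -/
def rowOcc (x y : List ℕ) (n m K d p : ℕ) : List ℕ :=
  if p < n ∧ K ≤ p / m + d ∧ p / m + d < 2 * K then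
    occ (fun i => y.getD i 0) m (x.getD p 0) (p / m + d - K) n else []

/-- A chain of matching pairs in the blocks of diagonal `d`, in rows `i * g + off i`. -/
structure IsSampledChain (x y : List ℕ) (n m K d g : ℕ) (off : ℕ → ℕ) (ch : List (ℕ × ℕ)) :
    Prop where
  chain : IsPairChain ch
  off : ∀ pq ∈ ch, pq.1 % g = off (pq.1 / g)
  mem : ∀ pq ∈ ch, pq.2 ∈ rowOcc x y n m K d pq.1

theorem mem_rowOcc {x y : List ℕ} {n m K d p q : ℕ} :
    q ∈ rowOcc x y n m K d p ↔ (p < n ∧ K ≤ p / m + d ∧ p / m + d < 2 * K) ∧ q < n ∧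
      y.getD q 0 = x.getD p 0 ∧ q / m = p / m + d - K := by
  rw [rowOcc]
  split_ifs with h
  · simp [mem_occ, h]
  · simp [h]

namespace RAM
open RAM.Expr

/-- The part of the memory that the attempts only read. -/
structure Ready (x y : List ℕ) (n m K L : ℕ) (s : State) : Prop where
  var_n : s.var rN = n
  var_m : s.var rM = m
  var_K : s.var rK = K
  var_L : s.var rLog = L
  arr_x : ∀ i, s.arr aX i = x.getD i 0
  cnt : ∀ a j, j ≤ n →
    s.arr aCnt (a * (n + 1) + j) = (occ (fun i => y.getD i 0) m a j n).length
  pos : ∀ a j r, j ≤ n → r < (occ (fun i => y.getD i 0) m a j n).length →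
    s.arr aPos ((a * (n + 1) + j) * (n + 1) + r) = (occ (fun i => y.getD i 0) m a j n).getD r 0

theorem Ready.congr {x y : List ℕ} {n m K L : ℕ} {s s' : State} (h : Ready x y n m K L s)
    (h0 : s'.var rN = s.var rN) (h1 : s'.var rM = s.var rM) (h2 : s'.var rK = s.var rK)
    (h3 : s'.var rLog = s.var rLog) (h4 : s'.arr aX = s.arr aX) (h5 : s'.arr aCnt = s.arr aCnt)
    (h6 : s'.arr aPos = s.arr aPos) : Ready x y n m K L s' where
  var_n := h0.trans h.var_n
  var_m := h1.trans h.var_m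
  var_K := h2.trans h.var_K
  var_L := h3.trans h.var_L
  arr_x i := by rw [h4, h.arr_x]
  cnt a j hj := by rw [h5, h.cnt a j hj]
  pos a j r hj hr := by rw [h6, h.pos a j r hj hr]

theorem Ready.agrees {x y : List ℕ} {n m K L : ℕ} {s s' : State} (h : Ready x y n m K L s)
    {P : Prog} (hA : P.Agrees s s') (h0 : P.writesVar rN = false) (h1 : P.writesVar rM = false)
    (h2 : P.writesVar rK = false) (h3 : P.writesVar rLog = false) (h4 : P.writesArr aX = false)
    (h5 : P.writesArr aCnt = false) (h6 : P.writesArr aPos = false) : Ready x y n m K L s' :=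
  h.congr (hA.var _ h0) (hA.var _ h1) (hA.var _ h2) (hA.var _ h3) (hA.arr _ h4) (hA.arr _ h5)
    (hA.arr _ h6)

/-! ### One column -/

/-- The index `rCnt - 1 - rU` reads the increasing list of columns backwards, as `Patience.insert`
requires. -/
def loadCol : Prog :=
  .assign rCol (get aPos (var rKey * (var rN + 1) + (var rCnt - 1 - var rU)))

def putCol : Prog :=
  .seq (.store aThr (var rLo) (var rCol))
    (.ite (.bin .eq (var rLo) (var rLen)) (.assign rLen (var rLen + 1)) .skip)

/-- Handle the next matching pair of the current row. -/
def insertCol : Prog := .seq loadCol (.seq search putCol)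

def insertTime : ℕ := loadCol.weight + searchTime + putCol.weight

theorem insertCol_spec {V : ℕ} {s : State} {x y : List ℕ} {n m K L p q q' : ℕ}
    {OK : List (ℕ × ℕ) → Prop} (hR : Ready x y n m K L s) (hx : x.length = n)
    (hy : y.length = n) (hn : n < 2 ^ L) (hV : n + 1 ≤ V)
    (hq : s.arr aPos (s.var rKey * (n + 1) + (s.var rCnt - 1 - s.var rU)) = q)
    (hP : Patience x y OK p q' (s.var rLen) (s.arr aThr)) (hOK : ∀ ch, OK ch → IsPairChain ch)
    (hqq : q < q') (hp : p < n) (hqn : q < n) (hxy : x.getD p 0 = y.getD q 0)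
    (hnext : ∀ ch, OK ch → ∀ i, (hi : i < ch.length) → ch[i].1 = p → q < ch[i].2 → q' ≤ ch[i].2) :
    Tri V insertCol s (insertTime * (L + 1))
      fun s' => Patience x y OK p q (s'.var rLen) (s'.arr aThr) := by
  have hlen := hP.len_le.trans (lcsLen_le_length x y)
  refine Tri.mono (τ := loadCol.weight + (searchTime * (L + 1) + putCol.weight))
    (Tri.seq (Tri.of_wp ?_)) (fun _ _ _ h => h) ?_
  · simp only [loadCol, Prog.wp, val_get, val_add, val_mul, val_var, val_sub, val_ofNat, hR.var_n, hq]
    refine ⟨by omega, Tri.seq (Tri.of_bdd fun hs₁ => ?_)⟩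
    have hS := search_spec hs₁ (by simp only [State.setVar_var]; simp [hR.var_L]; omega)
      (by simpa using hP.mono)
    simp only [State.setVar_var, State.setVar_arr] at hS
    simp [hR.var_L] at hS
    refine hS.mono ?_ le_rfl
    rintro s' hA hB ⟨h1, h2, h3⟩
    refine Tri.of_wp ?_
    have eL := hA.var rLen rfl
    have eC := hA.var rCol rfl
    have eT := hA.arr aThr rfl
    simp at eL eC eT
    have key := hP.insert hOK hqq (by omega) (by omega) hxy h1 h2 h3 hnext
    simp only [putCol, Prog.wp, val_var, val_eq, val_add, val_ofNat, State.setArr_var,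
      State.setArr_arr, State.setVar_var, State.setVar_arr, eL, eC]
    refine ⟨by omega, ?_⟩
    by_cases hc : s'.var rLo = s.var rLen
    · simp [hc, eT] at key ⊢
      exact ⟨by omega, key⟩
    · simp [hc, eT] at key ⊢
      exact key
  · simp only [insertTime]
    nlinarith [Nat.zero_le loadCol.weight, Nat.zero_le putCol.weight, Nat.zero_le L,
      Nat.zero_le (loadCol.weight * L), Nat.zero_le (putCol.weight * L)]

/-! ### One row -/

def cols : Prog := .for rU (var rCnt) insertCol

def colTime : ℕ := insertTime + (var rCnt).forWeight

/-- `rCnt` may have been cut down by the budget. Soundness survives this; `hcnt'` asks for the full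
count only if there are chains in `OK` to compare with. -/
theorem cols_spec {V : ℕ} {s : State} {x y : List ℕ} {n m K L p j : ℕ}
    {OK : List (ℕ × ℕ) → Prop} (hs : s.Bdd V) (hR : Ready x y n m K L s) (hx : x.length = n)
    (hy : y.length = n) (hn : n < 2 ^ L) (hV : n + 1 ≤ V) (hj : j ≤ n)
    (hkey : s.var rKey = x.getD p 0 * (n + 1) + j)
    (hcnt : s.var rCnt ≤ (occ (fun i => y.getD i 0) m (x.getD p 0) j n).length)
    (hP : Patience x y OK p n (s.var rLen) (s.arr aThr)) (hOK : ∀ ch, OK ch → IsPairChain ch)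
    (hp : p < n)
    (hcnt' : ∀ ch, OK ch → s.var rCnt = (occ (fun i => y.getD i 0) m (x.getD p 0) j n).length)
    (hmem : ∀ ch, OK ch → ∀ i, (hi : i < ch.length) → ch[i].1 = p →
      ch[i].2 ∈ occ (fun i => y.getD i 0) m (x.getD p 0) j n) :
    Tri V cols s (s.var rCnt * (colTime * (L + 1)) + 2 * (var rCnt).forWeight)
      fun s' => Patience x y OK p 0 (s'.var rLen) (s'.arr aThr) := by
  set oc := occ (fun i => y.getD i 0) m (x.getD p 0) j n with hoc
  have hpw : oc.Pairwise (· < ·) := occ_pairwise _ _ _ _ _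
  have hsort : ∀ a b, a < b → b < oc.length → oc.getD a 0 < oc.getD b 0 := by
    intro a b hab hb
    rw [List.getD_eq_getElem _ _ hb, List.getD_eq_getElem _ _ (hab.trans hb)]
    exact List.pairwise_iff_getElem.1 hpw a b (hab.trans hb) hb hab
  have hget : ∀ a < oc.length, oc.getD a 0 ∈ oc := by
    intro a ha
    rw [List.getD_eq_getElem _ _ ha]
    exact List.getElem_mem ha
  have hidx : ∀ q ∈ oc, ∃ a < oc.length, oc.getD a 0 = q := by
    intro q hq
    obtain ⟨a, ha, rfl⟩ := List.getElem_of_mem hq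
    exact ⟨a, ha, List.getD_eq_getElem _ _ ha⟩
  set cn := s.var rCnt with hcn
  -- The last column handled after `u` rounds; `n` is a sentinel to the right of all columns.
  let qc : ℕ → ℕ := fun u => if u = 0 then n else oc.getD (cn - u) 0
  refine Tri.mono (τ := cn * (insertTime * (L + 1)) + (cn + 2) * (var rCnt).forWeight)
    (Tri.for_const (fun u s' => Patience x y OK p (qc u) (s'.var rLen) (s'.arr aThr)) rfl
    (hs.var _) ?_ ?_ ?_ (fun s' _ hA h => h)) ?_ ?_
  · intro k s' _ _ hA _
    simp [hA.var rCnt rfl, hcn]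
  · simpa [qc] using hP
  · intro u s' hu hv hA hB hI
    have hqm := hget (cn - 1 - u) (by omega)
    have hqm' := mem_occ.1 hqm
    have hsub : cn - (u + 1) = cn - 1 - u := by omega
    refine (insertCol_spec (hR.agrees hA rfl rfl rfl rfl rfl rfl rfl) hx hy hn hV
      (q := oc.getD (cn - 1 - u) 0) ?_ hI hOK ?_ hp hqm'.1 hqm'.2.1.symm ?_).mono ?_ le_rfl
    · rw [hA.var rKey rfl, hA.var rCnt rfl, hA.arr aPos rfl, hv, hkey]
      exact hR.pos _ _ _ hj (show cn - 1 - u < oc.length by omega)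
    · simp only [qc]
      split_ifs with h
      · exact hqm'.1
      · exact hsort _ _ (by omega) (by omega)
    · intro ch hch i hi hip hlt
      have hfull := hcnt' ch hch
      obtain ⟨a, ha, hae⟩ := hidx _ (hmem ch hch i hi hip)
      rw [← hae] at hlt ⊢
      have : cn - 1 - u < a := by
        by_contra hcon
        rcases Nat.eq_or_lt_of_le (not_lt.1 hcon) with h | h
        · rw [h] at hlt; omega
        · have := hsort _ _ h (by omega); omega
      simp only [qc]
      split_ifs with h
      · omega
      · rcases Nat.eq_or_lt_of_le (show cn - u ≤ a by omega) with h' | h'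
        · rw [h']
        · exact (hsort _ _ h' ha).le
    · intro s'' hA' _ h
      simpa [qc, hsub] using h
  · intro s' hA hB hI
    refine ⟨hI.lt, hI.mono, hI.sound, fun k hk h => absurd h (Nat.not_lt_zero _), ?_⟩
    intro ch hch i hi hcase
    refine hI.complete ch hch i hi (hcase.imp id fun h => ⟨h.1, ?_⟩)
    obtain ⟨a, ha, hae⟩ := hidx _ (hmem ch hch i hi h.1)
    have hfull := hcnt' ch hch
    rw [← hae]
    simp only [qc]
    split_ifs with h0
    · omega
    · rw [Nat.sub_self]
      rcases Nat.eq_zero_or_pos a with rfl | h'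
      · exact le_rfl
      · exact (hsort _ _ h' ha).le
  · simp only [colTime]
    nlinarith [Nat.zero_le (cn * ((var rCnt).forWeight * L))]

/-- The first tape cell of an attempt selects the diagonal. The offset of the row in group `rRow` is
therefore read one cell later. -/
def pickRow : Prog :=
  .assign rP (var rRow * var rG + get aTape (var rBase + 1 + var rRow) % var rG)

/-- Products of truth values act as conjunctions, and `K < · + 1` expresses `K ≤ ·`. -/
def rowTest : Expr :=
  .bin .lt (var rP) (var rN) * (.bin .lt (var rK) (var rP / var rM + var rDiag + 1) *
    .bin .lt (var rP / var rM + var rDiag) (2 * var rK))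

def rowInit : Prog :=
  .seq (.assign rKey (get aX (var rP) * (var rN + 1) + (var rP / var rM + var rDiag - var rK)))
    (.seq (.assign rCnt (get aCnt (var rKey)))
    (.seq (.ite (.bin .lt (var rBudget) (var rCnt)) (.assign rCnt (var rBudget)) .skip)
      (.assign rBudget (var rBudget - var rCnt))))

/-- Handle all matching pairs in the sampled row, within the budget. -/
def row : Prog := .seq pickRow (.ite rowTest (.seq rowInit cols) .skip)

def rowTime : ℕ := pickRow.weight + rowTest.weight + rowInit.weight + 2 * (var rCnt).forWeight + 2

/-- The count `cn` of handled pairs is both what the row costs and what it takes from the budget, so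
summing over the rows gives an amortised time bound. -/
theorem row_spec {V : ℕ} {s : State} {x y : List ℕ} {n m K L d g o i : ℕ}
    {OK : List (ℕ × ℕ) → Prop} (hs : s.Bdd V) (hR : Ready x y n m K L s) (hx : x.length = n)
    (hy : y.length = n) (hn : n < 2 ^ L) (hV : n + 1 ≤ V) (hK : K ≤ n)
    (hVx : ∀ p, x.getD p 0 * (n + 1) + n ≤ V) (hVg : n + g ≤ V) (hg : 0 < g) (hi : i * g ≤ n)
    (hd : s.var rDiag = d) (hG : s.var rG = g) (hrow : s.var rRow = i)
    (ho : s.arr aTape (s.var rBase + 1 + i) % g = o)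
    (hP : Patience x y OK (i * g) n (s.var rLen) (s.arr aThr))
    (hOK : ∀ ch, OK ch → IsPairChain ch)
    (hmem : ∀ ch, OK ch → ∀ pq ∈ ch, pq.2 ∈ rowOcc x y n m K d pq.1)
    (hoff : ∀ ch, OK ch → ∀ pq ∈ ch, pq.1 / g = i → pq.1 % g = o)
    (hbud : ∀ ch, OK ch → (rowOcc x y n m K d (i * g + o)).length ≤ s.var rBudget) :
    ∃ cn, Tri V row s (rowTime + cn * (colTime * (L + 1))) fun s' =>
      s'.var rBudget + cn = s.var rBudget ∧
      ((rowOcc x y n m K d (i * g + o)).length ≤ s.var rBudget →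
        cn = (rowOcc x y n m K d (i * g + o)).length) ∧
      Patience x y OK ((i + 1) * g) n (s'.var rLen) (s'.arr aThr) := by
  set p := i * g + o with hp
  have hog : o < g := ho ▸ Nat.mod_lt _ hg
  have hlt_n : ∀ ch, OK ch → ∀ k, (hk : k < ch.length) → ch[k].2 < n := fun ch hch k hk =>
    (mem_rowOcc.1 (hmem ch hch _ (List.getElem_mem hk))).2.1
  have hcase : ∀ ch, OK ch → ∀ k, (hk : k < ch.length) → ch[k].1 < (i + 1) * g →
      ch[k].1 < i * g ∨ ch[k].1 = p := by
    intro ch hch k hk hlt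
    rcases Nat.lt_or_ge ch[k].1 (i * g) with h | h
    · exact Or.inl h
    · right
      have hdiv : ch[k].1 / g = i := Nat.div_eq_of_lt_le h hlt
      have := hoff ch hch _ (List.getElem_mem hk) hdiv
      rw [← Nat.div_add_mod ch[k].1 g, hdiv, this, hp, mul_comm]
  -- Chains in `OK` meet the group of rows `i * g, …, (i + 1) * g - 1` only in the sampled row `p`,
  -- so the rows around it can be skipped.
  have hPp : Patience x y OK p n (s.var rLen) (s.arr aThr) := by
    rcases Nat.eq_zero_or_pos o with h0 | h0
    · rw [hp, h0]; exact hP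
    · refine hP.advance (by omega) hlt_n fun ch hch k hk hlt => ?_
      have := hcase ch hch k hk (by rw [add_mul, one_mul]; omega)
      omega
  have hfin : ∀ {len : ℕ} {thr : ℕ → ℕ}, Patience x y OK p 0 len thr →
      Patience x y OK ((i + 1) * g) n len thr := by
    intro len thr h
    refine h.advance (by rw [add_mul, one_mul]; omega) hlt_n fun ch hch k hk hlt => ?_
    have := hcase ch hch k hk hlt
    omega
  have hpV : p ≤ V := by omega
  have e1 : pickRow.wp V (fun s₁ => s₁ = s.setVar rP p) s := by
    simp [pickRow, Prog.wp, hrow, hG, ho, ← hp, hpV]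
  by_cases hc : p < n ∧ K ≤ p / m + d ∧ p / m + d < 2 * K
  · have hocc : rowOcc x y n m K d p =
        occ (fun i => y.getD i 0) m (x.getD p 0) (p / m + d - K) n := by rw [rowOcc, if_pos hc]
    set oc := occ (fun i => y.getD i 0) m (x.getD p 0) (p / m + d - K) n with hoc
    have hjn : p / m + d - K ≤ n := by omega
    have hoclen : oc.length ≤ n := occ_length_le _ _ _ _ _
    rw [hocc] at hbud ⊢
    set cn := min oc.length (s.var rBudget) with hcn
    have hVp := hVx p
    have hsb := hs.var rBudget
    refine ⟨cn, ?_⟩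
    refine Tri.mono (τ := pickRow.weight + (1 + rowTest.weight + (rowInit.weight +
      (cn * (colTime * (L + 1)) + 2 * (var rCnt).forWeight))))
      (Tri.seq ((Tri.of_wp e1).mono ?_ le_rfl)) (fun _ _ _ h => h) ?_
    · rintro _ - hs₁ rfl
      refine Tri.ite (fun _ => Tri.seq (Tri.of_wp ?_)) (fun h => ?_)
      · have hkey := hR.cnt (x.getD p 0) (p / m + d - K) hjn
        rw [← hoc] at hkey
        have hspec : ∀ s₂ : State, s₂.Bdd V → s₂.var rKey = x.getD p 0 * (n + 1) +
            (p / m + d - K) → s₂.var rCnt = cn → s₂.var rBudget = s.var rBudget - cn →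
            s₂.var rLen = s.var rLen → s₂.arr aThr = s.arr aThr → Ready x y n m K L s₂ →
            Tri V cols s₂ (cn * (colTime * (L + 1)) + 2 * (var rCnt).forWeight) fun s' =>
              s'.var rBudget + cn = s.var rBudget ∧
              (oc.length ≤ s.var rBudget → cn = oc.length) ∧
              Patience x y OK ((i + 1) * g) n (s'.var rLen) (s'.arr aThr) := by
          intro s₂ hs₂ h1 h2 h3 h4 h5 hR₂
          have := cols_spec hs₂ hR₂ hx hy hn hV hjn h1 (by rw [h2]; exact min_le_left _ _)
            (by rw [h4, h5]; exact hPp) hOK hc.1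
            (fun ch hch => by rw [h2]; exact min_eq_left (hbud ch hch))
            (fun ch hch k hk hkp => by
              have := hmem ch hch _ (List.getElem_mem hk)
              rwa [hkp, hocc] at this)
          rw [h2] at this
          refine this.mono ?_ le_rfl
          intro s' hA _ h
          refine ⟨?_, by omega, hfin h⟩
          rw [hA.var rBudget rfl, h3]
          omega
        simp only [rowInit, Prog.wp, val_add, val_sub, val_mul, val_div, val_get, val_var,
          val_ofNat, val_lt, State.setVar_var, State.setVar_arr]
        simp only [hR.arr_x, hR.var_n, hR.var_K, hR.var_m, hd]
        simp [-List.getD_eq_getElem?_getD, hkey]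
        have hR' : ∀ {s' : State}, s'.arr = s.arr → (∀ v < 13, s'.var v = s.var v) →
            Ready x y n m K L s' := fun h1 h2 => hR.congr (h2 _ (by norm_num))
              (h2 _ (by norm_num)) (h2 _ (by norm_num)) (h2 _ (by norm_num))
              (by rw [h1]) (by rw [h1]) (by rw [h1])
        refine ⟨by omega, by omega, ?_⟩
        split_ifs with hb
        · refine ⟨by omega, Tri.of_bdd fun hs₂ => hspec _ hs₂ ?_ ?_ ?_ ?_ ?_ ?_⟩
          · simp
          · simp; omega
          · simp; omega
          · simp
          · simp
          · refine hR' rfl fun v hv => ?_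
            simp (disch := omega) only [State.setVar_var, if_neg]
        · refine ⟨by omega, Tri.of_bdd fun hs₂ => hspec _ hs₂ ?_ ?_ ?_ ?_ ?_ ?_⟩
          · simp
          · simp; omega
          · simp; omega
          · simp
          · simp
          · refine hR' rfl fun v hv => ?_
            simp (disch := omega) only [State.setVar_var, if_neg]
      · exfalso
        simp [rowTest, hR.var_n, hR.var_K, hR.var_m, hd] at h
        omega
    · simp only [rowTime]
      omega
  · have hocc : rowOcc x y n m K d p = [] := by rw [rowOcc, if_neg hc]
    refine ⟨0, ?_⟩
    refine Tri.mono (τ := pickRow.weight + (1 + rowTest.weight + 1))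
      (Tri.seq ((Tri.of_wp e1).mono ?_ le_rfl)) (fun _ _ _ h => h) (by simp only [rowTime]; omega)
    rintro _ - hs₁ rfl
    refine Tri.ite (fun h => ?_) (fun _ => Tri.skip ?_)
    · exfalso
      simp [rowTest, hR.var_n, hR.var_K, hR.var_m, hd] at h
      omega
    · refine ⟨by simp, by simp [hocc], hPp.advance (by rw [add_mul, one_mul]; omega) hlt_n ?_⟩
      intro ch hch k hk hlt
      rcases hcase ch hch k hk hlt with h | h
      · left; omega
      · have := hmem ch hch _ (List.getElem_mem hk)
        rw [h, hocc] at this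
        simp at this

end RAM

/-- The value `v` is at least the length of each chain of matching pairs that the attempt number
`r` with parameters `a`, `g` considers, provided that the attempt does not exceed its budget. The
attempt reads its random numbers from the tape `tp`. -/
def AttemptBound (x y : List ℕ) (n m K T D : ℕ) (tp : ℕ → ℕ) (a g r v : ℕ) : Prop :=
  ∀ ch, IsSampledChain x y n m K (tp (r * (n / g + 2)) % D) g
      (fun i => tp (r * (n / g + 2) + 1 + i) % g) ch →
    ∑ i ∈ Finset.range (n / g + 1), (rowOcc x y n m K (tp (r * (n / g + 2)) % D)
      (i * g + tp (r * (n / g + 2) + 1 + i) % g)).length ≤ T / a → ch.length ≤ v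

theorem AttemptBound.mono {x y : List ℕ} {n m K T D : ℕ} {tp : ℕ → ℕ} {a g r v v' : ℕ}
    (h : AttemptBound x y n m K T D tp a g r v) (hv : v ≤ v') :
    AttemptBound x y n m K T D tp a g r v' := fun ch h₁ h₂ => (h ch h₁ h₂).trans hv

namespace RAM
open RAM.Expr

/-! ### One attempt -/

/-- Attempts of one level read disjoint stretches of the tape, of `rRows + 1` cells each: one for
the diagonal and one offset per row group. -/
def attemptInit : Prog :=
  .seq (.assign rBase (var rTry * (var rRows + 1)))
    (.seq (.assign rDiag (get aTape (var rBase) % var rD))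
    (.seq (.assign rBudget (var rT / var rA)) (.assign rLen 0)))

def attemptEnd : Prog := .ite (.bin .lt (var rBest) (var rLen)) (.assign rBest (var rLen)) .skip

/-- Compute a longest chain of matching pairs in random rows of a random diagonal. -/
def attempt : Prog := .seq attemptInit (.seq (.for rRow (var rRows) row) attemptEnd)

def attemptTime : ℕ :=
  attemptInit.weight + rowTime + 2 * (var rRows).forWeight + attemptEnd.weight

/-- The time holds for every tape, because work on columns is limited by `T / a`. Optimality is
claimed only if the sampled rows fit into the budget. -/
theorem attempt_spec {V : ℕ} {s : State} {x y : List ℕ} {n m K L T D a g r : ℕ}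
    (hs : s.Bdd V) (hR : Ready x y n m K L s) (hx : x.length = n)
    (hy : y.length = n) (hn : n < 2 ^ L) (hV : n + 1 ≤ V) (hK : K ≤ n)
    (hVx : ∀ p, x.getD p 0 * (n + 1) + n ≤ V) (hVg : n + g ≤ V) (hg : 0 < g)
    (hT : s.var rT = T) (hD : s.var rD = D) (ha : s.var rA = a) (hG : s.var rG = g)
    (hRows : s.var rRows = n / g + 1) (hr : s.var rTry = r) (hVr : r * (n / g + 2) ≤ V) :
    Tri V attempt s (attemptTime * (n / g + 2) + T / a * (colTime * (L + 1))) fun s' =>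
      s.var rBest ≤ s'.var rBest ∧ (s.var rBest ≤ lcsLen x y → s'.var rBest ≤ lcsLen x y) ∧
      AttemptBound x y n m K T D (s.arr aTape) a g r (s'.var rBest) := by
  set d := s.arr aTape (r * (n / g + 2)) % D with hd
  set off : ℕ → ℕ := fun i => s.arr aTape (r * (n / g + 2) + 1 + i) % g with hoff
  -- The second condition does not involve `ch`. If the budget is too small, `OK` is empty and
  -- completeness becomes vacuous, so no case distinction is needed.
  set OK : List (ℕ × ℕ) → Prop := fun ch => IsSampledChain x y n m K d g off ch ∧
    ∑ i ∈ Finset.range (n / g + 1), (rowOcc x y n m K d (i * g + off i)).length ≤ T / a with hOK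
  have hlt_n : ∀ ch, OK ch → ∀ k, (hk : k < ch.length) → ch[k].2 < n := fun ch hch k hk =>
    (mem_rowOcc.1 (hch.1.mem _ (List.getElem_mem hk))).2.1
  have hTV : T / a ≤ V := (Nat.div_le_self _ _).trans (hT ▸ hs.var _)
  have hgn : n / g * g ≤ n := Nat.div_mul_le_self n g
  refine Tri.mono (τ := attemptInit.weight + (((n / g + 1) * rowTime + T / a * (colTime * (L + 1)) +
    ((n / g + 1) + 2) * (var rRows).forWeight) + attemptEnd.weight))
    (Tri.seq (Tri.of_wp ?_)) (fun _ _ _ h => h) ?_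
  · have hdV : d ≤ V := (Nat.mod_le _ _).trans (hs.arr _ _)
    have e : n / g + 1 + 1 = n / g + 2 := rfl
    simp only [attemptInit, Prog.wp, val_mul, val_add, val_var, val_ofNat, val_get, val_mod,
      val_div, State.setVar_var, State.setVar_arr]
    simp only [hr, hRows, hT, ha, hD, e]
    simp [← hd]
    refine ⟨hVr, hdV, hTV, ?_⟩
    generalize hs₁ : ((((s.setVar rBase (r * (n / g + 2))).setVar rDiag d).setVar rBudget
      (T / a)).setVar rLen 0) = s₁
    have hR₁ : Ready x y n m K L s₁ := hR.congr (by simp [← hs₁]) (by simp [← hs₁])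
      (by simp [← hs₁]) (by simp [← hs₁]) (by simp [← hs₁]) (by simp [← hs₁]) (by simp [← hs₁])
    have v_base : s₁.var rBase = r * (n / g + 2) := by simp [← hs₁]
    have v_diag : s₁.var rDiag = d := by simp [← hs₁]
    have v_bud : s₁.var rBudget = T / a := by simp [← hs₁]
    have v_len : s₁.var rLen = 0 := by simp [← hs₁]
    have v_best : s₁.var rBest = s.var rBest := by simp [← hs₁]
    have v_g : s₁.var rG = g := by simp [← hs₁, hG]
    have v_rows : s₁.var rRows = n / g + 1 := by simp [← hs₁, hRows]
    have v_tape : s₁.arr aTape = s.arr aTape := by simp [← hs₁]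
    refine Tri.seq (Tri.of_bdd fun hB₁ => ?_)
    -- The remaining budget is a potential: time spent plus the value of what is left stays below
    -- the fixed cost of `k` rows plus the value of the initial budget.
    refine Tri.for (fun k τ s' => s'.var rBudget ≤ T / a ∧
      τ + s'.var rBudget * (colTime * (L + 1)) ≤
        k * rowTime + T / a * (colTime * (L + 1)) ∧
      Patience x y OK (k * g) n (s'.var rLen) (s'.arr aThr) ∧
      ∀ ch, OK ch → s'.var rBudget +
        ∑ i ∈ Finset.range k, (rowOcc x y n m K d (i * g + off i)).length = T / a)
      rfl (by rw [← v_rows]; exact hB₁.var _) ?_ ?_ ?_ ?_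
    · intro k τ s' _ _ hA _
      simp [hA.var rRows rfl, v_rows]
    · simp [v_bud, v_len]
      exact Patience.start _ _ _ _ hlt_n
    · intro k τ s' hk hv hA hB' ⟨h1, h2, h3, h4⟩
      have hkg : k * g ≤ n := (Nat.mul_le_mul_right g (by omega)).trans hgn
      obtain ⟨cn, hT'⟩ := row_spec (OK := OK) (o := off k) hB'
        (hR₁.agrees hA rfl rfl rfl rfl rfl rfl rfl) hx hy hn hV hK hVx hVg hg hkg
        ((hA.var rDiag rfl).trans v_diag) ((hA.var rG rfl).trans v_g) hv
        (by rw [hA.arr aTape rfl, hA.var rBase rfl, v_tape, v_base]) h3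
        (fun ch hch => hch.1.chain) (fun ch hch => hch.1.mem)
        (fun ch hch pq hpq hk => hk ▸ hch.1.off pq hpq) (by
          intro ch hch
          have h5 := h4 ch hch
          have h6 := hch.2
          have h7 := Finset.sum_le_sum_of_subset (f := fun i =>
            (rowOcc x y n m K d (i * g + off i)).length)
            (Finset.range_subset_range.2 (show k + 1 ≤ n / g + 1 by omega))
          rw [Finset.sum_range_succ] at h7
          omega)
      refine ⟨_, hT'.mono ?_ le_rfl⟩
      rintro s'' hA' hB'' ⟨g1, g2, g3⟩
      simp
      refine ⟨by omega, ?_, g3, ?_⟩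
      · rw [← g1] at h2
        rw [add_mul] at h2
        rw [add_mul, one_mul]
        omega
      · intro ch hch
        have h5 := h4 ch hch
        rw [Finset.sum_range_succ]
        have h6 := hch.2
        have h7 := Finset.sum_le_sum_of_subset (f := fun i =>
          (rowOcc x y n m K d (i * g + off i)).length)
          (Finset.range_subset_range.2 (show k + 1 ≤ n / g + 1 by omega))
        rw [Finset.sum_range_succ] at h7
        have h8 := g2 (by omega)
        omega
    · rintro τ s' hv hA ⟨h1, h2, h3, h4⟩
      refine ⟨Tri.of_bdd fun hB' => Tri.of_wp ?_, by omega⟩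
      have hb : s'.var rBest = s.var rBest := (hA.var rBest rfl).trans v_best
      have hcomp : ∀ ch, OK ch → ch.length ≤ s'.var rLen := by
        intro ch hch
        by_contra hcon
        have hl : s'.var rLen < ch.length := by omega
        have hmem := (mem_rowOcc.1 (hch.1.mem _ (List.getElem_mem hl))).1.1
        have hlt : n < (n / g + 1) * g := by
          have := Nat.lt_div_mul_add (a := n) hg
          rw [add_mul, one_mul]; exact this
        have := (h3.complete ch hch _ hl (Or.inl (by omega))).1
        omega
      have hsound := h3.len_le
      simp only [attemptEnd, Prog.wp, val_lt, val_var, hb]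
      by_cases hc : s.var rBest < s'.var rLen
      · simp [hc]
        exact ⟨hB'.var _, hc.le, fun _ => hsound, fun ch h₁ h₂ => hcomp ch ⟨h₁, h₂⟩⟩
      · simp [hc]
        exact fun ch h₁ h₂ => (hcomp ch ⟨h₁, h₂⟩).trans (not_lt.1 hc)
  · simp only [attemptTime]
    nlinarith [Nat.zero_le (n / g), Nat.zero_le attemptInit.weight,
      Nat.zero_le attemptEnd.weight, Nat.zero_le (var rRows).forWeight,
      Nat.zero_le (attemptInit.weight * (n / g)), Nat.zero_le (attemptEnd.weight * (n / g)),
      Nat.zero_le ((var rRows).forWeight * (n / g)), Nat.zero_le rowTime]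

end RAM

namespace RAM
open RAM.Expr

/-! ### All attempts -/

def levelInit : Prog := .assign rRows (var rN / var rG + 1)

/-- Levels that would read more than `64 T` tape cells per repetition are skipped. `exists_level`
shows that the level needed is not among them. -/
def levelTest : Expr := .bin .lt (64 * var rT) (var rA * (var rRows + 1))

/-- All attempts for one choice of the parameters `a` (budget) and `g` (sampling distance). -/
def level : Prog :=
  .seq levelInit (.ite levelTest .skip (.for rTry (var rA * var rRep) attempt))

def doubleG : Prog := .assign rG (var rG * 2)

def doubleA : Prog := .assign rA (var rA * 2)

def gammaLoop : Prog := .for rGamma (var rLev) (.seq level doubleG)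

def alphaBody : Prog := .seq (.assign rG 1) (.seq gammaLoop doubleA)

/-- The output register is also the one that holds `n`, so the best value is moved there only at the
very end. -/
def attempts : Prog :=
  .seq (.assign rA 1) (.seq (.for rAlpha (var rLev) alphaBody) (.assign rN (var rBest)))

def levelTime : ℕ :=
  levelInit.weight + levelTest.weight + 2 + 64 * attemptTime + colTime +
    66 * (var rA * var rRep).forWeight

/-- The hypotheses on the memory and on the sizes of numbers under which the attempts run. -/
structure Setup (x y : List ℕ) (n m K L T D lev rep V : ℕ) (tp : ℕ → ℕ) (s : State) : Prop where
  ready : Ready x y n m K L s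
  hx : x.length = n
  hy : y.length = n
  hn : n < 2 ^ L
  hV : n + 2 ^ lev ≤ V
  hK : K ≤ n
  hT : 1 ≤ T
  hVx : ∀ p, x.getD p 0 * (n + 1) + n ≤ V
  hVT : 64 * T * rep ≤ V
  var_T : s.var rT = T
  var_D : s.var rD = D
  var_lev : s.var rLev = lev
  var_rep : s.var rRep = rep
  tape : s.arr aTape = tp

theorem Setup.congr {x y : List ℕ} {n m K L T D lev rep V : ℕ} {tp : ℕ → ℕ} {s s' : State}
    (h : Setup x y n m K L T D lev rep V tp s) (hv : ∀ v < 12, v ≠ rBest → s'.var v = s.var v)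
    (ha : ∀ b < 5, s'.arr b = s.arr b) : Setup x y n m K L T D lev rep V tp s' :=
  { h with
    ready := h.ready.congr (hv _ (by norm_num) (by norm_num)) (hv _ (by norm_num) (by norm_num))
      (hv _ (by norm_num) (by norm_num)) (hv _ (by norm_num) (by norm_num)) (ha _ (by norm_num))
      (ha _ (by norm_num)) (ha _ (by norm_num))
    var_T := (hv _ (by norm_num) (by norm_num)).trans h.var_T
    var_D := (hv _ (by norm_num) (by norm_num)).trans h.var_D
    var_lev := (hv _ (by norm_num) (by norm_num)).trans h.var_lev
    var_rep := (hv _ (by norm_num) (by norm_num)).trans h.var_rep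
    tape := (ha _ (by norm_num)).trans h.tape }

theorem Setup.agrees {x y : List ℕ} {n m K L T D lev rep V : ℕ} {tp : ℕ → ℕ} {s s' : State}
    (h : Setup x y n m K L T D lev rep V tp s) {P : Prog} (hA : P.Agrees s s')
    (hv : ∀ v < 12, v ≠ rBest → P.writesVar v = false) (ha : ∀ b < 5, P.writesArr b = false) :
    Setup x y n m K L T D lev rep V tp s' :=
  h.congr (fun v h₁ h₂ => hA.var v (hv v h₁ h₂)) (fun b hb => hA.arr b (ha b hb))

/-- The value `v` takes into account all attempts with parameters `a` and `g`. -/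
def LevelBound (x y : List ℕ) (n m K T D rep : ℕ) (tp : ℕ → ℕ) (a g v : ℕ) : Prop :=
  a * (n / g + 2) ≤ 64 * T → ∀ r < a * rep, AttemptBound x y n m K T D tp a g r v

/-- The invariant of the loops: the best value so far, and its relation to the initial one. -/
def Better (x y : List ℕ) (s s' : State) : Prop :=
  s.var rBest ≤ s'.var rBest ∧ (s.var rBest ≤ lcsLen x y → s'.var rBest ≤ lcsLen x y)

theorem Better.trans {x y : List ℕ} {s s' s'' : State} (h : Better x y s s')
    (h' : Better x y s' s'') : Better x y s s'' :=
  ⟨h.1.trans h'.1, fun hb => h'.2 (h.2 hb)⟩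

theorem Better.of_eq {x y : List ℕ} {s s' : State} (h : s'.var rBest = s.var rBest) :
    Better x y s s' := ⟨h.ge, fun hb => h ▸ hb⟩

theorem level_spec {V : ℕ} {s : State} {x y : List ℕ} {n m K L T D lev rep a g : ℕ}
    {tp : ℕ → ℕ} (hS : Setup x y n m K L T D lev rep V tp s)
    (ha : s.var rA = a) (hG : s.var rG = g) (hg : 0 < g) (hglev : g ≤ 2 ^ lev) :
    Tri V level s (levelTime * ((rep + 1) * T * (L + 1))) fun s' =>
      Better x y s s' ∧ LevelBound x y n m K T D rep tp a g (s'.var rBest) := by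
  have hn1 : n / g ≤ n := Nat.div_le_self _ _
  have hpow : 0 < 2 ^ lev := by positivity
  have hV := hS.hV
  have hT := hS.hT
  refine Tri.mono (τ := levelInit.weight + (1 + levelTest.weight +
    (1 + rep * (64 * T) * attemptTime + rep * T * (colTime * (L + 1)) +
      (rep * (64 * T) + 2) * (var rA * var rRep).forWeight)))
    (Tri.seq (Tri.of_wp ?_)) (fun _ _ _ h => h) ?_
  · simp only [levelInit, Prog.wp, val_div, val_add, val_var, val_ofNat, hS.ready.var_n, hG]
    refine ⟨by omega, ?_⟩
    generalize hs₁ : s.setVar rRows (n / g + 1) = s₁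
    have hS₁ : Setup x y n m K L T D lev rep V tp s₁ := hS.congr
      (fun v h₁ h₂ => by rw [← hs₁, State.setVar_var, if_neg (by omega)])
      (fun b _ => by rw [← hs₁]; rfl)
    have v_rows : s₁.var rRows = n / g + 1 := by simp [← hs₁]
    have v_a : s₁.var rA = a := by simp [← hs₁, ha]
    have v_g : s₁.var rG = g := by simp [← hs₁, hG]
    have v_best : s₁.var rBest = s.var rBest := by simp [← hs₁]
    have htest : levelTest.val s₁ = if 64 * T < a * (n / g + 2) then 1 else 0 := by
      simp [levelTest, hS₁.var_T, v_a, v_rows]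
    refine Tri.ite (fun h => ?_) (fun h => ?_)
    · rw [htest] at h
      have hlt : 64 * T < a * (n / g + 2) := by
        by_contra hcon
        simp [hcon] at h
      refine (Tri.skip ?_).mono (fun _ _ _ h => h) (by omega)
      exact ⟨.of_eq v_best, fun hle => absurd hle (by omega)⟩
    · rw [htest] at h
      have hle : a * (n / g + 2) ≤ 64 * T := by
        by_contra hcon
        simp [Nat.lt_of_not_le hcon] at h
      have harep : a * rep * (n / g + 2) ≤ 64 * T * rep := by
        calc a * rep * (n / g + 2) = a * (n / g + 2) * rep := by ring
          _ ≤ _ := Nat.mul_le_mul_right _ hle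
      have harep' : a * rep ≤ 64 * T * rep :=
        (Nat.le_mul_of_pos_right _ (by omega)).trans harep
      have hVT := hS.hVT
      refine Tri.mono (Tri.for_const (N := a * rep)
        (τ₁ := attemptTime * (n / g + 2) + T / a * (colTime * (L + 1)))
        (fun k s' => Better x y s s' ∧
          ∀ r < k, AttemptBound x y n m K T D tp a g r (s'.var rBest))
        rfl (by omega) ?_ ?_ ?_ ?_) (fun _ _ _ h => h) ?_
      · intro k s' _ _ hA _
        simp [hA.var rA rfl, hA.var rRep rfl, v_a, hS₁.var_rep]
      · exact ⟨.of_eq (by simp [v_best]), by simp⟩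
      · intro k s' hk hv hA hB' ⟨h1, h2⟩
        have hS' := hS₁.agrees hA (by decide) (by decide)
        have hkV : k * (n / g + 2) ≤ V :=
          (Nat.mul_le_mul_right _ hk.le).trans (harep.trans hVT)
        refine (attempt_spec hB' hS'.ready hS.hx hS.hy hS.hn (by omega) hS.hK hS.hVx (by omega) hg
          hS'.var_T hS'.var_D ((hA.var rA rfl).trans v_a) ((hA.var rG rfl).trans v_g)
          ((hA.var rRows rfl).trans v_rows) hv hkV).mono ?_ le_rfl
        rintro s'' - - ⟨g1, g2, g3⟩
        rw [hS'.tape] at g3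
        refine ⟨h1.trans ⟨by simpa using g1, by simpa using g2⟩, ?_⟩
        intro r hr
        rcases Nat.lt_succ_iff_lt_or_eq.1 hr with h | rfl
        · exact (h2 r h).mono (by simpa using g1)
        · simpa using g3
      · intro s' _ _ h
        exact ⟨h.1, fun _ => h.2⟩
      -- The factor `a` cancels: the rows cost `a * (n / g + 2) ≤ 64 T` and the columns `a * (T / a)
      -- ≤ T`, both times `rep`.
      · have e1 : a * rep * (attemptTime * (n / g + 2) + T / a * (colTime * (L + 1))) =
            rep * (a * (n / g + 2)) * attemptTime + rep * (T / a * a) * (colTime * (L + 1)) := by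
          ring
        have e2 : T / a * a ≤ T := Nat.div_mul_le_self T a
        have e3 : rep * (a * (n / g + 2)) * attemptTime ≤ rep * (64 * T) * attemptTime := by gcongr
        have e4 : rep * (T / a * a) * (colTime * (L + 1)) ≤ rep * T * (colTime * (L + 1)) := by
          gcongr
        have e5 : (a * rep + 2) * (var rA * var rRep).forWeight ≤
            (rep * (64 * T) + 2) * (var rA * var rRep).forWeight :=
          Nat.mul_le_mul_right _ (by rw [mul_comm rep]; omega)
        omega
  · have h1 : 1 ≤ (rep + 1) * T * (L + 1) := Nat.one_le_iff_ne_zero.2 (by positivity)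
    have h2 : rep * T ≤ (rep + 1) * T * (L + 1) :=
      calc rep * T ≤ (rep + 1) * T := by gcongr; omega
        _ ≤ _ := Nat.le_mul_of_pos_right _ (by omega)
    have h3 : rep * T * (L + 1) ≤ (rep + 1) * T * (L + 1) := by gcongr; omega
    generalize (rep + 1) * T * (L + 1) = M at *
    simp only [levelTime]
    generalize levelInit.weight = w1
    generalize levelTest.weight = w2
    generalize attemptTime = w3
    generalize colTime = w4
    generalize (var rA * var rRep).forWeight = w5
    have e1 : w1 ≤ w1 * M := Nat.le_mul_of_pos_right _ (by omega)
    have e2 : w2 ≤ w2 * M := Nat.le_mul_of_pos_right _ (by omega)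
    have e3 : rep * (64 * T) * w3 ≤ 64 * w3 * M := by
      calc rep * (64 * T) * w3 = 64 * w3 * (rep * T) := by ring
        _ ≤ _ := Nat.mul_le_mul_left _ h2
    have e4 : rep * T * (w4 * (L + 1)) ≤ w4 * M := by
      calc rep * T * (w4 * (L + 1)) = w4 * (rep * T * (L + 1)) := by ring
        _ ≤ _ := Nat.mul_le_mul_left _ h3
    have e5 : (rep * (64 * T) + 2) * w5 ≤ 66 * w5 * M := by
      calc (rep * (64 * T) + 2) * w5 = 64 * w5 * (rep * T) + 2 * w5 * 1 := by ring
        _ ≤ 64 * w5 * M + 2 * w5 * M := by gcongr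
        _ = _ := by ring
    simp only [add_mul] at e5 ⊢
    omega

/-- The time for all attempts, in units, apart from factors depending on the input. -/
def attemptsTime : ℕ :=
  levelTime + doubleG.weight + 3 * (var rLev).forWeight + (Prog.assign rG 1).weight +
    doubleA.weight + 3 * (var rLev).forWeight + (Prog.assign rA 1).weight +
    (Prog.assign rN (var rBest)).weight

theorem gammaLoop_spec {V : ℕ} {s : State} {x y : List ℕ} {n m K L T D lev rep a : ℕ}
    {tp : ℕ → ℕ} (hS : Setup x y n m K L T D lev rep V tp s)
    (ha : s.var rA = a) (hG : s.var rG = 1) (hlev : lev ≤ V) :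
    Tri V gammaLoop s (lev * (levelTime * ((rep + 1) * T * (L + 1)) + doubleG.weight) +
        (lev + 2) * (var rLev).forWeight) fun s' =>
      Better x y s s' ∧ ∀ γ < lev, LevelBound x y n m K T D rep tp a (2 ^ γ) (s'.var rBest) := by
  refine Tri.for_const (fun k s' => s'.var rG = 2 ^ k ∧ Better x y s s' ∧
    ∀ γ < k, LevelBound x y n m K T D rep tp a (2 ^ γ) (s'.var rBest)) rfl hlev ?_ ?_ ?_ ?_
  · intro k s' _ _ hA _
    simp [hA.var rLev rfl, hS.var_lev]
  · exact ⟨by simp [hG], .of_eq (by simp), by simp⟩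
  · intro k s' hk hv hA hB ⟨h1, h2, h3⟩
    have hS' := hS.agrees hA (by decide) (by decide)
    have hpow : 2 ^ k ≤ 2 ^ lev := Nat.pow_le_pow_right (by norm_num) hk.le
    have hpow' : 2 ^ (k + 1) ≤ 2 ^ lev := Nat.pow_le_pow_right (by norm_num) hk
    refine Tri.seq ((level_spec hS' ((hA.var rA rfl).trans ha) h1 (by positivity) hpow).mono
      ?_ le_rfl)
    rintro s'' hA' - ⟨g1, g2⟩
    have hV := hS.hV
    have hG' : s''.var rG = 2 ^ k := (hA'.var rG rfl).trans h1
    refine Tri.of_wp ?_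
    simp only [doubleG, Prog.wp, val_mul, val_var, val_ofNat, hG', ← pow_succ]
    refine ⟨by omega, by simp, h2.trans ⟨by simpa using g1.1, by simpa using g1.2⟩, ?_⟩
    intro γ hγ
    rcases Nat.lt_succ_iff_lt_or_eq.1 hγ with h | rfl
    · exact fun hle r hr => (h3 γ h hle r hr).mono (by simpa using g1.1)
    · simpa using g2
  · intro s' _ _ h
    exact h.2

theorem attempts_spec {V : ℕ} {s : State} {x y : List ℕ} {n m K L T D lev rep : ℕ}
    {tp : ℕ → ℕ} (hS : Setup x y n m K L T D lev rep V tp s)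
    (hbest : s.var rBest ≤ lcsLen x y) :
    Tri V attempts s (attemptsTime * ((lev + 1) ^ 2 * ((rep + 1) * T * (L + 1)))) fun s' =>
      s.var rBest ≤ s'.var rN ∧ s'.var rN ≤ lcsLen x y ∧
      ∀ α < lev, ∀ γ < lev, LevelBound x y n m K T D rep tp (2 ^ α) (2 ^ γ) (s'.var rN) := by
  have hV := hS.hV
  have hT := hS.hT
  have hpow : lev < 2 ^ lev := Nat.lt_two_pow_self
  refine Tri.mono (τ := (Prog.assign rA 1).weight + ((lev * ((Prog.assign rG 1).weight +
    ((lev * (levelTime * ((rep + 1) * T * (L + 1)) + doubleG.weight) +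
        (lev + 2) * (var rLev).forWeight) + doubleA.weight)) + (lev + 2) * (var rLev).forWeight) +
    (Prog.assign rN (var rBest)).weight))
    (Tri.seq (Tri.of_wp (P := .assign rA 1) ⟨by simp; omega, Tri.seq (Tri.for_const
      (fun k s' => s'.var rA = 2 ^ k ∧ Better x y s s' ∧
        ∀ α < k, ∀ γ < lev, LevelBound x y n m K T D rep tp (2 ^ α) (2 ^ γ) (s'.var rBest))
      rfl (by omega) ?_ ?_ ?_ ?_)⟩)) (fun _ _ _ h => h) ?_
  · intro k s' _ _ hA _
    simp [hA.var rLev rfl, hS.var_lev]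
  · exact ⟨by simp, .of_eq (by simp), by simp⟩
  · intro k s' hk hv hA hB ⟨h1, h2, h3⟩
    have hS₀ : Setup x y n m K L T D lev rep V tp (s.setVar rA ((1 : Expr).val s)) :=
      hS.congr (fun v h₁ h₂ => by rw [State.setVar_var, if_neg (by omega)]) (fun b _ => rfl)
    have hS' := hS₀.agrees hA (by decide) (by decide)
    have hS'' : Setup x y n m K L T D lev rep V tp (s'.setVar rG 1) :=
      hS'.congr (fun v h₁ h₂ => by rw [State.setVar_var, if_neg (by omega)]) (fun b _ => rfl)
    have hpow' : 2 ^ (k + 1) ≤ 2 ^ lev := Nat.pow_le_pow_right (by norm_num) hk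
    refine Tri.seq (Tri.of_wp (P := .assign rG 1) ⟨by simp; omega, Tri.seq ?_⟩)
    refine (gammaLoop_spec hS'' (a := 2 ^ k) (by simp [h1]) (by simp) (by omega)).mono ?_ le_rfl
    rintro s'' hA' - ⟨g1, g2⟩
    have hA'' : s''.var rA = 2 ^ k := (hA'.var rA rfl).trans (by simp [h1])
    refine Tri.of_wp ?_
    simp only [doubleA, Prog.wp, val_mul, val_var, val_ofNat, hA'', ← pow_succ]
    refine ⟨by omega, by simp, h2.trans ⟨by simpa using g1.1, by simpa using g1.2⟩, ?_⟩
    intro α hα γ hγ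
    rcases Nat.lt_succ_iff_lt_or_eq.1 hα with h | rfl
    · exact fun hle r hr => (h3 α h γ hγ hle r hr).mono (by simpa using g1.1)
    · simpa using g2 γ hγ
  · rintro s' hv hA ⟨h1, h2, h3⟩
    refine Tri.of_bdd fun hB => Tri.of_wp ?_
    simp only [Prog.wp, val_var]
    exact ⟨hB.var _, by simpa using h2.1, by simpa using h2.2 hbest, by simpa using h3⟩
  · have h1 : 1 ≤ (rep + 1) * T * (L + 1) := Nat.one_le_iff_ne_zero.2 (by positivity)
    generalize (rep + 1) * T * (L + 1) = M at *
    simp only [attemptsTime]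
    generalize levelTime = w1
    generalize doubleG.weight = w2
    generalize (var rLev).forWeight = w3
    generalize (Prog.assign rG 1).weight = w4
    generalize doubleA.weight = w5
    generalize (Prog.assign rA 1).weight = w6
    generalize (Prog.assign rN (var rBest)).weight = w7
    have hsq : ∀ w c : ℕ, c ≤ (lev + 1) ^ 2 * M → c * w ≤ w * ((lev + 1) ^ 2 * M) := by
      intro w c hc
      rw [mul_comm]
      exact Nat.mul_le_mul_left _ hc
    have hM : (lev + 1) ^ 2 ≤ (lev + 1) ^ 2 * M := Nat.le_mul_of_pos_right _ (by omega)
    have e1 := hsq w1 (lev * lev * M) (Nat.mul_le_mul_right _ (by nlinarith))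
    have e2 := hsq w2 (lev * lev) (by nlinarith)
    have e3 := hsq w3 (lev * lev) (by nlinarith)
    have e3' := hsq w3 lev (by nlinarith)
    have e3'' := hsq w3 1 (by nlinarith)
    have e4 := hsq w4 lev (by nlinarith)
    have e5 := hsq w5 lev (by nlinarith)
    have e6 := hsq w6 1 (by nlinarith)
    have e7 := hsq w7 1 (by nlinarith)
    generalize (lev + 1) ^ 2 * M = X at *
    ring_nf at e1 e2 e3 e3' e3'' e4 e5 e6 e7 ⊢
    linarith

end RAM

/-! ### Arithmetic of block lengths and of table addresses -/

/-- Squaring removes the root, so the program can find the block length with integers alone, by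
counting up. -/
theorem blockLen_le_iff {n T k : ℕ} (hT : 1 ≤ T) : blockLen n T ≤ k ↔ n * n ≤ k * k * T := by
  have hT' : (0 : ℝ) < T := by exact_mod_cast hT
  have hs : 0 < √(T : ℝ) := Real.sqrt_pos.2 hT'
  rw [blockLen, Nat.ceil_le, div_le_iff₀ hs]
  have e : (k : ℝ) * √(T : ℝ) = √((k * k * T : ℕ) : ℝ) := by
    push_cast
    rw [Real.sqrt_mul (by positivity), Real.sqrt_mul_self (by positivity)]
  rw [e, Real.le_sqrt (Nat.cast_nonneg _), sq]
  · exact_mod_cast Iff.rfl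
  · exact Nat.cast_nonneg _

theorem numBlocks_le {n m : ℕ} (hm : 1 ≤ m) : numBlocks n m ≤ n := by
  rw [numBlocks, Nat.div_le_iff_le_mul_add_pred (by omega)]
  have := Nat.le_mul_of_pos_left n hm
  omega

/-- Different pairs of symbol and block get different table addresses; likewise, rows sampled from
different groups are different. -/
theorem mul_add_inj {N a a' j j' : ℕ} (hj : j < N) (hj' : j' < N)
    (h : a * N + j = a' * N + j') : a = a' ∧ j = j' := by
  have hN : 0 < N := by omega
  have h1 := congrArg (· / N) h
  have h2 := congrArg (· % N) h
  simp only [mul_comm _ N, Nat.mul_add_div hN, Nat.mul_add_mod, Nat.div_eq_of_lt hj,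
    Nat.div_eq_of_lt hj', Nat.mod_eq_of_lt hj, Nat.mod_eq_of_lt hj'] at h1 h2
  omega

namespace RAM
open RAM.Expr

/-! ### Preparations -/

def blockLenLoop : Prog :=
  .for rI (var rN) (.ite (.bin .lt (var rM * var rM * var rT) (var rN * var rN))
    (.assign rM (var rM + 1)) .skip)

def blockLenTime (n : ℕ) : ℕ :=
  n * (Prog.ite (.bin .lt (var rM * var rM * var rT) (var rN * var rN))
    (.assign rM (var rM + 1)) .skip).weight + (n + 2) * (var rN).forWeight

theorem blockLenLoop_spec {V : ℕ} {s : State} {n T : ℕ} (hs : s.Bdd V) (hn : s.var rN = n)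
    (hT : s.var rT = T) (hT1 : 1 ≤ T) (hm : s.var rM = 0) :
    Tri V blockLenLoop s (blockLenTime n) fun s' => s'.var rM = blockLen n T := by
  have hnV : n ≤ V := hn ▸ hs.var _
  refine Tri.for_const (fun k s' => (∀ j < s'.var rM, j * j * T < n * n) ∧ s'.var rM ≤ k ∧
    (s'.var rM = k ∨ n * n ≤ s'.var rM * s'.var rM * T)) rfl hnV ?_ ?_ ?_ ?_
  · intro k s' _ _ hA _
    simp [hA.var rN rfl, hn]
  · simp [hm]
  · intro k s' hk hv hA hB ⟨h1, h2, h3⟩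
    refine Tri.of_wp ?_
    have en : s'.var rN = n := (hA.var rN rfl).trans hn
    have eT : s'.var rT = T := (hA.var rT rfl).trans hT
    simp only [Prog.wp, val_lt, val_mul, val_var, val_add, val_ofNat, en, eT]
    by_cases hc : s'.var rM * s'.var rM * T < n * n
    · simp [hc]
      refine ⟨by omega, ?_, by omega, by omega⟩
      intro j hj
      rcases Nat.eq_or_lt_of_le hj with rfl | h
      · exact hc
      · exact h1 j h
    · simp [hc]
      exact ⟨h1, by omega, by omega⟩
  · rintro s' hv hA ⟨h1, h2, h3⟩
    refine le_antisymm ?_ ((blockLen_le_iff hT1).2 ?_)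
    · by_contra hcon
      have := h1 _ (Nat.lt_of_not_le hcon)
      have := (blockLen_le_iff hT1).1 (le_refl (blockLen n T))
      omega
    · rcases h3 with h | h
      · rw [h]
        exact Nat.le_mul_of_pos_right _ hT1
      · exact h

def setK : Prog :=
  .seq (.assign rK ((var rN + var rM - 1) / var rM)) (.seq (.assign rPow 1) (.assign rD 1))

def logLoop : Prog :=
  .for rI (var rN) (.ite (.bin .lt (var rN) (var rPow)) .skip
    (.seq (.assign rPow (var rPow * 2)) (.assign rLog (var rLog + 1))))

def logTime (n : ℕ) : ℕ :=
  n * (Prog.ite (.bin .lt (var rN) (var rPow)) .skip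
    (.seq (.assign rPow (var rPow * 2)) (.assign rLog (var rLog + 1)))).weight +
    (n + 2) * (var rN).forWeight

theorem logLoop_spec {V : ℕ} {s : State} {n : ℕ} (hs : s.Bdd V) (hn : s.var rN = n) (hn1 : 1 ≤ n)
    (hV : 2 * n ≤ V) (hP : s.var rPow = 1) (hL : s.var rLog = 0) :
    Tri V logLoop s (logTime n) fun s' => s'.var rPow = 2 ^ s'.var rLog ∧
      n < 2 ^ s'.var rLog ∧ 2 ^ s'.var rLog ≤ 2 * n := by
  have hnV : n ≤ V := hn ▸ hs.var _
  -- `k < rPow` persists: doubling a positive number raises it by at least one, and without doubling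
  -- `rPow` already exceeds `n`. Hence `n` rounds suffice.
  refine Tri.for_const (fun k s' => s'.var rPow = 2 ^ s'.var rLog ∧ s'.var rPow ≤ 2 * n ∧
    k < s'.var rPow) rfl hnV ?_ ?_ ?_ ?_
  · intro k s' _ _ hA _
    simp [hA.var rN rfl, hn]
  · simp [hP, hL]
    omega
  · intro k s' hk hv hA hB ⟨h1, h2, h3⟩
    refine Tri.of_wp ?_
    have en : s'.var rN = n := (hA.var rN rfl).trans hn
    have hlog : s'.var rLog < 2 ^ s'.var rLog := Nat.lt_two_pow_self
    simp only [Prog.wp, val_lt, val_mul, val_var, val_add, val_ofNat, en]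
    by_cases hc : n < s'.var rPow
    · simp [hc]
      exact ⟨h1, h2, by omega⟩
    · simp [hc]
      refine ⟨by omega, by omega, by rw [h1, pow_succ], by omega, by omega⟩
  · rintro s' hv hA ⟨h1, h2, h3⟩
    rw [← h1]
    exact ⟨rfl, h3, h2⟩

/-- The number of diagonals is rounded up to a power of two. A drawn number modulo `D` is then
exactly uniform, at the price of some empty diagonals. -/
def diagLoop : Prog :=
  .for rI (2 * var rK) (.ite (.bin .lt (var rD) (2 * var rK)) (.assign rD (var rD * 2)) .skip)

def diagTime (K : ℕ) : ℕ :=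
  2 * K * (Prog.ite (.bin .lt (var rD) (2 * var rK)) (.assign rD (var rD * 2)) .skip).weight +
    (2 * K + 2) * (2 * var rK).forWeight

theorem diagLoop_spec {V : ℕ} {s : State} {K : ℕ} (hK : s.var rK = K) (hK1 : 1 ≤ K)
    (hV : 4 * K ≤ V) (hD : s.var rD = 1) :
    Tri V diagLoop s (diagTime K) fun s' => (∃ e, s'.var rD = 2 ^ e) ∧ 2 * K ≤ s'.var rD ∧
      s'.var rD ≤ 4 * K := by
  refine Tri.for_const (fun k s' => (∃ e, s'.var rD = 2 ^ e) ∧ s'.var rD ≤ 4 * K ∧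
    (k < s'.var rD ∨ 2 * K ≤ s'.var rD)) rfl (by omega) ?_ ?_ ?_ ?_
  · intro k s' _ _ hA _
    simp [hA.var rK rfl, hK]
  · simp [hD]
    exact ⟨⟨0, by simp⟩, by omega⟩
  · rintro k s' hk hv hA hB ⟨⟨e, h1⟩, h2, h3⟩
    refine Tri.of_wp ?_
    have eK : s'.var rK = K := (hA.var rK rfl).trans hK
    simp only [Prog.wp, val_lt, val_mul, val_var, val_ofNat, eK]
    by_cases hc : s'.var rD < 2 * K
    · simp [hc]
      exact ⟨by omega, ⟨e + 1, by rw [h1, pow_succ]⟩, by omega, by omega⟩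
    · simp [hc]
      exact ⟨⟨e, h1⟩, h2, by omega⟩
  · rintro s' hv hA ⟨h1, h2, h3⟩
    exact ⟨h1, by omega, h2⟩

/-- `rQ` equals `2 ^ (2 L + 10)`, a multiple of all moduli that matter. `64 T * rep` draws suffice
for any level that is run, and all levels share the same tape. -/
def setParams (c₀ : ℕ) : Prog :=
  .seq (.assign rQ (1024 * (var rPow * var rPow)))
    (.seq (.assign rLev (2 * var rLog + 11))
    (.seq (.assign rRep (.const c₀ * var rLog)) (.assign rDraws (64 * var rT * var rRep))))

/-! ### The table of occurrences -/

/-- Scanning `y` from left to right appends each position to the list of its symbol and block, so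
these lists are increasing. The arrays are initially zero, so the sparse address space needs no
clearing. -/
def tableBody : Prog :=
  .seq (.assign rKey (get aY (var rI) * (var rN + 1) + var rI / var rM))
    (.seq (.store aPos (var rKey * (var rN + 1) + get aCnt (var rKey)) (var rI))
    (.seq (.store aCnt (var rKey) (get aCnt (var rKey) + 1))
      (.store aHas (get aY (var rI)) 1)))

def tableLoop : Prog := .for rI (var rN) tableBody

def tableTime (n : ℕ) : ℕ := n * tableBody.weight + (n + 2) * (var rN).forWeight

theorem tableLoop_spec {V : ℕ} {s : State} {n m : ℕ} {y : List ℕ} (hs : s.Bdd V)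
    (hn : s.var rN = n) (hm : s.var rM = m)
    (hy : ∀ i, s.arr aY i = y.getD i 0) (hVy : ∀ i, y.getD i 0 * (n + 1) + n ≤ V)
    (hV : n + 1 ≤ V) (hc : ∀ i, s.arr aCnt i = 0) (hh : ∀ i, s.arr aHas i = 0) :
    Tri V tableLoop s (tableTime n) fun s' =>
      (∀ a j, j ≤ n →
        s'.arr aCnt (a * (n + 1) + j) = (occ (fun i => y.getD i 0) m a j n).length) ∧
      (∀ a j r, j ≤ n → r < (occ (fun i => y.getD i 0) m a j n).length →
        s'.arr aPos ((a * (n + 1) + j) * (n + 1) + r) =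
          (occ (fun i => y.getD i 0) m a j n).getD r 0) ∧
      ∀ a, s'.arr aHas a ≠ 0 ↔ ∃ q < n, y.getD q 0 = a := by
  have hnV : n ≤ V := hn ▸ hs.var _
  set f : ℕ → ℕ := fun i => y.getD i 0 with hf
  refine Tri.for_const (fun k s' =>
      (∀ a j, j ≤ n → s'.arr aCnt (a * (n + 1) + j) = (occ f m a j k).length) ∧
      (∀ a j r, j ≤ n → r < (occ f m a j k).length →
        s'.arr aPos ((a * (n + 1) + j) * (n + 1) + r) = (occ f m a j k).getD r 0) ∧
      ∀ a, s'.arr aHas a ≠ 0 ↔ ∃ q < k, f q = a) rfl hnV ?_ ?_ ?_ ?_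
  · intro k s' _ _ hA _
    simp [hA.var rN rfl, hn]
  · simp [hc, hh, occ]
  · rintro k s' hk hv hA hB ⟨h1, h2, h3⟩
    have en : s'.var rN = n := (hA.var rN rfl).trans hn
    have em : s'.var rM = m := (hA.var rM rfl).trans hm
    have ey : ∀ i, s'.arr aY i = f i := fun i => by rw [hA.arr aY rfl]; exact hy i
    have hkm : k / m ≤ n := (Nat.div_le_self _ _).trans hk.le
    have hVk : f k * (n + 1) + n ≤ V := hVy k
    have hcnt := h1 (f k) (k / m) hkm
    have hlen := occ_length_le f m (f k) (k / m) k
    have hkey : ∀ {a j}, j ≤ n → (a * (n + 1) + j = f k * (n + 1) + k / m ↔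
        f k = a ∧ k / m = j) := by
      intro a j hj
      refine ⟨fun h => ?_, fun h => by rw [h.1, h.2]⟩
      have := mul_add_inj (by omega) (by omega) h
      exact ⟨this.1.symm, this.2.symm⟩
    refine Tri.of_wp ?_
    simp only [tableBody, Prog.wp, val_mul, val_var, val_add, val_ofNat, val_get, val_div,
      State.setVar_var, State.setVar_arr, State.setArr_var, State.setArr_arr, en, em, ey, hv]
    simp [ey, hcnt, -List.getD_eq_getElem?_getD]
    refine ⟨by omega, by omega, by omega, by omega, ?_, ?_, ?_⟩
    · intro a j hj
      rw [occ_succ, Function.update_apply]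
      simp only [hkey hj]
      split_ifs with h
      · rw [← h.1, ← h.2]; simp
      · simp [h1 a j hj]
    · intro a j r hj hr
      have hlen' := occ_length_le f m a j k
      rw [occ_succ] at hr ⊢
      rw [Function.update_apply]
      by_cases h : f k = a ∧ k / m = j
      · rw [if_pos h] at hr ⊢
        simp only [List.length_append, List.length_singleton] at hr
        obtain ⟨rfl, rfl⟩ := h
        by_cases hr' : r = (occ f m (f k) (k / m) k).length
        · simp [hr']
        · rw [if_neg (by omega), h2 _ _ r hj (by omega), List.getD_append _ _ _ _ (by omega)]
      · rw [if_neg h] at hr ⊢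
        rw [List.append_nil] at hr ⊢
        rw [if_neg, h2 a j r hj hr]
        intro hcon
        have := mul_add_inj (by omega) (by omega) hcon
        exact h ((hkey hj).1 this.1)
    · intro a
      rw [Function.update_apply]
      split_ifs with h
      · simp only [not_false_eq_true, true_iff]
        exact ⟨k, by omega, h.symm⟩
      · have := h3 a
        simp only [ne_eq] at this
        rw [this]
        refine ⟨fun ⟨q, hq, he⟩ => ⟨q, by omega, he⟩, fun ⟨q, hq, he⟩ => ⟨q, ?_, he⟩⟩
        rcases Nat.eq_or_lt_of_le hq with rfl | h'
        · exact absurd he.symm h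
        · exact h'
  · rintro s' - - h
    exact h

/-- Secures the value `1` as soon as any symbol is common. This covers the levels where sampling
would leave too few chain elements. -/
def matchBody : Prog := .ite (get aHas (get aX (var rI))) (.assign rBest 1) .skip

def matchLoop : Prog := .for rI (var rN) matchBody

def matchTime (n : ℕ) : ℕ := n * matchBody.weight + (n + 2) * (var rN).forWeight

theorem matchLoop_spec {V : ℕ} {s : State} {n : ℕ} {x y : List ℕ} (hs : s.Bdd V)
    (hn : s.var rN = n) (hx : ∀ i, s.arr aX i = x.getD i 0)
    (hh : ∀ a, s.arr aHas a ≠ 0 ↔ ∃ q < n, y.getD q 0 = a) (hb : s.var rBest = 0) :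
    Tri V matchLoop s (matchTime n) fun s' =>
      (s'.var rBest ≠ 0 → s'.var rBest = 1 ∧ ∃ p < n, ∃ q < n, y.getD q 0 = x.getD p 0) ∧
      ∀ p < n, ∀ q < n, y.getD q 0 = x.getD p 0 → s'.var rBest = 1 := by
  have hnV : n ≤ V := hn ▸ hs.var _
  refine Tri.for_const (fun k s' =>
      (s'.var rBest ≠ 0 → s'.var rBest = 1 ∧ ∃ p < n, ∃ q < n, y.getD q 0 = x.getD p 0) ∧
      ∀ p < k, ∀ q < n, y.getD q 0 = x.getD p 0 → s'.var rBest = 1) rfl hnV ?_ ?_ ?_ ?_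
  · intro k s' _ _ hA _
    simp [hA.var rN rfl, hn]
  · simp [hb]
  · rintro k s' hk hv hA hB ⟨h1, h2⟩
    have ex : ∀ i, s'.arr aX i = x.getD i 0 := fun i => by rw [hA.arr aX rfl]; exact hx i
    have eh : s'.arr aHas = s.arr aHas := hA.arr aHas rfl
    refine Tri.of_wp ?_
    simp only [matchBody, Prog.wp, val_var, val_ofNat, val_get, hv, ex, eh]
    by_cases hc : s.arr aHas (x.getD k 0) = 0
    · rw [if_pos hc]
      simp only [State.setVar_var, if_neg (show (2 : ℕ) ≠ 12 by norm_num)]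
      refine ⟨h1, fun p hp q hq he => ?_⟩
      rcases Nat.lt_succ_iff_lt_or_eq.1 hp with h | rfl
      · exact h2 p h q hq he
      · exact absurd hc ((hh _).2 ⟨q, hq, he⟩)
    · rw [if_neg hc]
      obtain ⟨q, hq, he⟩ := (hh _).1 hc
      simp only [State.setVar_var, if_neg (show (2 : ℕ) ≠ 12 by norm_num), if_true]
      exact ⟨by omega, fun _ => ⟨trivial, k, hk, q, hq, he⟩, fun _ _ _ _ _ => trivial⟩
  · rintro s' - - h
    exact h

/-! ### The deterministic first phase -/

def prepare (c₀ : ℕ) : Prog :=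
  .seq blockLenLoop (.seq setK (.seq logLoop (.seq diagLoop
    (.seq (setParams c₀) (.seq tableLoop matchLoop)))))

def prepareTime (c₀ : ℕ) : ℕ :=
  blockLenTime 1 + setK.weight + logTime 1 + diagTime 1 + (setParams c₀).weight +
    tableTime 1 + matchTime 1

/-- The state after the first phase. -/
structure Prepared (c₀ : ℕ) (x y : List ℕ) (n T L D : ℕ) (s : State) : Prop where
  ready : Ready x y n (blockLen n T) (numBlocks n (blockLen n T)) L s
  lt_pow : n < 2 ^ L
  pow_le : 2 ^ L ≤ 2 * n
  pow_D : ∃ e, D = 2 ^ e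
  le_D : 2 * numBlocks n (blockLen n T) ≤ D
  D_le : D ≤ 4 * numBlocks n (blockLen n T)
  var_T : s.var rT = T
  var_D : s.var rD = D
  var_Q : s.var rQ = 1024 * (2 ^ L * 2 ^ L)
  var_lev : s.var rLev = 2 * L + 11
  var_rep : s.var rRep = c₀ * L
  var_draws : s.var rDraws = 64 * T * (c₀ * L)
  best_le : s.var rBest ≤ lcsLen x y
  le_best : ∀ p < n, ∀ q < n, y.getD q 0 = x.getD p 0 → 1 ≤ s.var rBest

theorem one_le_blockLen {n T : ℕ} (hn : 1 ≤ n) (hT : 1 ≤ T) : 1 ≤ blockLen n T := by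
  by_contra h
  have := (blockLen_le_iff hT).1 (show blockLen n T ≤ 0 by omega)
  have := Nat.mul_pos hn hn
  omega

theorem one_le_numBlocks {n m : ℕ} (hn : 1 ≤ n) (hm : 1 ≤ m) : 1 ≤ numBlocks n m := by
  rw [numBlocks, Nat.le_div_iff_mul_le (by omega)]
  omega

theorem prepare_spec {V n T : ℕ} (c₀ : ℕ) {x y : List ℕ} (hn : 1 ≤ n) (hT : 1 ≤ T)
    (hx : x.length = n) (hy : y.length = n) (hs : (input n T x y).Bdd V)
    (hVy : ∀ i, y.getD i 0 * (n + 1) + n ≤ V)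
    (hV : 16384 * (n + 1) ^ 2 ≤ V) (hVd : 64 * T * (c₀ * (2 * n)) ≤ V) :
    Tri V (prepare c₀) (input n T x y) (prepareTime c₀ * n) fun s => ∃ L D,
      Prepared c₀ x y n T L D s := by
  set m := blockLen n T with hm
  set K := numBlocks n m with hK
  have hm1 : 1 ≤ m := one_le_blockLen hn hT
  have hK1 : 1 ≤ K := one_le_numBlocks hn hm1
  have hKn : K ≤ n := numBlocks_le hm1
  have hmn : m ≤ n := (blockLen_le_iff hT).2 (Nat.le_mul_of_pos_right _ hT)
  have hV' : 16384 * (n * n) + 16384 * n + 16384 ≤ V := by nlinarith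
  have hnn : n ≤ n * n := Nat.le_mul_of_pos_right _ hn
  refine Tri.mono (τ := blockLenTime n + (setK.weight + (logTime n + (diagTime K +
    ((setParams c₀).weight + (tableTime n + matchTime n))))))
    (Tri.seq ?_) (fun _ _ _ h => h) ?_
  · refine (blockLenLoop_spec hs (n := n) (T := T) rfl rfl hT rfl).mono ?_ le_rfl
    intro s₁ hA₁ hB₁ e1
    rw [← hm] at e1
    have n1 : s₁.var rN = n := hA₁.var rN rfl
    have T1 : s₁.var rT = T := hA₁.var rT rfl
    refine Tri.seq (Tri.of_wp ?_)
    simp only [setK, Prog.wp, val_div, val_sub, val_add, val_var, val_ofNat, n1, e1]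
    refine ⟨hKn.trans (by omega), by omega, by omega, ?_⟩
    generalize hs₂ : ((s₁.setVar rK ((n + m - 1) / m)).setVar rPow 1).setVar rD 1 = s₂
    have K2 : s₂.var rK = K := by simp [← hs₂, hK, numBlocks]
    have P2 : s₂.var rPow = 1 := by simp [← hs₂]
    have D2 : s₂.var rD = 1 := by simp [← hs₂]
    have n2 : s₂.var rN = n := by simp [← hs₂, n1]
    have T2 : s₂.var rT = T := by simp [← hs₂, T1]
    have m2 : s₂.var rM = m := by simp [← hs₂, e1]
    have L2 : s₂.var rLog = 0 := by simp [← hs₂]; exact hA₁.var rLog rfl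
    have b2 : s₂.var rBest = 0 := by simp [← hs₂]; exact hA₁.var rBest rfl
    have a2 : s₂.arr = (input n T x y).arr := by
      rw [← hs₂]
      funext b
      exact hA₁.arr b rfl
    refine Tri.seq (Tri.of_bdd fun hB₂ => ?_)
    refine (logLoop_spec hB₂ n2 hn (by omega) P2 L2).mono ?_ le_rfl
    rintro s₃ hA₃ hB₃ ⟨g1, g2, g3⟩
    refine Tri.seq ((diagLoop_spec (s := s₃) (K := K) ((hA₃.var rK rfl).trans K2) hK1 (by omega)
      ((hA₃.var rD rfl).trans D2)).mono ?_ le_rfl)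
    rintro s₄ hA₄ hB₄ ⟨f1, f2, f3⟩
    have L4 : s₄.var rLog = s₃.var rLog := hA₄.var rLog rfl
    have P4 : s₄.var rPow = 2 ^ s₄.var rLog := by rw [hA₄.var rPow rfl, g1, L4]
    have T4 : s₄.var rT = T := ((hA₄.var rT rfl).trans (hA₃.var rT rfl)).trans T2
    rw [← L4] at g2 g3
    have hlog : s₄.var rLog < 2 ^ s₄.var rLog := Nat.lt_two_pow_self
    have hQ : 2 ^ s₄.var rLog * 2 ^ s₄.var rLog ≤ 2 * n * (2 * n) := Nat.mul_le_mul g3 g3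
    have hQ' : 2 * n * (2 * n) = 4 * (n * n) := by ring
    have hrep : 64 * T * (c₀ * s₄.var rLog) ≤ V :=
      (Nat.mul_le_mul_left _ (Nat.mul_le_mul_left _ (by omega))).trans hVd
    have hrep' : c₀ * s₄.var rLog ≤ V :=
      (Nat.le_mul_of_pos_left _ (by omega)).trans hrep
    refine Tri.seq (Tri.of_wp ?_)
    simp only [setParams, Prog.wp, val_mul, val_add, val_var, val_ofNat, val_const,
      State.setVar_var]
    simp [P4, T4]
    refine ⟨by omega, by omega, hrep', hrep, ?_⟩
    generalize hs₅ : (((s₄.setVar rQ (1024 * (2 ^ s₄.var rLog * 2 ^ s₄.var rLog))).setVar rLev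
      (2 * s₄.var rLog + 11)).setVar rRep (c₀ * s₄.var rLog)).setVar rDraws
      (64 * T * (c₀ * s₄.var rLog)) = s₅
    have v5 : ∀ v < 8, s₅.var v = s₄.var v := by
      intro v hv
      rw [← hs₅]
      simp (disch := omega) only [State.setVar_var, if_neg]
    have a5 : s₅.arr = (input n T x y).arr := by
      rw [← hs₅]
      funext b
      exact ((hA₄.arr b rfl).trans (hA₃.arr b rfl)).trans (congrFun a2 b)
    have n5 : s₅.var rN = n :=
      (v5 _ (by norm_num)).trans (((hA₄.var rN rfl).trans (hA₃.var rN rfl)).trans n2)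
    have m5 : s₅.var rM = m :=
      (v5 _ (by norm_num)).trans (((hA₄.var rM rfl).trans (hA₃.var rM rfl)).trans m2)
    have K5 : s₅.var rK = K :=
      (v5 _ (by norm_num)).trans (((hA₄.var rK rfl).trans (hA₃.var rK rfl)).trans K2)
    have b5 : s₅.var rBest = 0 :=
      (v5 _ (by norm_num)).trans (((hA₄.var rBest rfl).trans (hA₃.var rBest rfl)).trans b2)
    refine Tri.seq (Tri.of_bdd fun hB₅ => ?_)
    refine (tableLoop_spec hB₅ n5 m5 (y := y) (fun i => by rw [a5]; rfl) hVy (by omega)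
      (fun i => by rw [a5]; rfl) (fun i => by rw [a5]; rfl)).mono ?_ le_rfl
    rintro s₆ hA₆ hB₆ ⟨t1, t2, t3⟩
    refine (matchLoop_spec (x := x) hB₆ ((hA₆.var rN rfl).trans n5)
      (fun i => by rw [hA₆.arr aX rfl, a5]; rfl) t3 ((hA₆.var rBest rfl).trans b5)).mono ?_ le_rfl
    rintro s₇ hA₇ hB₇ ⟨q1, q2⟩
    have v7 : ∀ v < 12, v ≠ 2 → s₇.var v = s₅.var v := by
      intro v hv hv'
      have h1 : matchLoop.writesVar v = false := by
        revert v; decide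
      have h2 : tableLoop.writesVar v = false := by
        revert v; decide
      rw [hA₇.var v h1, hA₆.var v h2]
    refine ⟨s₄.var rLog, s₄.var rD, ⟨?_, g2, g3, f1, f2, f3, ?_, ?_, ?_, ?_, ?_, ?_, ?_, ?_⟩⟩
    · refine ⟨(v7 _ (by norm_num) (by norm_num)).trans n5,
        (v7 _ (by norm_num) (by norm_num)).trans m5, (v7 _ (by norm_num) (by norm_num)).trans K5,
        (v7 _ (by norm_num) (by norm_num)).trans (v5 _ (by norm_num)), ?_, ?_, ?_⟩
      · intro i
        rw [hA₇.arr aX rfl, hA₆.arr aX rfl, a5]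
        rfl
      · rw [hA₇.arr aCnt rfl]; exact t1
      · rw [hA₇.arr aPos rfl]; exact t2
    · rw [v7 _ (by norm_num) (by norm_num), v5 _ (by norm_num), T4]
    · rw [v7 _ (by norm_num) (by norm_num), v5 _ (by norm_num)]
    · rw [v7 _ (by norm_num) (by norm_num), ← hs₅]; simp
    · rw [v7 _ (by norm_num) (by norm_num), ← hs₅]; simp
    · rw [v7 _ (by norm_num) (by norm_num), ← hs₅]; simp
    · rw [v7 _ (by norm_num) (by norm_num), ← hs₅]; simp
    · rcases Nat.eq_zero_or_pos (s₇.var rBest) with h | h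
      · omega
      · obtain ⟨h1, p, hp, q, hq, he⟩ := q1 (by omega)
        rw [h1]
        exact ((hasCommon_zero x y p q).snoc (by omega) (by omega) he.symm).le_lcsLen
    · intro p hp q hq he
      rw [q2 p hp q hq he]
  · have key : ∀ w f N : ℕ, N ≤ n → N * w + (N + 2) * f ≤ (1 * w + (1 + 2) * f) * n := by
      intro w f N hN
      have h1 : N * w ≤ n * w := Nat.mul_le_mul_right _ hN
      have h2 : (N + 2) * f ≤ 3 * n * f := Nat.mul_le_mul_right _ (by omega)
      calc _ ≤ n * w + 3 * n * f := by omega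
        _ = _ := by ring
    have key' : ∀ w f : ℕ, 2 * K * w + (2 * K + 2) * f ≤ (2 * 1 * w + (2 * 1 + 2) * f) * n := by
      intro w f
      have h1 : 2 * K * w ≤ 2 * n * w := Nat.mul_le_mul_right _ (by omega)
      have h2 : (2 * K + 2) * f ≤ 4 * n * f := Nat.mul_le_mul_right _ (by omega)
      calc _ ≤ 2 * n * w + 4 * n * f := by omega
        _ = _ := by ring
    have k1 : blockLenTime n ≤ blockLenTime 1 * n := key _ _ _ le_rfl
    have k2 : logTime n ≤ logTime 1 * n := key _ _ _ le_rfl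
    have k3 : tableTime n ≤ tableTime 1 * n := key _ _ _ le_rfl
    have k4 : matchTime n ≤ matchTime 1 * n := key _ _ _ le_rfl
    have k5 : diagTime K ≤ diagTime 1 * n := key' _ _
    have k6 : setK.weight ≤ setK.weight * n := Nat.le_mul_of_pos_right _ hn
    have k7 : (setParams c₀).weight ≤ (setParams c₀).weight * n := Nat.le_mul_of_pos_right _ hn
    simp only [prepareTime, add_mul]
    omega

end RAM

namespace RAM
open RAM.Expr

/-! ### The whole program -/

/-- The program. The constant `c₀` controls the number of repetitions. -/
def program (c₀ : ℕ) : Prog :=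
  .seq (prepare c₀) (.seq (Prog.draw rI rW rDraws rQ aTape) attempts)

/-- A bound for all numbers that occur. -/
def maxNum (A c₀ n : ℕ) : ℕ := 16384 * (A + 1) * (c₀ + 1) * (n + 1) ^ 4

/-- The running time, in units. -/
def programTime (c₀ n T L : ℕ) : ℕ :=
  prepareTime c₀ * n + attemptsTime * ((2 * L + 11 + 1) ^ 2 * ((c₀ * L + 1) * T * (L + 1))) +
    (64 * T * (c₀ * L) + 2) * 40

/-- Separates machine and probability: from here on, only averages over lists of draws matter. The
tape is a function `tp` that is known only on the cells that were drawn. -/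
theorem program_spec (A c₀ : ℕ) {n T : ℕ} {x y : List ℕ} (hn : 1 ≤ n) (hnT : n ≤ T)
    (hTn : T ≤ n ^ 2) (hx : x.length = n) (hy : y.length = n) (hxA : ∀ a ∈ x, a ≤ A * n)
    (hyA : ∀ a ∈ y, a ≤ A * n) :
    ∃ L D, n < 2 ^ L ∧ 2 ^ L ≤ 2 * n ∧ (∃ e, D = 2 ^ e) ∧
      2 * numBlocks n (blockLen n T) ≤ D ∧ D ≤ 4 * numBlocks n (blockLen n T) ∧
      ∀ (good : List ℕ → Prop) [DecidablePred good] (R : ℕ → Prop),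
        (∀ (l : List ℕ) (tp : ℕ → ℕ) (v : ℕ), l.length = 64 * T * (c₀ * L) →
          (∀ j < 64 * T * (c₀ * L), tp j = l.getD j 0) → good l → v ≤ lcsLen x y →
          (∀ p < n, ∀ q < n, y.getD q 0 = x.getD p 0 → 1 ≤ v) →
          (∀ α < 2 * L + 11, ∀ γ < 2 * L + 11, LevelBound x y n (blockLen n T)
            (numBlocks n (blockLen n T)) T D (c₀ * L) tp (2 ^ α) (2 ^ γ) v) → R v) →
        ENNReal.ofReal (drawAvg (1024 * (2 ^ L * 2 ^ L)) (64 * T * (c₀ * L))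
          fun l => if good l then 1 else 0) ≤
        haltProb (program c₀) (input n T x y)
          {r | r.2 ≤ programTime c₀ n T L * unit (maxNum A c₀ n) ∧ R r.1.output} := by
  set V := maxNum A c₀ n with hVdef
  have hT1 : 1 ≤ T := hn.trans hnT
  obtain ⟨e1, e2, e3, e4⟩ : 16384 * (n + 1) ^ 2 ≤ V ∧ 128 * c₀ * n ^ 3 ≤ V ∧
      A * n * (n + 1) + n ≤ V ∧ n ^ 2 ≤ V := by
    have h1 : 1 ≤ (A + 1) * (c₀ + 1) := Nat.one_le_iff_ne_zero.2 (by positivity)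
    have h2 : (n + 1) ^ 2 ≤ (n + 1) ^ 4 := Nat.pow_le_pow_right (by omega) (by norm_num)
    have h3 : (n + 1) ^ 3 ≤ (n + 1) ^ 4 := Nat.pow_le_pow_right (by omega) (by norm_num)
    have h4 : c₀ ≤ (A + 1) * (c₀ + 1) :=
      (Nat.le_succ c₀).trans (Nat.le_mul_of_pos_left _ (by omega))
    have h5 : A + 1 ≤ (A + 1) * (c₀ + 1) := Nat.le_mul_of_pos_right _ (by omega)
    have h6 : n ^ 3 ≤ (n + 1) ^ 3 := Nat.pow_le_pow_left (by omega) _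
    have hV : V = 16384 * ((A + 1) * (c₀ + 1)) * (n + 1) ^ 4 := by rw [hVdef, maxNum]; ring
    refine ⟨?_, ?_, ?_, ?_⟩
    · calc 16384 * (n + 1) ^ 2 = 16384 * 1 * (n + 1) ^ 2 := by ring
        _ ≤ _ := by rw [hV]; gcongr
    · calc 128 * c₀ * n ^ 3 ≤ 16384 * ((A + 1) * (c₀ + 1)) * (n + 1) ^ 4 :=
            Nat.mul_le_mul (Nat.mul_le_mul (by norm_num) h4) (h6.trans h3)
        _ = _ := hV.symm
    · calc A * n * (n + 1) + n ≤ (A + 1) * (n + 1) ^ 2 := by nlinarith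
        _ ≤ 16384 * ((A + 1) * (c₀ + 1)) * (n + 1) ^ 4 := by
            gcongr
            exact h5.trans (Nat.le_mul_of_pos_left _ (by norm_num))
        _ = _ := hV.symm
    · calc n ^ 2 ≤ (n + 1) ^ 2 := Nat.pow_le_pow_left (by omega) _
        _ ≤ 1 * (n + 1) ^ 4 := by rw [one_mul]; exact h2
        _ ≤ 16384 * ((A + 1) * (c₀ + 1)) * (n + 1) ^ 4 := by
            gcongr
            exact h1.trans (Nat.le_mul_of_pos_left _ (by norm_num))
        _ = _ := hV.symm
  have getD_le : ∀ {z : List ℕ}, (∀ a ∈ z, a ≤ A * n) → ∀ i, z.getD i 0 ≤ A * n := by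
    intro z hz i
    rcases Nat.lt_or_ge i z.length with h | h
    · rw [List.getD_eq_getElem _ _ h]
      exact hz _ (List.getElem_mem h)
    · rw [List.getD_eq_default _ _ h]
      exact Nat.zero_le _
  have hVz : ∀ {z : List ℕ}, (∀ a ∈ z, a ≤ A * n) → ∀ i, z.getD i 0 * (n + 1) + n ≤ V := by
    intro z hz i
    have := Nat.mul_le_mul_right (n + 1) (getD_le hz i)
    omega
  have hVz' : ∀ {z : List ℕ}, (∀ a ∈ z, a ≤ A * n) → ∀ i, z.getD i 0 ≤ V := by
    intro z hz i
    have h1 := hVz hz i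
    have h2 : z.getD i 0 ≤ z.getD i 0 * (n + 1) := Nat.le_mul_of_pos_right _ (by omega)
    omega
  have hTV : T ≤ V := hTn.trans e4
  have hB : (input n T x y).Bdd V := by
    refine ⟨fun v => ?_, fun b i => ?_⟩
    · simp only [input]
      split_ifs <;> omega
    · simp only [input]
      split_ifs
      · exact hVz' hxA i
      · exact hVz' hyA i
      · exact Nat.zero_le _
  have hVd : 64 * T * (c₀ * (2 * n)) ≤ V := by
    calc 64 * T * (c₀ * (2 * n)) ≤ 64 * n ^ 2 * (c₀ * (2 * n)) := by gcongr
      _ = 128 * c₀ * n ^ 3 := by ring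
      _ ≤ V := e2
  obtain ⟨s₁, t₁, hb₁, ht₁, hB₁, L, D, hP⟩ :=
    prepare_spec c₀ hn hT1 hx hy hB (hVz hyA) e1 hVd hB
  refine ⟨L, D, hP.lt_pow, hP.pow_le, hP.pow_D, hP.le_D, hP.D_le, ?_⟩
  intro good _ R hR
  have hlog : L < 2 ^ L := Nat.lt_two_pow_self
  have hpl := hP.pow_le
  have hN : 64 * T * (c₀ * L) ≤ V :=
    (Nat.mul_le_mul_left _ (Nat.mul_le_mul_left _ (by omega))).trans hVd
  -- From `2 ^ L ≤ 2 n` the power is at most `8192 n ^ 2`, which explains the constant `16384` in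
  -- `maxNum`.
  have hlev : n + 2 ^ (2 * L + 11) ≤ V := by
    have : 2 ^ (2 * L + 11) = 2048 * (2 ^ L * 2 ^ L) := by
      rw [pow_add, two_mul, pow_add]; ring
    have h2 : 2 ^ L * 2 ^ L ≤ 2 * n * (2 * n) := Nat.mul_le_mul hP.pow_le hP.pow_le
    nlinarith
  have main := le_haltProb_draw (V := V) (i := rI) (w := rW) (vN := rDraws) (vQ := rQ)
    (b := aTape) (N := 64 * T * (c₀ * L)) (P := prepare c₀) (M := attempts) (good := good)
    (R := fun s => R s.output) (s₀ := input n T x y) (s₁ := s₁) (t₀ := t₁)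
    (τ := attemptsTime * ((2 * L + 11 + 1) ^ 2 * ((c₀ * L + 1) * T * (L + 1))) * unit V)
    (by norm_num) (by norm_num) (by norm_num) (by norm_num) (by norm_num) hP.var_draws hN
    (by rw [hP.var_Q]; positivity) hB₁ hb₁ (by
      intro l s hl hlQ hs hd
      have hv : ∀ v < 12, s.var v = s₁.var v := fun v hv => hd.var v (by omega) (by omega)
      have hSet : Setup x y n (blockLen n T) (numBlocks n (blockLen n T)) L T D (2 * L + 11)
          (c₀ * L) V (s.arr aTape) s :=
        { ready := hP.ready.congr (hv _ (by norm_num)) (hv _ (by norm_num)) (hv _ (by norm_num))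
            (hv _ (by norm_num)) (hd.arr _ (by norm_num)) (hd.arr _ (by norm_num))
            (hd.arr _ (by norm_num))
          hx := hx
          hy := hy
          hn := hP.lt_pow
          hV := hlev
          hK := numBlocks_le (one_le_blockLen hn hT1)
          hT := hT1
          hVx := hVz hxA
          hVT := hN
          var_T := (hv _ (by norm_num)).trans hP.var_T
          var_D := (hv _ (by norm_num)).trans hP.var_D
          var_lev := (hv _ (by norm_num)).trans hP.var_lev
          var_rep := (hv _ (by norm_num)).trans hP.var_rep
          tape := rfl }
      have hbest : s.var rBest = s₁.var rBest := hv _ (by norm_num)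
      obtain ⟨s', t, hb, ht, -, h1, h2, h3⟩ :=
        attempts_spec hSet (hbest ▸ hP.best_le) hs
      refine ⟨s', t, hb, ht, fun hg => hR l (s.arr aTape) _ hl (fun j hj => hd.tape j (hl ▸ hj)) hg
        h2 (fun p hp q hq he => ?_) h3⟩
      have := hP.le_best p hp q hq he
      rw [hbest] at h1
      exact this.trans h1)
  rw [hP.var_Q] at main
  refine main.trans (haltProb_mono ?_)
  rintro r ⟨hr, hR'⟩
  refine ⟨hr.trans ?_, hR'⟩
  calc _ ≤ prepareTime c₀ * n * unit V +
        attemptsTime * ((2 * L + 11 + 1) ^ 2 * ((c₀ * L + 1) * T * (L + 1))) * unit V +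
        (64 * T * (c₀ * L) + 2) * (40 * unit V) := by gcongr
    _ = _ := by rw [programTime]; ring

end RAM

/-! ### Diagonals of blocks -/

theorem getElem_block {x : List ℕ} {m i k : ℕ} (h : k < (block x m i).length) :
    k < m ∧ i * m + k < x.length ∧ (block x m i)[k] = x.getD (i * m + k) 0 := by
  simp only [block, List.length_take, List.length_drop] at h
  have h' : i * m + k < x.length := by omega
  refine ⟨by omega, h', ?_⟩
  rw [List.getD_eq_getElem _ _ h']
  simp [block]

theorem lt_length_block {x : List ℕ} {m i k : ℕ} (hk : k < m) (h : i * m + k < x.length) :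
    k < (block x m i).length := by
  simp only [block, List.length_take, List.length_drop]
  omega

theorem le_numBlocks_mul {n m : ℕ} (hm : 1 ≤ m) : n ≤ numBlocks n m * m := by
  have h := Nat.div_add_mod (n + m - 1) m
  have h' := Nat.mod_lt (n + m - 1) (show 0 < m by omega)
  rw [numBlocks, mul_comm]
  omega

/-- A longest common subsequence of two blocks is a chain of matching pairs of positions. -/
theorem exists_chain_block (x y : List ℕ) {m : ℕ} (i j : ℕ) :
    ∃ ch : List (ℕ × ℕ), IsPairChain ch ∧ ch.length = lcsLen (block x m i) (block y m j) ∧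
      ∀ pq ∈ ch, pq.1 < x.length ∧ pq.2 < y.length ∧ y.getD pq.2 0 = x.getD pq.1 0 ∧
        pq.1 / m = i ∧ pq.2 / m = j := by
  obtain ⟨z, hx, hy, hz⟩ := exists_lcs (block x m i) (block y m j)
  obtain ⟨f, hf⟩ := List.sublist_iff_exists_fin_orderEmbedding_get_eq.1 hx
  obtain ⟨g, hg⟩ := List.sublist_iff_exists_fin_orderEmbedding_get_eq.1 hy
  refine ⟨List.ofFn fun k => (i * m + (f k : ℕ), j * m + (g k : ℕ)), ?_, by simpa using hz, ?_⟩
  · rw [IsPairChain, List.pairwise_ofFn]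
    intro a b hab
    have h1 : (f a : ℕ) < f b := f.strictMono hab
    have h2 : (g a : ℕ) < g b := g.strictMono hab
    exact ⟨by simpa using h1, by simpa using h2⟩
  · intro pq hpq
    rw [List.mem_ofFn] at hpq
    obtain ⟨k, rfl⟩ := hpq
    obtain ⟨h1, h2, h3⟩ := getElem_block (f k).2
    obtain ⟨h4, h5, h6⟩ := getElem_block (g k).2
    refine ⟨h2, h5, ?_, ?_, ?_⟩
    · have := (hf k).symm.trans (hg k)
      simp only [List.get_eq_getElem] at this
      rw [h3, h6] at this
      exact this.symm
    · change (i * m + (f k : ℕ)) / m = i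
      rw [mul_comm, Nat.mul_add_div (by omega), Nat.div_eq_of_lt h1, add_zero]
    · change (j * m + (g k : ℕ)) / m = j
      rw [mul_comm, Nat.mul_add_div (by omega), Nat.div_eq_of_lt h4, add_zero]

/-- The sum of the LCS lengths of the blocks on diagonal `d`. -/
noncomputable def diagWeight (x y : List ℕ) (m K d : ℕ) : ℕ :=
  ∑ i ∈ Finset.range K, if K ≤ i + d ∧ i + d < 2 * K then
    lcsLen (block x m i) (block y m (i + d - K)) else 0

/-- Consecutive blocks of a diagonal lie strictly later in both strings, so the chains of the single
blocks can be concatenated. -/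
theorem exists_chain_diag {x y : List ℕ} {n m K : ℕ} (hx : x.length = n) (hy : y.length = n)
    (d : ℕ) :
    ∃ ch : List (ℕ × ℕ), IsPairChain ch ∧ ch.length = diagWeight x y m K d ∧
      ∀ pq ∈ ch, pq.2 ∈ rowOcc x y n m K d pq.1 := by
  suffices h : ∀ k ≤ K, ∃ ch : List (ℕ × ℕ), IsPairChain ch ∧
      ch.length = (∑ i ∈ Finset.range k, if K ≤ i + d ∧ i + d < 2 * K then
        lcsLen (block x m i) (block y m (i + d - K)) else 0) ∧
      ∀ pq ∈ ch, pq.2 ∈ rowOcc x y n m K d pq.1 ∧ pq.1 / m < k by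
    obtain ⟨ch, h1, h2, h3⟩ := h K le_rfl
    exact ⟨ch, h1, h2, fun pq hpq => (h3 pq hpq).1⟩
  intro k hk
  induction k with
  | zero => exact ⟨[], List.Pairwise.nil, by simp, by simp⟩
  | succ k ih =>
    obtain ⟨ch, h1, h2, h3⟩ := ih (by omega)
    rw [Finset.sum_range_succ]
    by_cases hc : K ≤ k + d ∧ k + d < 2 * K
    · rw [if_pos hc]
      obtain ⟨ch', g1, g2, g3⟩ := exists_chain_block x y (m := m) k (k + d - K)
      refine ⟨ch ++ ch', ?_, by rw [List.length_append, h2, g2], ?_⟩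
      · rw [IsPairChain, List.pairwise_append]
        refine ⟨h1, g1, fun a ha b hb => ?_⟩
        obtain ⟨a1, a2⟩ := h3 a ha
        obtain ⟨-, -, -, b1, b2⟩ := g3 b hb
        obtain ⟨⟨-, a3, -⟩, -, -, a4⟩ := mem_rowOcc.1 a1
        have lt_of_div : ∀ u v : ℕ, u / m < v / m → u < v := fun u v h => by
          by_contra hcon
          have := Nat.div_le_div_right (c := m) (not_lt.1 hcon)
          omega
        exact ⟨lt_of_div _ _ (by omega), lt_of_div _ _ (by omega)⟩
      · intro pq hpq
        rw [List.mem_append] at hpq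
        rcases hpq with h | h
        · exact ⟨(h3 pq h).1, (h3 pq h).2.trans (by omega)⟩
        · obtain ⟨b0, b1, b2, b3, b4⟩ := g3 pq h
          refine ⟨mem_rowOcc.2 ⟨⟨by omega, by omega, by omega⟩, by omega, b2, by omega⟩, by omega⟩
    · rw [if_neg hc]
      exact ⟨ch, h1, by rw [h2, add_zero], fun pq h => ⟨(h3 pq h).1, (h3 pq h).2.trans (by omega)⟩⟩

/-- The block `(i, j)` lies on the diagonal `j + K - i`, which is below `2 K ≤ D`. -/
theorem blockLambda_le_sum_diagWeight {n T D : ℕ} (x y : List ℕ)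
    (hD : 2 * numBlocks n (blockLen n T) ≤ D) :
    blockLambda n T x y ≤ ∑ d ∈ Finset.range D,
      diagWeight x y (blockLen n T) (numBlocks n (blockLen n T)) d := by
  rw [blockLambda]
  set m := blockLen n T
  set K := numBlocks n m
  rw [Finset.sum_product]
  simp only [diagWeight]
  rw [Finset.sum_comm (s := Finset.range D)]
  refine Finset.sum_le_sum fun i hi => ?_
  rw [Finset.mem_range] at hi
  have hinj : Set.InjOn (fun j => j + K - i) (Finset.range K : Set ℕ) := by
    intro a ha b hb h
    simp only at h
    omega
  calc ∑ j ∈ Finset.range K, lcsLen (block x m i) (block y m j)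
      = ∑ j ∈ Finset.range K, (fun d => if K ≤ i + d ∧ i + d < 2 * K then
          lcsLen (block x m i) (block y m (i + d - K)) else 0) (j + K - i) := by
        refine Finset.sum_congr rfl fun j hj => ?_
        rw [Finset.mem_range] at hj
        have e : i + (j + K - i) - K = j := by omega
        simp only [e]
        rw [if_pos (by omega)]
    _ = ∑ d ∈ (Finset.range K).image (fun j => j + K - i), if K ≤ i + d ∧ i + d < 2 * K then
          lcsLen (block x m i) (block y m (i + d - K)) else 0 := by rw [Finset.sum_image hinj]
    _ ≤ _ := by
        refine Finset.sum_le_sum_of_subset fun d hd => ?_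
        rw [Finset.mem_image] at hd
        obtain ⟨j, hj, rfl⟩ := hd
        rw [Finset.mem_range] at hj ⊢
        omega

theorem sum_range_mul {M : Type*} [AddCommMonoid M] (f : ℕ → M) (k m : ℕ) :
    ∑ p ∈ Finset.range (k * m), f p =
      ∑ i ∈ Finset.range k, ∑ a ∈ Finset.range m, f (i * m + a) := by
  induction k with
  | zero => simp
  | succ k ih => rw [Nat.succ_mul, Finset.sum_range_add, ih, Finset.sum_range_succ]

theorem occ_length_eq_card (y : ℕ → ℕ) (m a j n : ℕ) :
    (occ y m a j n).length = ((Finset.range n).filter fun q => y q = a ∧ q / m = j).card := by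
  rw [occ, ← List.toFinset_card_of_nodup (List.nodup_range.filter _)]
  congr 1
  ext q
  simp

/-- Within block `j` a column is determined by its residue modulo `m`, which translates positions in
the string into positions in the block. -/
theorem sum_occ_le_matchingPairs {x y : List ℕ} {n m i j : ℕ} (hx : x.length = n)
    (hy : y.length = n) (hm : 1 ≤ m) :
    ∑ a ∈ Finset.range m, (if i * m + a < n then
      (occ (fun q => y.getD q 0) m (x.getD (i * m + a) 0) j n).length else 0) ≤
      matchingPairs (block x m i) (block y m j) := by
  have h1 : ∀ a ∈ Finset.range m, (if i * m + a < n then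
      (occ (fun q => y.getD q 0) m (x.getD (i * m + a) 0) j n).length else 0) ≤
      ((Finset.range m).filter fun b => i * m + a < n ∧ j * m + b < n ∧
        y.getD (j * m + b) 0 = x.getD (i * m + a) 0).card := by
    intro a _
    split_ifs with h
    · rw [occ_length_eq_card]
      refine Finset.card_le_card_of_injOn (fun q => q % m) ?_ ?_
      · intro q hq
        simp only [Finset.coe_filter, Finset.mem_range, Set.mem_ofPred_eq] at hq ⊢
        have e : j * m + q % m = q := by
          rw [← hq.2.2, mul_comm]; exact Nat.div_add_mod q m
        rw [e]
        exact ⟨Nat.mod_lt _ (by omega), h, hq.1, hq.2.1⟩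
      · intro q hq q' hq' he
        simp only [Finset.coe_filter, Finset.mem_range, Set.mem_ofPred_eq] at hq hq' he
        rw [← Nat.div_add_mod q m, ← Nat.div_add_mod q' m, hq.2.2, hq'.2.2, he]
    · exact Nat.zero_le _
  refine (Finset.sum_le_sum h1).trans ?_
  rw [← Finset.card_sigma, matchingPairs]
  refine le_trans (Finset.card_le_card ?_) (Finset.card_image_le (f :=
    fun p : Fin (block x m i).length × Fin (block y m j).length =>
      (⟨(p.1 : ℕ), (p.2 : ℕ)⟩ : Σ _ : ℕ, ℕ)))
  rintro ⟨a, b⟩ hab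
  simp only [Finset.mem_sigma, Finset.mem_filter, Finset.mem_range] at hab
  obtain ⟨ha, hb, h2, h3, h4⟩ := hab
  have ha' : a < (block x m i).length := lt_length_block ha (by omega)
  have hb' : b < (block y m j).length := lt_length_block hb (by omega)
  rw [Finset.mem_image]
  refine ⟨(⟨a, ha'⟩, ⟨b, hb'⟩), ?_, rfl⟩
  simp only [Finset.mem_filter, Finset.mem_univ, true_and, List.get_eq_getElem]
  rw [(getElem_block ha').2.2, (getElem_block hb').2.2, h4]

theorem sum_rowOcc_le_sum_matchingPairs {n m K : ℕ} {x y : List ℕ} (hx : x.length = n)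
    (hy : y.length = n) (hm : 1 ≤ m) (hnK : n ≤ K * m) (d N : ℕ) :
    ∑ p ∈ Finset.range N, (rowOcc x y n m K d p).length ≤
      ∑ i ∈ (Finset.range K).filter (fun i => K ≤ i + d ∧ i + d < 2 * K),
        matchingPairs (block x m i) (block y m (i + d - K)) := by
  have h0 : ∀ p, n ≤ p → (rowOcc x y n m K d p).length = 0 := by
    intro p hp
    rw [rowOcc, if_neg (by omega)]
    rfl
  calc ∑ p ∈ Finset.range N, (rowOcc x y n m K d p).length
      ≤ ∑ p ∈ Finset.range (K * m), (rowOcc x y n m K d p).length := by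
        rw [← Finset.sum_filter_add_sum_filter_not (Finset.range N) (· < n)]
        rw [Finset.sum_eq_zero (s := (Finset.range N).filter fun p => ¬ p < n) fun p hp => h0 p
          (not_lt.1 (Finset.mem_filter.1 hp).2), add_zero]
        refine Finset.sum_le_sum_of_subset fun p hp => ?_
        rw [Finset.mem_filter] at hp
        rw [Finset.mem_range]
        exact hp.2.trans_le hnK
    _ = ∑ i ∈ Finset.range K, ∑ a ∈ Finset.range m, (rowOcc x y n m K d (i * m + a)).length :=
        sum_range_mul _ _ _
    _ ≤ ∑ i ∈ Finset.range K, if K ≤ i + d ∧ i + d < 2 * K then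
          matchingPairs (block x m i) (block y m (i + d - K)) else 0 := by
        refine Finset.sum_le_sum fun i _ => ?_
        have hdiv : ∀ a ∈ Finset.range m, (i * m + a) / m = i := by
          intro a ha
          rw [Finset.mem_range] at ha
          rw [mul_comm, Nat.mul_add_div (by omega), Nat.div_eq_of_lt ha, add_zero]
        split_ifs with hc
        · refine le_trans (Finset.sum_le_sum fun a ha => ?_)
            (sum_occ_le_matchingPairs hx hy hm)
          rw [rowOcc, hdiv a ha]
          by_cases h : i * m + a < n
          · rw [if_pos ⟨h, hc⟩, if_pos h]
          · rw [if_neg (fun hh => h hh.1)]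
            exact Nat.zero_le _
        · refine (Finset.sum_eq_zero fun a ha => ?_).le
          rw [rowOcc, hdiv a ha, if_neg (fun hh => hc hh.2)]
          rfl
    _ = _ := (Finset.sum_filter _ _).symm

/-- The blocks of one diagonal form a block sequence. This is the only way in which `μ` enters. -/
theorem sum_rowOcc_le_blockMu {n T : ℕ} {x y : List ℕ} (hx : x.length = n) (hy : y.length = n)
    (hm : 1 ≤ blockLen n T) (d N : ℕ) :
    ∑ p ∈ Finset.range N, (rowOcc x y n (blockLen n T) (numBlocks n (blockLen n T)) d p).length ≤
      blockMu n T x y := by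
  classical
  have hnK := le_numBlocks_mul (n := n) hm
  rw [blockMu]
  generalize numBlocks n (blockLen n T) = K at *
  generalize blockLen n T = m at *
  refine (sum_rowOcc_le_sum_matchingPairs hx hy hm hnK d N).trans ?_
  set I := (Finset.range K).filter fun i => K ≤ i + d ∧ i + d < 2 * K with hI
  have hinj : Set.InjOn (fun i => (i, i + d - K)) (I : Set ℕ) := by
    intro a _ b _ h
    exact (Prod.ext_iff.1 h).1
  have hsum : ∑ i ∈ I, matchingPairs (block x m i) (block y m (i + d - K)) =
      ∑ p ∈ I.image (fun i => (i, i + d - K)),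
        matchingPairs (block x m p.1) (block y m p.2) := by rw [Finset.sum_image hinj]
  rw [hsum]
  refine Finset.le_sup (f := fun S : Finset (ℕ × ℕ) => ∑ p ∈ S,
    matchingPairs (block x m p.1) (block y m p.2)) ?_
  rw [Finset.mem_filter, Finset.mem_powerset]
  constructor
  · intro p hp
    rw [Finset.mem_image] at hp
    obtain ⟨i, hi, rfl⟩ := hp
    rw [hI, Finset.mem_filter, Finset.mem_range] at hi
    simp only [Finset.mem_product, Finset.mem_range]
    omega
  · intro p hp q hq hpq
    rw [Finset.mem_image] at hp hq
    obtain ⟨i, hi, rfl⟩ := hp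
    obtain ⟨i', hi', rfl⟩ := hq
    rw [hI, Finset.mem_filter, Finset.mem_range] at hi hi'
    have : i ≠ i' := by rintro rfl; exact hpq rfl
    dsimp only
    omega

/-! ### Averages of products and sums -/

/-- Independence of the draws, used for the exponential moment in the Chernoff bound. -/
theorem drawAvg_prod {Q : ℕ} (k : ℕ) (φ : ℕ → ℕ → ℝ) :
    drawAvg Q k (fun l => ∏ i ∈ Finset.range k, φ i (l.getD i 0)) =
      ∏ i ∈ Finset.range k, (∑ a ∈ Finset.range Q, φ i a) / Q := by
  induction k generalizing φ with
  | zero => simp [drawAvg]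
  | succ k ih =>
    rw [drawAvg, Finset.prod_range_succ']
    simp only [Finset.prod_range_succ', List.getD_cons_succ, List.getD_cons_zero]
    have : ∀ a, drawAvg Q k (fun l => (∏ i ∈ Finset.range k, φ (i + 1) (l.getD i 0)) * φ 0 a) =
        φ 0 a * ∏ i ∈ Finset.range k, (∑ a ∈ Finset.range Q, φ (i + 1) a) / Q := by
      intro a
      rw [← ih (fun i => φ (i + 1)), ← drawAvg_mul_left]
      simp only [mul_comm]
    simp only [this]
    rw [← Finset.sum_mul, mul_div_right_comm, mul_comm]

theorem drawAvg_sum {Q : ℕ} (hQ : 0 < Q) (k : ℕ) (φ : ℕ → ℕ → ℝ) :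
    drawAvg Q k (fun l => ∑ i ∈ Finset.range k, φ i (l.getD i 0)) =
      ∑ i ∈ Finset.range k, (∑ a ∈ Finset.range Q, φ i a) / Q := by
  induction k generalizing φ with
  | zero => simp [drawAvg]
  | succ k ih =>
    rw [drawAvg, Finset.sum_range_succ']
    simp only [Finset.sum_range_succ', List.getD_cons_succ, List.getD_cons_zero, drawAvg_add,
      drawAvg_const hQ, ih (fun i => φ (i + 1)), Finset.sum_add_distrib, add_div]
    have : (Q : ℝ) ≠ 0 := by positivity
    congr 1
    simp
    field_simp

theorem sum_mod_div {Q g : ℕ} (hQ : 0 < Q) (hg : g ∣ Q) (f : ℕ → ℝ) :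
    (∑ a ∈ Finset.range Q, f (a % g)) / Q = (∑ b ∈ Finset.range g, f b) / g := by
  obtain ⟨k, rfl⟩ := hg
  have hg0 : 0 < g := Nat.pos_of_mul_pos_right hQ
  have hk0 : 0 < k := Nat.pos_of_mul_pos_left hQ
  rw [mul_comm g k, sum_range_mul]
  have : ∀ i ∈ Finset.range k, ∑ a ∈ Finset.range g, f ((i * g + a) % g) =
      ∑ b ∈ Finset.range g, f b := by
    intro i _
    refine Finset.sum_congr rfl fun a ha => ?_
    rw [mul_comm, Nat.mul_add_mod, Nat.mod_eq_of_lt (Finset.mem_range.1 ha)]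
  rw [Finset.sum_congr rfl this]
  have h1 : (g : ℝ) ≠ 0 := by positivity
  have h2 : (k : ℝ) ≠ 0 := by positivity
  simp
  field_simp

/-- Attempts reading disjoint stretches of the tape are independent and identically distributed.
Unread draws average out. -/
theorem drawAvg_blocks {Q : ℕ} (hQ : 0 < Q) (S b rest : ℕ) (F : List ℕ → ℝ) :
    drawAvg Q (S * b + rest) (fun l => ∏ r ∈ Finset.range S, F ((l.drop (r * b)).take b)) =
      drawAvg Q b F ^ S := by
  induction S with
  | zero => simp [drawAvg_const hQ]
  | succ S ih =>
    rw [Nat.succ_mul, show S * b + b + rest = b + (S * b + rest) by ring, drawAvg_append,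
      pow_succ, ← ih, ← drawAvg_mul_left]
    refine drawAvg_congr fun l hl _ => ?_
    rw [mul_comm _ (F l), ← drawAvg_mul_left]
    refine drawAvg_congr fun l' _ _ => ?_
    rw [Finset.prod_range_succ', mul_comm]
    congr 1
    · simp [← hl]
    · refine Finset.prod_congr rfl fun r _ => ?_
      rw [List.drop_append, List.drop_eq_nil_of_le (by rw [hl]; nlinarith), List.nil_append, hl,
        Nat.succ_mul, Nat.add_sub_cancel]

/-! ### One attempt -/

/-- The attempt with random numbers `l` finds a chain of length at least `v`. -/
def Succeeds (x y : List ℕ) (n m K B D g : ℕ) (v : ℝ) (l : List ℕ) : Prop :=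
  ∃ ch, IsSampledChain x y n m K (l.getD 0 0 % D) g (fun i => l.getD (1 + i) 0 % g) ch ∧
    ∑ i ∈ Finset.range (n / g + 1), (rowOcc x y n m K (l.getD 0 0 % D)
      (i * g + l.getD (1 + i) 0 % g)).length ≤ B ∧ v ≤ ch.length

/-- The number of sampled rows of a chain. -/
theorem exists_sampled_chain {x y : List ℕ} {n m K d g : ℕ} {ch : List (ℕ × ℕ)}
    (hg : 0 < g) (hch : IsPairChain ch) (hmem : ∀ pq ∈ ch, pq.2 ∈ rowOcc x y n m K d pq.1)
    (off : ℕ → ℕ) (hoff : ∀ i, off i < g) (R : ℕ) :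
    ∃ ch', IsSampledChain x y n m K d g off ch' ∧
      ∑ i ∈ Finset.range R, (if i * g + off i ∈ ch.map Prod.fst then 1 else 0) ≤ ch'.length := by
  refine ⟨ch.filter fun pq => pq.1 % g = off (pq.1 / g), ⟨hch.filter _, ?_, ?_⟩, ?_⟩
  · intro pq hpq
    simpa using (List.mem_filter.1 hpq).2
  · intro pq hpq
    exact hmem pq (List.mem_filter.1 hpq).1
  · rw [← Finset.card_filter]
    refine le_trans ?_ ((List.toFinset_card_le ((ch.filter fun pq =>
      pq.1 % g = off (pq.1 / g)).map Prod.fst)).trans (by rw [List.length_map]))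
    refine Finset.card_le_card_of_injOn (fun i => i * g + off i) ?_ ?_
    · intro i hi
      simp only [Finset.coe_filter, Finset.mem_range, Set.mem_ofPred_eq, List.mem_map] at hi
      obtain ⟨-, pq, hpq, he⟩ := hi
      simp only [List.coe_toFinset, List.mem_map, Set.mem_ofPred_eq, List.mem_filter]
      refine ⟨pq, ⟨hpq, ?_⟩, he⟩
      rw [he, mul_comm, Nat.mul_add_mod, Nat.mul_add_div hg, Nat.mod_eq_of_lt (hoff i),
        Nat.div_eq_of_lt (hoff i)]
      simp
    · intro i _ j _ h
      exact (mul_add_inj (hoff i) (hoff j) h).1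

theorem sum_indicator_rows {ch : List (ℕ × ℕ)} (hch : IsPairChain ch) {N : ℕ}
    (hN : ∀ pq ∈ ch, pq.1 < N) :
    ∑ p ∈ Finset.range N, (if p ∈ ch.map Prod.fst then 1 else 0) = ch.length := by
  have hnd : (ch.map Prod.fst).Nodup := by
    rw [List.Nodup, List.pairwise_map]
    exact hch.imp fun h => h.1.ne
  rw [← Finset.card_filter, ← List.length_map (f := Prod.fst), ← List.toFinset_card_of_nodup hnd]
  congr 1
  ext p
  simp only [Finset.mem_filter, Finset.mem_range, List.mem_toFinset, and_iff_right_iff_imp]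
  intro hp
  obtain ⟨pq, hpq, rfl⟩ := List.mem_map.1 hp
  exact hN pq hpq

open Classical in
-- Two bad events, each of probability at most `1/4`: the sampled rows contain more than `B` pairs
-- (Markov), or fewer than `w / (4 g)` elements of `ch` are sampled (Chernoff).
theorem drawAvg_fail_diag_le {x y : List ℕ} {n m K d g B w μ Q : ℕ} {ch : List (ℕ × ℕ)}
    (hg : 0 < g) (hQ : 0 < Q) (hgQ : g ∣ Q) (hch : IsPairChain ch)
    (hmem : ∀ pq ∈ ch, pq.2 ∈ rowOcc x y n m K d pq.1) (hw : w ≤ ch.length)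
    (hμ : ∀ N, ∑ p ∈ Finset.range N, (rowOcc x y n m K d p).length ≤ μ)
    (hgw : 8 * g ≤ w) (hB : 4 * μ ≤ g * (B + 1)) :
    drawAvg Q (n / g + 1) (fun l => if ∃ ch', IsSampledChain x y n m K d g
        (fun i => l.getD i 0 % g) ch' ∧ ∑ i ∈ Finset.range (n / g + 1),
          (rowOcc x y n m K d (i * g + l.getD i 0 % g)).length ≤ B ∧
        (w : ℝ) / (4 * g) ≤ ch'.length then 0 else 1) ≤ 1 / 2 := by
  set θ : ℝ := (w : ℝ) / (4 * g) with hθ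
  set R := n / g + 1 with hR
  have hg' : (0 : ℝ) < g := by exact_mod_cast hg
  have hRn : n < R * g := by
    rw [hR, add_mul, one_mul]; exact Nat.lt_div_mul_add hg
  have hrows : ∀ pq ∈ ch, pq.1 < R * g := fun pq hpq =>
    ((mem_rowOcc.1 (hmem pq hpq)).1.1).trans hRn
  set χ : ℕ → ℕ := fun p => if p ∈ ch.map Prod.fst then 1 else 0 with hχ
  have hχ1 : ∀ p, χ p = 0 ∨ χ p = 1 := fun p => by
    simp only [hχ]; split_ifs <;> simp
  have hχsum : ∑ p ∈ Finset.range (R * g), χ p = ch.length := sum_indicator_rows hch hrows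
  -- The union bound, pointwise: the failure indicator is at most `exp θ * 2 ^ (-X)` plus the pair
  -- count divided by `B + 1`, where `X` is the number of sampled rows of `ch`.
  have point : ∀ l : List ℕ, l.length = R → (∀ a ∈ l, a < Q) →
      (if ∃ ch', IsSampledChain x y n m K d g (fun i => l.getD i 0 % g) ch' ∧
        ∑ i ∈ Finset.range R, (rowOcc x y n m K d (i * g + l.getD i 0 % g)).length ≤ B ∧
        θ ≤ ch'.length then (0 : ℝ) else 1) ≤
      Real.exp θ * (∏ i ∈ Finset.range R, (1 / 2 : ℝ) ^ χ (i * g + l.getD i 0 % g)) +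
      ((B : ℝ) + 1)⁻¹ * ∑ i ∈ Finset.range R,
        ((rowOcc x y n m K d (i * g + l.getD i 0 % g)).length : ℝ) := by
    intro l _ _
    have p1 : 0 ≤ Real.exp θ *
        (∏ i ∈ Finset.range R, (1 / 2 : ℝ) ^ χ (i * g + l.getD i 0 % g)) := by positivity
    have p2 : 0 ≤ ((B : ℝ) + 1)⁻¹ * ∑ i ∈ Finset.range R,
        ((rowOcc x y n m K d (i * g + l.getD i 0 % g)).length : ℝ) := by positivity
    split_ifs with h
    · positivity
    · push Not at h
      obtain ⟨ch', h1, h2⟩ := exists_sampled_chain hg hch hmem (fun i => l.getD i 0 % g)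
        (fun i => Nat.mod_lt _ hg) R
      rcases Nat.lt_or_ge B (∑ i ∈ Finset.range R,
        (rowOcc x y n m K d (i * g + l.getD i 0 % g)).length) with hc | hc
      · have : (1 : ℝ) ≤ ((B : ℝ) + 1)⁻¹ * ∑ i ∈ Finset.range R,
            ((rowOcc x y n m K d (i * g + l.getD i 0 % g)).length : ℝ) := by
          rw [inv_mul_eq_div, one_le_div (by positivity)]
          exact_mod_cast hc
        linarith
      · have h3 := h ch' h1 hc
        rw [Finset.prod_pow_eq_pow_sum]
        set X := ∑ i ∈ Finset.range R, χ (i * g + l.getD i 0 % g) with hX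
        have hXθ : (X : ℝ) < θ := lt_of_le_of_lt (by exact_mod_cast h2) h3
        have : (1 : ℝ) ≤ Real.exp θ * (1 / 2 : ℝ) ^ X := by
          have e1 : Real.exp (-(X : ℝ)) ≤ (1 / 2 : ℝ) ^ X := by
            have : Real.exp (-1) ≤ 1 / 2 := by
              rw [Real.exp_neg, inv_le_comm₀ (Real.exp_pos _) (by norm_num)]
              have := Real.add_one_le_exp (1 : ℝ)
              norm_num at this ⊢
              linarith
            calc Real.exp (-(X : ℝ)) = Real.exp (-1) ^ X := by
                  rw [← Real.exp_nat_mul]; congr 1; ring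
              _ ≤ _ := by gcongr
          calc (1 : ℝ) = Real.exp 0 := Real.exp_zero.symm
            _ ≤ Real.exp (θ + -(X : ℝ)) := Real.exp_le_exp.2 (by linarith)
            _ = Real.exp θ * Real.exp (-(X : ℝ)) := Real.exp_add _ _
            _ ≤ _ := by gcongr
        linarith
  refine (drawAvg_mono point).trans ?_
  rw [drawAvg_add, drawAvg_mul_left, drawAvg_mul_left,
    drawAvg_prod R (fun i a => (1 / 2 : ℝ) ^ χ (i * g + a % g)),
    drawAvg_sum hQ R (fun i a => ((rowOcc x y n m K d (i * g + a % g)).length : ℝ))]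
  -- If `p` is the fraction of rows of a group used by `ch`, its factor is `1 - p / 2 ≤ exp (-p /
  -- 2)`. The fractions sum to `ch.length / g ≥ 4 θ`.
  have hfirst : ∏ i ∈ Finset.range R,
      (∑ a ∈ Finset.range Q, (1 / 2 : ℝ) ^ χ (i * g + a % g)) / Q ≤ Real.exp (-(2 * θ)) := by
    have hfac : ∀ i ∈ Finset.range R,
        (∑ a ∈ Finset.range Q, (1 / 2 : ℝ) ^ χ (i * g + a % g)) / Q ≤
        Real.exp (-((∑ b ∈ Finset.range g, (χ (i * g + b) : ℝ)) / (2 * g))) := by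
      intro i _
      rw [sum_mod_div hQ hgQ (fun b => (1 / 2 : ℝ) ^ χ (i * g + b))]
      have : ∀ b, (1 / 2 : ℝ) ^ χ (i * g + b) = 1 - (χ (i * g + b) : ℝ) / 2 := by
        intro b
        rcases hχ1 (i * g + b) with h | h <;> rw [h] <;> norm_num
      simp only [this, Finset.sum_sub_distrib, ← Finset.sum_div]
      refine le_trans (le_of_eq ?_) (Real.one_sub_le_exp_neg _)
      simp
      field_simp
    refine (Finset.prod_le_prod (fun i _ => by positivity) hfac).trans ?_
    rw [← Real.exp_sum]
    refine Real.exp_le_exp.2 ?_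
    rw [Finset.sum_neg_distrib, ← Finset.sum_div, ← sum_range_mul (fun p => (χ p : ℝ))]
    have : (∑ p ∈ Finset.range (R * g), (χ p : ℝ)) = ch.length := by exact_mod_cast hχsum
    rw [this, neg_le_neg_iff, hθ]
    have hw' : (w : ℝ) ≤ ch.length := by exact_mod_cast hw
    calc 2 * ((w : ℝ) / (4 * g)) = w / (2 * g) := by field_simp; ring
      _ ≤ _ := by gcongr
  have hsecond : ∑ i ∈ Finset.range R, (∑ a ∈ Finset.range Q,
      ((rowOcc x y n m K d (i * g + a % g)).length : ℝ)) / Q ≤ (μ : ℝ) / g := by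
    have : ∀ i ∈ Finset.range R, (∑ a ∈ Finset.range Q,
        ((rowOcc x y n m K d (i * g + a % g)).length : ℝ)) / Q =
        (∑ b ∈ Finset.range g, ((rowOcc x y n m K d (i * g + b)).length : ℝ)) / g := fun i _ =>
      sum_mod_div hQ hgQ (fun b => ((rowOcc x y n m K d (i * g + b)).length : ℝ))
    rw [Finset.sum_congr rfl this, ← Finset.sum_div,
      ← sum_range_mul (fun p => ((rowOcc x y n m K d p).length : ℝ))]
    gcongr
    exact_mod_cast hμ (R * g)
  have b1 : Real.exp θ * ∏ i ∈ Finset.range R,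
      (∑ a ∈ Finset.range Q, (1 / 2 : ℝ) ^ χ (i * g + a % g)) / Q ≤ 1 / 4 := by
    -- Here `8 g ≤ w` is used: the first term is at most `exp θ * exp (-2 θ) ≤ exp (-2) ≤ 1/4`.
    have hθ2 : 2 ≤ θ := by
      rw [hθ, le_div_iff₀ (by positivity)]
      have : (8 : ℝ) * g ≤ w := by exact_mod_cast hgw
      linarith
    calc _ ≤ Real.exp θ * Real.exp (-(2 * θ)) := by gcongr
      _ = Real.exp (-θ) := by rw [← Real.exp_add]; congr 1; ring
      _ ≤ Real.exp (-2) := Real.exp_le_exp.2 (by linarith)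
      _ ≤ 1 / 4 := by
        have h1 := Real.add_one_le_exp (1 : ℝ)
        have h2 : Real.exp 2 = Real.exp 1 * Real.exp 1 := by rw [← Real.exp_add]; norm_num
        rw [Real.exp_neg, inv_le_comm₀ (Real.exp_pos _) (by norm_num), h2]
        norm_num at h1 ⊢
        nlinarith
  have b2 : ((B : ℝ) + 1)⁻¹ * ∑ i ∈ Finset.range R, (∑ a ∈ Finset.range Q,
      ((rowOcc x y n m K d (i * g + a % g)).length : ℝ)) / Q ≤ 1 / 4 := by
    have hB' : 4 * (μ : ℝ) ≤ g * (B + 1) := by exact_mod_cast hB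
    calc _ ≤ ((B : ℝ) + 1)⁻¹ * ((μ : ℝ) / g) := by gcongr
      _ = μ / (g * (B + 1)) := by field_simp
      _ ≤ 1 / 4 := by
        rw [div_le_iff₀ (by positivity)]
        linarith
  linarith

theorem getD_take_drop (l : List ℕ) {s b j : ℕ} (hj : j < b) :
    ((l.drop s).take b).getD j 0 = l.getD (s + j) 0 := by
  simp [List.getD_eq_getElem?_getD, hj]

open Classical in
-- The first draw picks a diagonal of weight at least `w` with probability `N / D`; conditionally on
-- this, the remaining draws succeed with probability at least `1/2`.
theorem drawAvg_fail_le {x y : List ℕ} {n m K D g B w μ Q : ℕ}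
    (hx : x.length = n) (hy : y.length = n) (hD : 0 < D) (hDQ : D ∣ Q)
    (hg : 0 < g) (hQ : 0 < Q) (hgQ : g ∣ Q)
    (hμ : ∀ d N, ∑ p ∈ Finset.range N, (rowOcc x y n m K d p).length ≤ μ)
    (hgw : 8 * g ≤ w) (hB : 4 * μ ≤ g * (B + 1)) :
    drawAvg Q (n / g + 2) (fun l => if Succeeds x y n m K B D g ((w : ℝ) / (4 * g)) l
      then 0 else 1) ≤
      1 - ({d ∈ Finset.range D | w ≤ diagWeight x y m K d}.card : ℝ) / (2 * D) := by
  set N := {d ∈ Finset.range D | w ≤ diagWeight x y m K d}.card with hN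
  have hstep : ∀ a, drawAvg Q (n / g + 1) (fun l => if Succeeds x y n m K B D g
      ((w : ℝ) / (4 * g)) (a :: l) then 0 else 1) ≤
      1 - (if w ≤ diagWeight x y m K (a % D) then 1 else 0) / 2 := by
    intro a
    split_ifs with h
    · obtain ⟨ch, h1, h2, h3⟩ := exists_chain_diag (n := n) (m := m) (K := K) hx hy (a % D)
      have := drawAvg_fail_diag_le hg hQ hgQ h1 h3 (h.trans h2.ge) (hμ (a % D)) hgw hB
      simp only [Succeeds, List.getD_cons_zero, Nat.add_comm 1, List.getD_cons_succ]
      refine this.trans (by norm_num)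
    · refine (drawAvg_mono (g := fun _ => 1) fun l _ _ => by split_ifs <;> simp).trans ?_
      rw [drawAvg_const hQ]
      norm_num
  rw [show n / g + 2 = (n / g + 1) + 1 from rfl, drawAvg]
  have hD' : (0 : ℝ) < D := by exact_mod_cast hD
  calc _ ≤ (∑ a ∈ Finset.range Q,
        (1 - (if w ≤ diagWeight x y m K (a % D) then 1 else 0 : ℝ) / 2)) / Q := by
        gcongr with a _
        exact hstep a
    _ = (∑ d ∈ Finset.range D,
        (1 - (if w ≤ diagWeight x y m K d then 1 else 0 : ℝ) / 2)) / D :=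
        sum_mod_div hQ hDQ (fun d => 1 - (if w ≤ diagWeight x y m K d then 1 else 0 : ℝ) / 2)
    _ = _ := by
        rw [Finset.sum_sub_distrib, ← Finset.sum_div, Finset.sum_boole, ← hN]
        simp
        field_simp

open Classical in
/-- The probability that none of the attempts at a level succeeds. -/
theorem le_drawAvg_exists_succeeds {x y : List ℕ} {n m K D g B w μ Q a rep k : ℕ}
    (hx : x.length = n) (hy : y.length = n) (hD : 0 < D) (hDQ : D ∣ Q)
    (hg : 0 < g) (hQ : 0 < Q) (hgQ : g ∣ Q)
    (hμ : ∀ d N, ∑ p ∈ Finset.range N, (rowOcc x y n m K d p).length ≤ μ)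
    (hgw : 8 * g ≤ w) (hB : 4 * μ ≤ g * (B + 1)) (ha : 0 < a)
    (haD : D ≤ a * {d ∈ Finset.range D | w ≤ diagWeight x y m K d}.card)
    (hk : a * rep * (n / g + 2) ≤ k) :
    1 - Real.exp (-(rep / 2)) ≤ drawAvg Q k (fun l => if ∃ r < a * rep,
      Succeeds x y n m K B D g ((w : ℝ) / (4 * g))
        ((l.drop (r * (n / g + 2))).take (n / g + 2)) then 1 else 0) := by
  set b := n / g + 2 with hb
  set F : List ℕ → ℝ := fun l => if Succeeds x y n m K B D g ((w : ℝ) / (4 * g)) l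
      then 0 else 1 with hF
  obtain ⟨rest, rfl⟩ := Nat.exists_eq_add_of_le hk
  have hF0 : ∀ l, 0 ≤ F l := fun l => by simp only [hF]; split_ifs <;> simp
  have hfail : drawAvg Q b F ≤ 1 - 1 / (2 * a) := by
    refine (drawAvg_fail_le hx hy hD hDQ hg hQ hgQ hμ hgw hB).trans ?_
    have h1 : (0 : ℝ) < a := by exact_mod_cast ha
    have h2 : (0 : ℝ) < D := by exact_mod_cast hD
    have h3 : (D : ℝ) ≤ a * {d ∈ Finset.range D | w ≤ diagWeight x y m K d}.card := by
      exact_mod_cast haD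
    rw [sub_le_sub_iff_left, div_le_div_iff₀ (by positivity) (by positivity)]
    linarith
  have hall := drawAvg_blocks hQ (a * rep) b rest F
  have hpow : drawAvg Q b F ^ (a * rep) ≤ Real.exp (-(rep / 2)) := by
    have h1 : (0 : ℝ) < a := by exact_mod_cast ha
    calc drawAvg Q b F ^ (a * rep) ≤ Real.exp (-(1 / (2 * a))) ^ (a * rep) := by
          refine pow_le_pow_left₀ (drawAvg_nonneg fun l => hF0 l) ?_ _
          exact hfail.trans (Real.one_sub_le_exp_neg _)
      _ = _ := by
          rw [← Real.exp_nat_mul]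
          congr 1
          push_cast
          field_simp
  have hpt : ∀ l : List ℕ, l.length = a * rep * b + rest → (∀ z ∈ l, z < Q) →
      (1 : ℝ) ≤ (if ∃ r < a * rep, Succeeds x y n m K B D g ((w : ℝ) / (4 * g))
        ((l.drop (r * b)).take b) then 1 else 0) +
        ∏ r ∈ Finset.range (a * rep), F ((l.drop (r * b)).take b) := by
    intro l _ _
    split_ifs with h
    · have : 0 ≤ ∏ r ∈ Finset.range (a * rep), F ((l.drop (r * b)).take b) :=
        Finset.prod_nonneg fun r _ => hF0 _
      linarith
    · push Not at h
      rw [Finset.prod_eq_one]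
      · norm_num
      · intro r hr
        simp only [hF]
        rw [if_neg (h r (Finset.mem_range.1 hr))]
  have := drawAvg_mono hpt
  rw [drawAvg_const hQ, drawAvg_add, hall] at this
  linarith

/-- An attempt that succeeds forces the value of the level up. -/
theorem AttemptBound.le_of_succeeds {x y : List ℕ} {n m K T D a g r v : ℕ} {tp : ℕ → ℕ}
    {l : List ℕ} {q : ℝ} (h : AttemptBound x y n m K T D tp a g r v)
    (hs : Succeeds x y n m K (T / a) D g q ((l.drop (r * (n / g + 2))).take (n / g + 2)))
    (htp : ∀ j < n / g + 2, tp (r * (n / g + 2) + j) = l.getD (r * (n / g + 2) + j) 0) :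
    q ≤ v := by
  obtain ⟨ch, h1, h2, h3⟩ := hs
  have e0 := htp 0 (Nat.succ_pos _)
  rw [getD_take_drop l (Nat.succ_pos (n / g + 1)), ← e0, add_zero] at h1 h2
  refine h3.trans ?_
  -- The offsets from list and tape agree only on the cells of this attempt. That is enough, since
  -- rows below `n` lie in groups of index at most `n / g`.
  have hoff : ∀ i ≤ n / g, ((l.drop (r * (n / g + 2))).take (n / g + 2)).getD (1 + i) 0 =
      tp (r * (n / g + 2) + 1 + i) := by
    intro i hi
    rw [getD_take_drop l (by omega), ← htp _ (by omega), add_assoc]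
  have : ch.length ≤ v := by
    refine h ch ⟨h1.chain, ?_, h1.mem⟩ ?_
    · intro pq hpq
      have hp := (mem_rowOcc.1 (h1.mem pq hpq)).1.1
      have := h1.off pq hpq
      rwa [hoff _ (Nat.div_le_div_right hp.le)] at this
    · refine le_of_eq_of_le (Finset.sum_congr rfl fun i hi => ?_) h2
      rw [hoff i (by have := Finset.mem_range.1 hi; omega)]
  exact_mod_cast this

/-! ### The choice of the level -/

/-- `K ≤ n / m + 1 ≤ √T + 1`, and `√T ≥ 1`. -/
theorem numBlocks_le_sqrt {n T : ℕ} (hn : 1 ≤ n) (hT : 1 ≤ T) :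
    (numBlocks n (blockLen n T) : ℝ) ≤ 2 * √(T : ℝ) := by
  set m := blockLen n T with hm
  have hm1 : 1 ≤ m := RAM.one_le_blockLen hn hT
  have hs : 1 ≤ √(T : ℝ) := Real.one_le_sqrt.2 (by exact_mod_cast hT)
  have h1 : (n : ℝ) ≤ m * √(T : ℝ) := by
    rw [← div_le_iff₀ (by linarith)]
    exact Nat.le_ceil _
  have h2 : numBlocks n m * m ≤ n + m := (Nat.div_mul_le_self _ _).trans (Nat.sub_le _ _)
  have h3 : (numBlocks n m : ℝ) * m ≤ n + m := by exact_mod_cast h2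
  have hm' : (0 : ℝ) < m := by exact_mod_cast hm1
  refine le_of_mul_le_mul_right ?_ hm'
  nlinarith

theorem diagWeight_le {x y : List ℕ} {n : ℕ} (hx : x.length = n) (hy : y.length = n)
    (m K d : ℕ) : diagWeight x y m K d ≤ n := by
  obtain ⟨ch, h1, h2, h3⟩ := exists_chain_diag (m := m) (K := K) hx hy d
  rw [← h2, ← sum_indicator_rows h1 fun pq hpq => (mem_rowOcc.1 (h3 pq hpq)).1.1]
  refine (Finset.sum_le_card_nsmul _ _ 1 fun p _ => by split_ifs <;> simp).trans ?_
  simp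

/-- A positive weight is less than twice the largest power of two below or equal to it. Summing over
all `d` gives `L` dyadic terms, the largest of which is at least the average. -/
theorem exists_dyadic_level (W : ℕ → ℕ) {D L : ℕ} (hW : ∀ d < D, W d < 2 ^ L)
    (hpos : 0 < ∑ d ∈ Finset.range D, W d) :
    ∃ κ < L, ∑ d ∈ Finset.range D, W d ≤
      2 * L * 2 ^ κ * {d ∈ Finset.range D | 2 ^ κ ≤ W d}.card := by
  set N : ℕ → ℕ := fun κ => {d ∈ Finset.range D | 2 ^ κ ≤ W d}.card with hN
  have hL : 0 < L := by
    by_contra h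
    refine hpos.ne' (Finset.sum_eq_zero fun d hd => ?_)
    have := hW d (Finset.mem_range.1 hd)
    rw [show L = 0 by omega] at this
    omega
  have hle : ∑ d ∈ Finset.range D, W d ≤ ∑ κ ∈ Finset.range L, 2 * 2 ^ κ * N κ := by
    calc ∑ d ∈ Finset.range D, W d ≤ ∑ d ∈ Finset.range D, ∑ κ ∈ Finset.range L,
          (if 2 ^ κ ≤ W d then 2 * 2 ^ κ else 0) := by
          refine Finset.sum_le_sum fun d hd => ?_
          rcases Nat.eq_zero_or_pos (W d) with h | h
          · simp [h]
          · have hlog : Nat.log 2 (W d) < L :=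
              Nat.log_lt_of_lt_pow h.ne' (hW d (Finset.mem_range.1 hd))
            have h1 := Nat.pow_log_le_self 2 h.ne'
            have h2 := Nat.lt_pow_succ_log_self (b := 2) (by norm_num) (W d)
            refine le_trans ?_ (Finset.single_le_sum
              (f := fun κ => if 2 ^ κ ≤ W d then 2 * 2 ^ κ else 0) (fun _ _ => Nat.zero_le _)
              (Finset.mem_range.2 hlog))
            simp only [if_pos h1]
            rw [pow_succ] at h2
            omega
      _ = ∑ κ ∈ Finset.range L, 2 * 2 ^ κ * N κ := by
          rw [Finset.sum_comm]
          refine Finset.sum_congr rfl fun κ _ => ?_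
          rw [← Finset.sum_filter, Finset.sum_const, smul_eq_mul, mul_comm]
  obtain ⟨κ, hκ, hmax⟩ := Finset.exists_max_image (Finset.range L) (fun κ => 2 * 2 ^ κ * N κ)
    ⟨0, Finset.mem_range.2 hL⟩
  refine ⟨κ, Finset.mem_range.1 hκ, hle.trans ((Finset.sum_le_card_nsmul _ _ _ hmax).trans ?_)⟩
  rw [Finset.card_range, smul_eq_mul]
  exact le_of_eq (by ring)

theorem exists_min_pow {a b : ℕ} (hb : 0 < b) :
    ∃ α, a ≤ 2 ^ α * b ∧ (α = 0 ∨ 2 ^ α * b < 2 * a) := by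
  have hex : ∃ α, a ≤ 2 ^ α * b :=
    ⟨a, Nat.lt_two_pow_self.le.trans (Nat.le_mul_of_pos_right _ hb)⟩
  classical
  refine ⟨Nat.find hex, Nat.find_spec hex, ?_⟩
  rcases Nat.eq_zero_or_pos (Nat.find hex) with h | h
  · exact Or.inl h
  · right
    have h1 := Nat.find_min hex (m := Nat.find hex - 1) (by omega)
    have h2 : 2 ^ Nat.find hex = 2 * 2 ^ (Nat.find hex - 1) := by
      rw [← pow_succ']; congr 1; omega
    rw [h2, mul_assoc]
    omega

/-- With `s = √T` there are three cases. If `g = 1`, then `N ≤ 8 s` suffices. Otherwise `g s² ≤ 2 a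
(n + 4 μ)`: for `4 μ ≤ n` this gives `g ≤ 4 a`, which yields the bound for `λ / s`; for `n ≤ 4 μ` it
gives `g s² ≤ 16 a μ`, which yields the bound for `λ s / μ`. In both, `a N ≤ 16 s`. -/
theorem min_le_of_level {lam μ n L w N a g D s : ℝ} (hμ : 0 ≤ μ) (hs : 1 ≤ s)
    (hL : 0 ≤ L) (hw : 0 ≤ w) (hN : 0 ≤ N) (ha : 0 ≤ a)
    (hlam : lam ≤ 2 * L * w * N) (hND : N ≤ D) (hD : D ≤ 8 * s) (haN : a * N ≤ 2 * D)
    (hnT : n ≤ s * s) (hg0 : 0 < g) (hg : g = 1 ∨ g * (s * s) ≤ 2 * (a * (n + 4 * μ))) :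
    min (lam / s) (lam * s / μ) ≤ 2048 * L * (w / (4 * g)) := by
  have hs0 : 0 < s := by linarith
  have hLw : 0 ≤ L * w := mul_nonneg hL hw
  have e : 2048 * L * (w / (4 * g)) = 512 * (L * w) / g := by field_simp; ring
  rw [e]
  rcases hg with rfl | hg
  · refine (min_le_left _ _).trans ?_
    rw [div_one, div_le_iff₀ hs0]
    calc lam ≤ 2 * (L * w) * N := by linarith
      _ ≤ 2 * (L * w) * (8 * s) := by gcongr; linarith
      _ ≤ _ := by nlinarith [mul_nonneg hLw hs0.le]
  · have hlg : lam * g ≤ 2 * (L * w) * N * g := by nlinarith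
    have haN' : a * N ≤ 16 * s := by linarith
    rcases le_total (4 * μ) n with h | h
    · refine (min_le_left _ _).trans ?_
      rw [div_le_div_iff₀ hs0 hg0]
      have h4 : g ≤ 4 * a := by
        refine le_of_mul_le_mul_right ?_ (mul_pos hs0 hs0)
        nlinarith
      calc lam * g ≤ 2 * (L * w) * N * g := hlg
        _ ≤ 2 * (L * w) * N * (4 * a) := by gcongr
        _ = 8 * (L * w) * (a * N) := by ring
        _ ≤ 8 * (L * w) * (16 * s) := by gcongr
        _ ≤ _ := by nlinarith [mul_nonneg hLw hs0.le]
    · refine (min_le_right _ _).trans ?_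
      rcases hμ.eq_or_lt with rfl | hμ
      · rw [div_zero]; positivity
      rw [div_le_div_iff₀ hμ hg0]
      refine le_of_mul_le_mul_right ?_ hs0
      have h16 : g * (s * s) ≤ 16 * (a * μ) := by nlinarith
      calc lam * s * g * s = lam * g * (s * s) := by ring
        _ ≤ 2 * (L * w) * N * g * (s * s) := by gcongr
        _ = 2 * (L * w) * N * (g * (s * s)) := by ring
        _ ≤ 2 * (L * w) * N * (16 * (a * μ)) := by gcongr
        _ = 32 * (L * w) * μ * (a * N) := by ring
        _ ≤ 32 * (L * w) * μ * (16 * s) := by gcongr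
        _ = 512 * (L * w) * μ * s := by ring

/-- A level of the program whose sampling parameters fit the strings. -/
theorem exists_level {x y : List ℕ} {n T L D : ℕ} (hn : 1 ≤ n) (hnT : n ≤ T)
    (hx : x.length = n) (hy : y.length = n) (hnL : n < 2 ^ L)
    (hKD : 2 * numBlocks n (blockLen n T) ≤ D) (hDK : D ≤ 4 * numBlocks n (blockLen n T))
    (hlam : 0 < blockLambda n T x y) :
    ∃ κ α γ, κ < L ∧ α < L + 3 ∧
      0 < {d ∈ Finset.range D | 2 ^ κ ≤
        diagWeight x y (blockLen n T) (numBlocks n (blockLen n T)) d}.card ∧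
      D ≤ 2 ^ α * {d ∈ Finset.range D | 2 ^ κ ≤
        diagWeight x y (blockLen n T) (numBlocks n (blockLen n T)) d}.card ∧
      4 * blockMu n T x y ≤ 2 ^ γ * (T / 2 ^ α + 1) ∧ 2 ^ α * (n / 2 ^ γ + 2) ≤ 64 * T ∧
      min ((blockLambda n T x y : ℝ) / √(T : ℝ))
        ((blockLambda n T x y : ℝ) * √(T : ℝ) / (blockMu n T x y : ℝ)) ≤
        2048 * L * (((2 ^ κ : ℕ) : ℝ) / (4 * (2 ^ γ : ℕ))) := by
  have hT1 : 1 ≤ T := hn.trans hnT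
  set m := blockLen n T with hm
  set K := numBlocks n m with hK
  set μ := blockMu n T x y with hμ
  set lam := blockLambda n T x y with hl
  have hsum : lam ≤ ∑ d ∈ Finset.range D, diagWeight x y m K d :=
    blockLambda_le_sum_diagWeight x y hKD
  obtain ⟨κ, hκ, hle⟩ := exists_dyadic_level (fun d => diagWeight x y m K d) (L := L)
    (fun d _ => (diagWeight_le hx hy m K d).trans_lt hnL) (hlam.trans_le hsum)
  set N := {d ∈ Finset.range D | 2 ^ κ ≤ diagWeight x y m K d}.card with hN
  have hlN : lam ≤ 2 * L * 2 ^ κ * N := hsum.trans hle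
  have hNpos : 0 < N := by
    rcases Nat.eq_zero_or_pos N with h | h
    · rw [h] at hlN; omega
    · exact h
  have hND : N ≤ D := (Finset.card_filter_le _ _).trans (by rw [Finset.card_range])
  -- About `D / N` attempts are needed to hit a heavy diagonal.
  obtain ⟨α, hα, hα'⟩ := exists_min_pow (a := D) hNpos
  -- The summand `n` limits the number of sampled rows and `4 μ` the expected number of sampled
  -- pairs, relative to the budget `T / 2 ^ α`.
  obtain ⟨γ, hγ, hγ'⟩ := exists_min_pow (a := 2 ^ α * (n + 4 * μ)) hT1
  have haN : 2 ^ α * N ≤ 2 * D := by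
    rcases hα' with h | h
    · rw [h]; omega
    · exact h.le
  have haD : 2 ^ α ≤ 2 * D := (Nat.le_mul_of_pos_right _ hNpos).trans haN
  have hKn : K ≤ n := numBlocks_le (RAM.one_le_blockLen hn hT1)
  have hKs : (K : ℝ) ≤ 2 * √(T : ℝ) := numBlocks_le_sqrt hn hT1
  have hs1 : 1 ≤ √(T : ℝ) := Real.one_le_sqrt.2 (by exact_mod_cast hT1)
  have hss : √(T : ℝ) * √(T : ℝ) = T := Real.mul_self_sqrt (by positivity)
  have hDs : (D : ℝ) ≤ 8 * √(T : ℝ) := by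
    have : (D : ℝ) ≤ 4 * K := by exact_mod_cast hDK
    linarith
  have ha0 : 0 < 2 ^ α := by positivity
  have hg0 : 0 < 2 ^ γ := by positivity
  refine ⟨κ, α, γ, hκ, ?_, hNpos, hα, ?_, ?_, ?_⟩
  · refine (Nat.pow_lt_pow_iff_right (a := 2) (by norm_num)).1 ?_
    rw [pow_add]
    omega
  · refine le_of_mul_le_mul_left ?_ ha0
    have h1 : T ≤ 2 ^ α * (T / 2 ^ α + 1) := by
      have := Nat.lt_div_mul_add (a := T) ha0
      rw [mul_add, mul_one, mul_comm]; exact this.le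
    calc 2 ^ α * (4 * μ) ≤ 2 ^ α * (n + 4 * μ) := by gcongr; omega
      _ ≤ 2 ^ γ * T := hγ
      _ ≤ 2 ^ γ * (2 ^ α * (T / 2 ^ α + 1)) := by gcongr
      _ = _ := by ring
  -- The remaining term is `2 * 2 ^ α ≤ 4 D ≤ 32 T`. The total of `33 T` passes the test with
  -- threshold `64 T`.
  · have h1 : 2 ^ α * (n / 2 ^ γ) ≤ T := by
      refine le_of_mul_le_mul_left ?_ hg0
      calc 2 ^ γ * (2 ^ α * (n / 2 ^ γ)) = 2 ^ α * (n / 2 ^ γ * 2 ^ γ) := by ring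
        _ ≤ 2 ^ α * n := by gcongr; exact Nat.div_mul_le_self _ _
        _ ≤ 2 ^ α * (n + 4 * μ) := by gcongr; omega
        _ ≤ _ := hγ
    have h2 : D ≤ 8 * T := by
      have : (D : ℝ) ≤ 8 * T := by nlinarith
      exact_mod_cast this
    rw [mul_add]
    omega
  · refine min_le_of_level (n := n) (N := N) (a := (2 ^ α : ℕ)) (D := D) (Nat.cast_nonneg _) hs1
      (Nat.cast_nonneg _) (Nat.cast_nonneg _) (Nat.cast_nonneg _)
      (Nat.cast_nonneg _) ?_ ?_ hDs ?_ ?_ ?_ ?_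
    · exact_mod_cast hlN
    · exact_mod_cast hND
    · exact_mod_cast haN
    · rw [hss]; exact_mod_cast hnT
    · exact_mod_cast hg0
    · rw [hss]
      rcases hγ' with h | h
      · left; simp [h]
      · right; exact_mod_cast h.le

/-! ### The output of the program -/

namespace RAM

theorem dvd_drawBound {e L : ℕ} (he : e ≤ L + 10) : 2 ^ e ∣ 1024 * (2 ^ L * 2 ^ L) := by
  rw [show 1024 * (2 ^ L * 2 ^ L) = 2 ^ (10 + (L + L)) by rw [pow_add, pow_add]; norm_num]
  exact pow_dvd_pow 2 (by omega)

-- Taking every tape as good gives the statements that hold with probability one. For the lower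
-- bound, the good tapes are those on which some attempt of the level from `exists_level` succeeds.
set_option maxHeartbeats 1000000 in
theorem program_bounds (A c₀ : ℕ) {n T : ℕ} {x y : List ℕ} (hn : 1 ≤ n) (hnT : n ≤ T)
    (hTn : T ≤ n ^ 2) (hx : x.length = n) (hy : y.length = n) (hxA : ∀ a ∈ x, a ≤ A * n)
    (hyA : ∀ a ∈ y, a ≤ A * n) :
    ∃ L, n < 2 ^ L ∧ 2 ^ L ≤ 2 * n ∧
      haltProb (program c₀) (input n T x y)
        {r | r.2 ≤ programTime c₀ n T L * unit (maxNum A c₀ n) ∧ r.1.output ≤ lcsLen x y} = 1 ∧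
      ENNReal.ofReal (1 - Real.exp (-((c₀ * L : ℕ) / 2))) ≤
        haltProb (program c₀) (input n T x y)
          {r | min ((blockLambda n T x y : ℝ) / √(T : ℝ))
              ((blockLambda n T x y : ℝ) * √(T : ℝ) / (blockMu n T x y : ℝ)) ≤
            4096 * L * (r.1.output : ℝ)} := by
  classical
  have hT1 : 1 ≤ T := hn.trans hnT
  obtain ⟨L, D, hnL, hLn, ⟨e, he⟩, hKD, hDK, hspec⟩ :=
    program_spec A c₀ hn hnT hTn hx hy hxA hyA
  have hQ : 0 < 1024 * (2 ^ L * 2 ^ L) := by positivity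
  have sure : ∀ R : ℕ → Prop, (∀ v, v ≤ lcsLen x y →
      (∀ p < n, ∀ q < n, y.getD q 0 = x.getD p 0 → 1 ≤ v) → R v) →
      1 ≤ haltProb (program c₀) (input n T x y)
        {r | r.2 ≤ programTime c₀ n T L * unit (maxNum A c₀ n) ∧ R r.1.output} := by
    intro R hR
    have := hspec (fun _ => True) R fun l tp v _ _ _ h1 h2 _ => hR v h1 h2
    simpa [drawAvg_const hQ] using this
  refine ⟨L, hnL, hLn, le_antisymm (haltProb_le_one) (sure _ fun v h _ => h), ?_⟩
  set target := min ((blockLambda n T x y : ℝ) / √(T : ℝ))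
    ((blockLambda n T x y : ℝ) * √(T : ℝ) / (blockMu n T x y : ℝ)) with htarget
  have surely : (∀ v, v ≤ lcsLen x y →
      (∀ p < n, ∀ q < n, y.getD q 0 = x.getD p 0 → 1 ≤ v) → target ≤ 4096 * L * (v : ℝ)) →
      ENNReal.ofReal (1 - Real.exp (-((c₀ * L : ℕ) / 2))) ≤
        haltProb (program c₀) (input n T x y) {r | target ≤ 4096 * L * (r.1.output : ℝ)} := by
    intro h
    refine le_trans ?_ ((sure _ h).trans (haltProb_mono fun r hr => hr.2))
    rw [ENNReal.ofReal_le_one]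
    have := Real.exp_pos (-((c₀ * L : ℕ) / 2))
    linarith
  rcases Nat.eq_zero_or_pos (blockLambda n T x y) with hlam | hlam
  · refine surely fun v _ _ => ?_
    rw [htarget, hlam]
    simp
    positivity
  obtain ⟨κ, α, γ, hκ, hα, hN, haD, hB, hbudget, hmin⟩ :=
    exists_level hn hnT hx hy hnL hKD hDK hlam
  -- In the first case `w / (4 g) ≤ 2`, and the value `1` from a single matching pair suffices on
  -- every tape. It exists because a diagonal of positive weight has a nonempty chain.
  rcases Nat.lt_or_ge (2 ^ κ) (8 * 2 ^ γ) with hsmall | hlarge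
  · refine surely fun v _ hv => ?_
    have hv1 : 1 ≤ v := by
      obtain ⟨d, hd⟩ := Finset.card_pos.1 hN
      obtain ⟨ch, -, h2, h3⟩ := exists_chain_diag (m := blockLen n T)
        (K := numBlocks n (blockLen n T)) hx hy d
      have hlen : 0 < ch.length := by
        rw [h2]
        exact (Nat.pow_pos (by norm_num)).trans_le (Finset.mem_filter.1 hd).2
      have h4 := mem_rowOcc.1 (h3 _ (List.getElem_mem hlen))
      exact hv _ h4.1.1 _ h4.2.1 h4.2.2.1
    have hv1' : (1 : ℝ) ≤ v := by exact_mod_cast hv1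
    have hq : ((2 ^ κ : ℕ) : ℝ) / (4 * (2 ^ γ : ℕ)) ≤ 2 := by
      have h8 : ((2 ^ κ : ℕ) : ℝ) ≤ 8 * (2 ^ γ : ℕ) := by exact_mod_cast hsmall.le
      rw [div_le_iff₀ (by positivity)]
      linarith
    calc target ≤ 2048 * L * (((2 ^ κ : ℕ) : ℝ) / (4 * (2 ^ γ : ℕ))) := hmin
      _ ≤ 2048 * L * 2 := by gcongr
      _ = 4096 * L * 1 := by ring
      _ ≤ _ := by gcongr
  · have hγ : γ < L := by
      refine lt_of_le_of_lt ?_ hκ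
      refine (Nat.pow_le_pow_iff_right (a := 2) (by norm_num)).1 ?_
      omega
    have hKn : numBlocks n (blockLen n T) ≤ n := numBlocks_le (one_le_blockLen hn hT1)
    have hD0 : 0 < D := he ▸ Nat.pow_pos (by norm_num)
    have heL : e < L + 2 := by
      refine (Nat.pow_lt_pow_iff_right (a := 2) (by norm_num)).1 ?_
      rw [← he, pow_add]
      omega
    have hdraws : 2 ^ α * (c₀ * L) * (n / 2 ^ γ + 2) ≤ 64 * T * (c₀ * L) :=
      calc _ = 2 ^ α * (n / 2 ^ γ + 2) * (c₀ * L) := by ring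
        _ ≤ _ := by gcongr
    have havg := le_drawAvg_exists_succeeds (Q := 1024 * (2 ^ L * 2 ^ L)) (rep := c₀ * L)
      (B := T / 2 ^ α) hx hy hD0 (he ▸ dvd_drawBound (by omega)) (by positivity) hQ
      (dvd_drawBound (by omega))
      (fun d M => sum_rowOcc_le_blockMu hx hy (one_le_blockLen hn hT1) d M) hlarge hB
      (Nat.pow_pos (by norm_num)) haD hdraws
    refine (ENNReal.ofReal_le_ofReal havg).trans ?_
    refine (hspec _ (fun v => target ≤ 4096 * L * (v : ℝ)) ?_).trans
      (haltProb_mono fun r hr => hr.2)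
    rintro l tp v - htp ⟨r, hr, hs⟩ - - hlev
    have hbound := hlev α (by omega) γ (by omega) hbudget r hr
    have hq := hbound.le_of_succeeds hs fun j hj => htp _ (by
      refine lt_of_lt_of_le ?_ hdraws
      calc r * (n / 2 ^ γ + 2) + j < r * (n / 2 ^ γ + 2) + (n / 2 ^ γ + 2) := by gcongr
        _ = (r + 1) * (n / 2 ^ γ + 2) := by ring
        _ ≤ _ := by gcongr; omega)
    calc target ≤ 2048 * L * (((2 ^ κ : ℕ) : ℝ) / (4 * (2 ^ γ : ℕ))) := hmin
      _ ≤ 2048 * L * v := by gcongr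
      _ ≤ _ := by gcongr; norm_num

/-! ### From machine units to powers of `1 + log n` -/

theorem unit_maxNum_le (A c₀ : ℕ) {n L : ℕ} (hnL : n < 2 ^ L) :
    unit (maxNum A c₀ n) ≤ 16 + A + c₀ + 4 * L := by
  have : maxNum A c₀ n < 2 ^ (15 + A + c₀ + 4 * L) := by
    have h1 : A + 1 ≤ 2 ^ A := Nat.lt_two_pow_self
    have h2 : c₀ + 1 ≤ 2 ^ c₀ := Nat.lt_two_pow_self
    have h3 : n + 1 ≤ 2 ^ L := hnL
    calc maxNum A c₀ n ≤ 16384 * 2 ^ A * 2 ^ c₀ * (2 ^ L) ^ 4 := by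
          rw [maxNum]; gcongr
      _ < 32768 * 2 ^ A * 2 ^ c₀ * (2 ^ L) ^ 4 := by gcongr; norm_num
      _ = _ := by rw [pow_add, pow_add, pow_add, ← pow_mul, mul_comm L 4]; norm_num
  have := Nat.size_le.2 this
  rw [unit]
  omega

/-- The factor of the running time in front of the power of the logarithm. -/
def timeFactor (A c₀ : ℕ) : ℕ :=
  (prepareTime c₀ + attemptsTime * (256 * ((2 * c₀ + 1) * 3)) + (128 * c₀ + 2) * 40) *
    (24 + A + c₀)

/-- The exponent `5` consists of two logarithms for the levels and one each for the repetitions, the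
binary search and the bit length of the numbers. -/
theorem programTime_le (A c₀ : ℕ) {n T L : ℕ} {ℓ : ℝ} (hn : 1 ≤ n) (hnT : n ≤ T)
    (hnL : n < 2 ^ L) (hℓ : 1 ≤ ℓ) (hL : (L : ℝ) ≤ 2 * ℓ) :
    ((programTime c₀ n T L * unit (maxNum A c₀ n) : ℕ) : ℝ) ≤ timeFactor A c₀ * ℓ ^ 5 * T := by
  have hT : (1 : ℝ) ≤ T := by exact_mod_cast hn.trans hnT
  have hnT' : (n : ℝ) ≤ T := by exact_mod_cast hnT
  have hu : (unit (maxNum A c₀ n) : ℝ) ≤ (24 + A + c₀) * ℓ := by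
    have h1 : (unit (maxNum A c₀ n) : ℝ) ≤ 16 + A + c₀ + 4 * L := by
      exact_mod_cast unit_maxNum_le A c₀ hnL
    have h2 : (0 : ℝ) ≤ (16 + A + c₀) * (ℓ - 1) := by
      have : 0 ≤ ℓ - 1 := by linarith
      positivity
    linarith
  have hℓ4 : 1 ≤ ℓ ^ 4 := one_le_pow₀ hℓ
  have h14 : ℓ ≤ ℓ ^ 4 := le_self_pow₀ hℓ (by norm_num)
  have hp : (programTime c₀ n T L : ℝ) ≤ (prepareTime c₀ + attemptsTime * (256 * ((2 * c₀ + 1) * 3)) +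
      (128 * c₀ + 2) * 40) * ℓ ^ 4 * T := by
    rw [programTime]
    push_cast
    have t1 : (prepareTime c₀ : ℝ) * n ≤ prepareTime c₀ * (ℓ ^ 4 * T) := by
      gcongr
      nlinarith
    have t2 : (attemptsTime : ℝ) * ((2 * L + 11 + 1) ^ 2 * ((c₀ * L + 1) * T * (L + 1))) ≤
        attemptsTime * (256 * ((2 * c₀ + 1) * 3) * (ℓ ^ 4 * T)) := by
      have a1 : (2 * L + 11 + 1 : ℝ) ≤ 16 * ℓ := by linarith
      have a2 : (c₀ * L + 1 : ℝ) ≤ (2 * c₀ + 1) * ℓ := by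
        have : (c₀ : ℝ) * L ≤ c₀ * (2 * ℓ) := by gcongr
        linarith
      have a3 : (L + 1 : ℝ) ≤ 3 * ℓ := by linarith
      calc (attemptsTime : ℝ) * ((2 * L + 11 + 1) ^ 2 * ((c₀ * L + 1) * T * (L + 1))) ≤
          attemptsTime * ((16 * ℓ) ^ 2 * (((2 * c₀ + 1) * ℓ) * T * (3 * ℓ))) := by gcongr
        _ = _ := by ring
    have t3 : (64 * T * (c₀ * L) + 2 : ℝ) * 40 ≤ (128 * c₀ + 2) * 40 * (ℓ ^ 4 * T) := by
      have b1 : (64 * T * (c₀ * L) : ℝ) ≤ 64 * T * (c₀ * (2 * ℓ ^ 4)) := by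
        gcongr
        linarith
      have b2 : (1 : ℝ) ≤ ℓ ^ 4 * T := one_le_mul_of_one_le_of_one_le hℓ4 hT
      nlinarith
    linarith
  calc ((programTime c₀ n T L * unit (maxNum A c₀ n) : ℕ) : ℝ)
      = (programTime c₀ n T L : ℝ) * unit (maxNum A c₀ n) := by push_cast; ring
    _ ≤ ((prepareTime c₀ + attemptsTime * (256 * ((2 * c₀ + 1) * 3)) +
      (128 * c₀ + 2) * 40) * ℓ ^ 4 * T) * ((24 + A + c₀) * ℓ) := by gcongr
    _ = _ := by rw [timeFactor]; push_cast; ring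

end RAM

theorem mainTheorem4 (c : ℝ) (hc : 0 < c) (A : ℕ) :
    ∃ (P : RAM.Prog) (C : ℝ) (k : ℕ), 0 < C ∧
      ∀ (n T : ℕ) (x y : List ℕ), 1 ≤ n → n ≤ T → T ≤ n ^ 2 →
        x.length = n → y.length = n →
        (∀ a ∈ x, a ≤ A * n) → (∀ a ∈ y, a ≤ A * n) →
        RAM.expectedTime P (RAM.input n T x y) ≤
            ENNReal.ofReal (C * (1 + Real.log n) ^ k * T) ∧
        RAM.haltProb P (RAM.input n T x y) {r | r.1.output ≤ lcsLen x y} = 1 ∧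
        ENNReal.ofReal (1 - (n : ℝ) ^ (-c)) ≤
          RAM.haltProb P (RAM.input n T x y)
            {r | min ((blockLambda n T x y : ℝ) / √(T : ℝ))
                    ((blockLambda n T x y : ℝ) * √(T : ℝ) / (blockMu n T x y : ℝ))
                  / (C * (1 + Real.log n) ^ k) ≤ (r.1.output : ℝ)} := by
  -- With `c₀ * L` repetitions the failure probability is at most `exp (-c₀ L / 2) ≤ n ^ (-c)`, as
  -- `L ≥ log n`.
  obtain ⟨c₀, hc₀⟩ := exists_nat_ge (2 * c)
  -- One constant serves both bounds: `timeFactor` for the time, and `8192` for the quality, from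
  -- `4096 L ≤ 8192 ℓ`.
  refine ⟨RAM.program c₀, RAM.timeFactor A c₀ + 8192, 5, by positivity, ?_⟩
  intro n T x y hn hnT hTn hx hy hxA hyA
  obtain ⟨L, hnL, hLn, hsure, hprob⟩ := RAM.program_bounds A c₀ hn hnT hTn hx hy hxA hyA
  set ℓ : ℝ := 1 + Real.log n with hℓdef
  have hn' : (1 : ℝ) ≤ n := by exact_mod_cast hn
  have hlog : 0 ≤ Real.log n := Real.log_nonneg hn'
  have hℓ : 1 ≤ ℓ := by linarith
  have hlog2 := Real.log_two_gt_d9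
  have hlog2' := Real.log_two_lt_d9
  have hL : (L : ℝ) ≤ 2 * ℓ := by
    have h1 : Real.log ((2 : ℝ) ^ L) ≤ Real.log (2 * n) :=
      Real.log_le_log (by positivity) (by exact_mod_cast hLn)
    rw [Real.log_pow, Real.log_mul (by norm_num) (by positivity)] at h1
    nlinarith
  have hL' : Real.log n ≤ L := by
    have h1 : Real.log n ≤ Real.log ((2 : ℝ) ^ L) :=
      Real.log_le_log (by positivity) (by exact_mod_cast hnL.le)
    rw [Real.log_pow] at h1
    have : (0 : ℝ) ≤ L := Nat.cast_nonneg _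
    nlinarith
  have hℓ5 : 1 ≤ ℓ ^ 5 := one_le_pow₀ hℓ
  refine ⟨?_, ?_, ?_⟩
  · refine (RAM.expectedTime_le (B := RAM.programTime c₀ n T L * RAM.unit (RAM.maxNum A c₀ n))
      (le_antisymm (RAM.haltProb_le_one)
        (hsure.ge.trans (RAM.haltProb_mono fun r hr => hr.1)))).trans ?_
    rw [← ENNReal.ofReal_natCast]
    refine ENNReal.ofReal_le_ofReal ((RAM.programTime_le A c₀ hn hnT hnL hℓ hL).trans ?_)
    gcongr
    linarith
  · exact le_antisymm (RAM.haltProb_le_one)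
      (hsure.ge.trans (RAM.haltProb_mono fun r hr => hr.2))
  · refine le_trans (ENNReal.ofReal_le_ofReal ?_) (hprob.trans (RAM.haltProb_mono ?_))
    · rw [sub_le_sub_iff_left, Real.rpow_def_of_pos (by linarith), Real.exp_le_exp]
      push_cast
      have : Real.log n * c ≤ L * (c₀ / 2) := by
        gcongr
        linarith
      linarith
    · intro r hr
      simp only [Set.mem_ofPred_eq] at hr ⊢
      rw [div_le_iff₀ (by positivity)]
      refine hr.trans ?_
      have h0 : (0 : ℝ) ≤ r.1.output := Nat.cast_nonneg _
      have h1 : 4096 * (L : ℝ) ≤ (RAM.timeFactor A c₀ + 8192) * ℓ ^ 5 := by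
        have h2 : ℓ ≤ ℓ ^ 5 := le_self_pow₀ hℓ (by norm_num)
        have h3 : (0 : ℝ) ≤ RAM.timeFactor A c₀ * ℓ ^ 5 := by positivity
        linarith
      rw [mul_comm (r.1.output : ℝ)]
      gcongr
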